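/- All graphs are finite multigraphs: parallel edges are allowed (two parallel edges form a cycle with two vertices), self-loops are not. Let $G=(V,E)$ be such a graph with edge weights $\omega\colon E\to\{0,1\}$, and let the length of a cycle be the total weight of its edges. A cactus is a connected graph in which every edge belongs to at most one cycle; an odd cactus is a cactus in which every cycle has odd length; a forest of odd cacti is a graph each of whose connected components is an odd cactus. In (weighted) Disjoint Even Cycle Transversal the input consists of $G$, $\omega$, an integer $k\ge 0$, and a set $S\subseteq V$ such that $G[V\setminus S]$ is a forest of odd cacti, and the task is to find a set $X\subseteq V\setminus S$ with $|X|\le k$ such that $G[V\setminus X]$ is a forest of odd cacti, or to report that no such set exists. Then there is a deterministic algorithm that solves every instance with $|S|\le k+1$ in time $O^*(16.64^k)$, that is, in at most $16.64^k\cdot p(|V|+|E|)$ steps for a fixed polynomial $p$. In particular (taking $\omega\equiv 1$, so that the length of a cycle is its number of vertices), unweighted Disjoint Even Cycle Transversal with $|S|\le k+1$ can be solved in time $O^*(16.64^k)$. -/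

import Mathlib

open scoped Graph

/-! ### Cycles, cacti and odd cacti in multigraphs

Multigraphs are Mathlib's `Graph α β` (vertices in `α`, edges in `β`, parallel edges allowed). -/

namespace EvenCycle

/-- A cycle of a multigraph: at least two pairwise distinct vertices `v 0, …, v (len - 1)` and
pairwise distinct edges, the edge `e i` joining `v i` to its cyclic successor. Two parallel edges
form a cycle with two vertices. -/
structure GraphCycle {α β : Type*} (G : Graph α β) where
  len : ℕ
  two_le : 2 ≤ len
  v : Fin len → α
  e : Fin len → β
  v_inj : Function.Injective v
  e_inj : Function.Injective e
  link : ∀ i, G.IsLink (e i) (v i) (v (finRotate len i))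

/-- The set of edges of a cycle (it determines the cycle as a subgraph). -/
def GraphCycle.edges {α β : Type*} {G : Graph α β} (C : GraphCycle G) : Set β := Set.range C.e

/-- The length of a cycle with respect to 0/1 edge weights: the total weight of its edges. -/
def GraphCycle.weight {α β : Type*} {G : Graph α β} (C : GraphCycle G) (w : β → Fin 2) : ℕ :=
  ∑ i, (w (C.e i) : ℕ)

/-- If all weights are `1`, the length of a cycle is its number of vertices. -/
theorem GraphCycle.weight_one {α β : Type*} {G : Graph α β} (C : GraphCycle G) :
    C.weight (fun _ => 1) = C.len := by
  simp [GraphCycle.weight]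

/-- Any two vertices are joined by a walk. -/
def IsConnected {α β : Type*} (G : Graph α β) : Prop :=
  ∀ x ∈ V(G), ∀ y ∈ V(G), Relation.ReflTransGen G.Adj x y

/-- The connected component of `x`, as an induced subgraph. -/
def component {α β : Type*} (G : Graph α β) (x : α) : Graph α β :=
  G.induce {y | y ∈ V(G) ∧ Relation.ReflTransGen G.Adj x y}

/-- A cactus: a connected graph in which every edge belongs to at most one cycle. -/
def IsCactus {α β : Type*} (G : Graph α β) : Prop :=
  IsConnected G ∧ ∀ (C D : GraphCycle G) (e : β), e ∈ C.edges → e ∈ D.edges → C.edges = D.edges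

/-- An odd cactus: a cactus in which every cycle has odd length. -/
def IsOddCactus {α β : Type*} (G : Graph α β) (w : β → Fin 2) : Prop :=
  IsCactus G ∧ ∀ C : GraphCycle G, Odd (C.weight w)

/-- A forest of odd cacti: every connected component is an odd cactus. -/
def IsOddCactusForest {α β : Type*} (G : Graph α β) (w : β → Fin 2) : Prop :=
  ∀ x ∈ V(G), IsOddCactus (component G x) w

/-! ### Instances of the weighted disjoint even cycle transversal problem -/

/-- A finite loopless multigraph with vertices `0, …, n - 1` and edges `0, …, m - 1`, with 0/1 edge
weights, together with a vertex set `S` and a number `k`. -/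
structure Inst where
  n : ℕ
  m : ℕ
  ends : Fin m → Fin n × Fin n
  loopless : ∀ e, (ends e).1 ≠ (ends e).2
  weight : Fin m → Fin 2
  S : Finset (Fin n)
  k : ℕ

/-- The multigraph of an instance. -/
def Inst.graph (I : Inst) : Graph (Fin I.n) (Fin I.m) where
  vertexSet := Set.univ
  IsLink e x y := I.ends e = (x, y) ∨ I.ends e = (y, x)
  isLink_symm := fun _ _ => ⟨fun _ _ h => h.symm⟩
  eq_or_eq_of_isLink_of_isLink := by
    intro e x y v w h h'
    rcases h with h | h <;> rcases h' with h' | h' <;> rw [h] at h' <;> simp_all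
  left_mem_of_isLink := fun _ _ _ _ => Set.mem_univ _

/-- Deleting `S` leaves a forest of odd cacti. -/
def Inst.IsValid (I : Inst) : Prop :=
  IsOddCactusForest (I.graph.deleteVerts (I.S : Set (Fin I.n))) I.weight

/-- `X` is disjoint from `S`, has at most `k` vertices, and its removal leaves a forest of odd
cacti. -/
def Inst.IsSolution (I : Inst) (X : Finset (Fin I.n)) : Prop :=
  Disjoint X I.S ∧ X.card ≤ I.k ∧
    IsOddCactusForest (I.graph.deleteVerts (X : Set (Fin I.n))) I.weight

end EvenCycle

/-! ### The machine model

First-order recursive programs over binary trees (LISP-style), with call-by-value evaluation. Every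
evaluation step (variable lookup, forming `nil` or a pair, taking a pair apart, binding a variable,
calling a function) has cost one. Each is a bounded number of pointer operations, so that running
times agree up to a polynomial with those of Turing machines and random access machines. -/

namespace TreeMachine

/-- Data: binary trees. -/
inductive Data where
  | nil : Data
  | node : Data → Data → Data

/-- Expressions; variables are indices into the current environment, the most recently bound
variable having index `0`.
* `bind a b` evaluates `a`, binds the value, and evaluates `b`;
* `case a b c` evaluates `a`; if the value is `nil` it evaluates `b`, and if it is `node x y` it
  evaluates `c` with `x` bound as variable `0` and `y` as variable `1`;
* `call f a` applies the `f`-th function of the program to the value of `a`. -/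
inductive Expr where
  | var : ℕ → Expr
  | nil : Expr
  | node : Expr → Expr → Expr
  | bind : Expr → Expr → Expr
  | case : Expr → Expr → Expr → Expr
  | call : ℕ → Expr → Expr

/-- A program is a finite list of bodies of (mutually recursive) functions of one argument, which
is variable `0` of the body. The function with index `0` is the main function. -/
abbrev Program := List Expr

/-- `Eval P env a d t`: in program `P`, under the environment `env`, the expression `a` evaluates to
`d` in exactly `t` steps. -/
inductive Eval (P : Program) : List Data → Expr → Data → ℕ → Prop
  | var {env : List Data} {i : ℕ} {d : Data} :
      env[i]? = some d → Eval P env (.var i) d 1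
  | nil {env : List Data} :
      Eval P env .nil .nil 1
  | node {env : List Data} {a b : Expr} {x y : Data} {s t : ℕ} :
      Eval P env a x s → Eval P env b y t → Eval P env (.node a b) (.node x y) (s + t + 1)
  | bind {env : List Data} {a b : Expr} {x y : Data} {s t : ℕ} :
      Eval P env a x s → Eval P (x :: env) b y t → Eval P env (.bind a b) y (s + t + 1)
  | case_nil {env : List Data} {a b c : Expr} {z : Data} {s t : ℕ} :
      Eval P env a .nil s → Eval P env b z t → Eval P env (.case a b c) z (s + t + 1)
  | case_node {env : List Data} {a b c : Expr} {x y z : Data} {s t : ℕ} :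
      Eval P env a (.node x y) s → Eval P (x :: y :: env) c z t →
      Eval P env (.case a b c) z (s + t + 1)
  | call {env : List Data} {f : ℕ} {a body : Expr} {x y : Data} {s t : ℕ} :
      P[f]? = some body → Eval P env a x s → Eval P [x] body y t →
      Eval P env (.call f a) y (s + t + 1)

/-- Evaluation is deterministic: the value and the number of steps are unique. -/
theorem Eval.unique {P : Program} {env : List Data} {a : Expr} {d d' : Data} {t t' : ℕ}
    (h : Eval P env a d t) (h' : Eval P env a d' t') : d = d' ∧ t = t' := by
  induction h generalizing d' t' with
  | var hi => cases h' with
    | var hi' => rw [hi] at hi'; simpa using hi'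
  | nil => cases h'; simp
  | node _ _ ih1 ih2 => cases h' with
    | node g1 g2 =>
      obtain ⟨rfl, rfl⟩ := ih1 g1
      obtain ⟨rfl, rfl⟩ := ih2 g2
      simp
  | bind _ _ ih1 ih2 => cases h' with
    | bind g1 g2 =>
      obtain ⟨rfl, rfl⟩ := ih1 g1
      obtain ⟨rfl, rfl⟩ := ih2 g2
      simp
  | case_nil _ _ ih1 ih2 => cases h' with
    | case_nil g1 g2 =>
      obtain ⟨-, rfl⟩ := ih1 g1
      obtain ⟨rfl, rfl⟩ := ih2 g2
      simp
    | case_node g1 g2 => simpa using (ih1 g1).1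
  | case_node _ _ ih1 ih2 => cases h' with
    | case_nil g1 g2 => simpa using (ih1 g1).1
    | case_node g1 g2 =>
      obtain ⟨h1, rfl⟩ := ih1 g1
      cases h1
      obtain ⟨rfl, rfl⟩ := ih2 g2
      simp
  | call hf _ _ ih1 ih2 => cases h' with
    | call hf' g1 g2 =>
      rw [hf] at hf'
      cases hf'
      obtain ⟨rfl, rfl⟩ := ih1 g1
      obtain ⟨rfl, rfl⟩ := ih2 g2
      simp

/-- On input `x` the program `P` halts with output `y` after exactly `t` steps. -/
def Runs (P : Program) (x y : Data) (t : ℕ) : Prop :=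
  ∃ main, P[0]? = some main ∧ Eval P [x] main y t

/-- Natural numbers in unary. -/
def encNat : ℕ → Data
  | 0 => .nil
  | i + 1 => .node .nil (encNat i)

/-- Lists. -/
def encList : List Data → Data
  | [] => .nil
  | d :: l => .node d (encList l)

end TreeMachine

namespace EvenCycle

open TreeMachine

/-- The encoding of an edge: its two ends and its weight. -/
def Inst.encEdge (I : Inst) (e : Fin I.m) : Data :=
  .node (encNat (I.ends e).1) (.node (encNat (I.ends e).2) (encNat (I.weight e)))

/-- The encoding of an instance: the number of vertices, the list of edges, the list of the elements
of `S`, and `k`. -/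
def Inst.enc (I : Inst) : Data :=
  .node (encNat I.n)
    (.node (encList ((List.finRange I.m).map I.encEdge))
      (.node (encList (((List.finRange I.n).filter (· ∈ I.S)).map fun x => encNat x))
        (encNat I.k)))

/-- Correct outputs: `node nil l`, where `l` lists a solution, if there is a solution, and `nil`
if there is none. -/
def Inst.IsAnswer (I : Inst) (out : Data) : Prop :=
  (∃ l : List (Fin I.n), out = .node .nil (encList (l.map fun x => encNat x)) ∧
    I.IsSolution l.toFinset) ∨
  (out = .nil ∧ ∀ X : Finset (Fin I.n), ¬ I.IsSolution X)

end EvenCycle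

/-! Forests of odd cacti are described edge by edge (`Net.GoodAt`): if the ends of `e` stay
connected without `e`, then the edges forced on every such connection already connect them, so that
together with `e` they form the only cycle through `e`, and this cycle is odd. The condition is
hereditary, can be checked separately on parts glued at one vertex (`GoodAt.of_retract`), and
excludes a third independent connection between two vertices (`Good.not_triply_joined`).

The algorithm is a bounded search tree. The vertices of `S` are kept, those of `F` are undecided,
and `F` always induces a forest of odd cacti. For `U ⊆ F`, a component of `F \ U` is minor if it has
a neighbour in `U` and at most one other neighbour, together with which it is good. A solution
meeting a minor component can trade that part for the neighbour in `U` (`Sol.exchange`). Hence one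
may branch: delete a vertex of `U`, or keep its region, that is, `U` with all its minor components.
A nonempty `U` with at most three vertices is used if keeping its region makes `S` bad, if `U = {p}`
and `p` is attached to two vertices of `S`, or if `U = {p, q}` connects two components of `S`
(`Net.Test`).

The measure is `6 ^ k * (54/25) ^ c * (6/5) ^ b`, where `c` counts the components of `S` and `b`
counts the boundary vertices of `S` up to not being separable by one edge. The measures of all
branches add up to at most the present one (`mu_keep`, `mu_delete`), and for `|S| ≤ k + 1` the
measure is at most `3 * 16.64 ^ k`, because `6 * 54/25 * 6/5 = 15.552`.

The combinatorial core is `Stuck.good`: if no `U` qualifies, the whole graph is already a forest of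
odd cacti. Otherwise let `P` be a smallest component of some `F \ {v}` that is not inert. Then `v`
has two neighbours in `P`, which gives a cycle through `v`; `P` falls into fibres hanging from the
vertices of the cycle, and all fibres are inert by minimality. If at most one fibre touches `S`,
then `P` is inert. If exactly two do, the cycle gets an ear through `S`; if three do, the middle one
is joined to `S` in three ways. Both contradict that no three-vertex set qualifies.

It remains to identify `Net.Good` with the given definition (`isOddCactusForest_iff`) and to follow
an explicit program through polynomial step bounds; `spec_solve` turns the measure into a running
time. -/

namespace EvenCycle

/-! ### Edge connectivity and odd cacti as a local condition on edges. -/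

/-- A loopless multigraph on the vertex type `V` with edge type `β` and edge weights. -/
structure Net (V β : Type*) where
  ends : β → V × V
  wt : β → ℕ
  ne : ∀ e, (ends e).1 ≠ (ends e).2

namespace Net

variable {V β : Type*} (N : Net V β)

/-- Two vertices are joined by a walk using edges of `E` only. -/
def con (E : Set β) : V → V → Prop :=
  Relation.EqvGen fun x y => ∃ e ∈ E, N.ends e = (x, y)

variable {N} {E E' E₀ E₁ : Set β} {x y z : V} {e f : β}

theorem con_refl (x : V) : N.con E x x := .refl x

theorem con.symm (h : N.con E x y) : N.con E y x := Relation.EqvGen.symm _ _ h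

theorem con.trans (h : N.con E x y) (h' : N.con E y z) : N.con E x z :=
  Relation.EqvGen.trans _ _ _ h h'

theorem con_edge (h : e ∈ E) : N.con E (N.ends e).1 (N.ends e).2 := .rel _ _ ⟨e, h, rfl⟩

theorem con_map_of {V' β' : Type*} {N' : Net V' β'} {E' : Set β'} (φ : V → V')
    (h : ∀ e ∈ E, N'.con E' (φ (N.ends e).1) (φ (N.ends e).2))
    (hxy : N.con E x y) : N'.con E' (φ x) (φ y) := by
  induction hxy with
  | rel a b hab => obtain ⟨e, he, hab⟩ := hab; simpa [hab] using h e he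
  | refl a => exact con_refl _
  | symm a b _ ih => exact ih.symm
  | trans a b c _ _ ih ih' => exact ih.trans ih'

theorem con.mono (h : N.con E x y) (hE : E ⊆ E') : N.con E' x y :=
  con_map_of id (fun _ he => con_edge (hE he)) h

theorem con.iff_of (h : N.con E x y) (p : V → Prop)
    (hp : ∀ e ∈ E, p (N.ends e).1 ↔ p (N.ends e).2) : p x ↔ p y := by
  induction h with
  | rel a b hab => obtain ⟨e, he, hab⟩ := hab; simpa [hab] using hp e he
  | refl a => exact Iff.rfl
  | symm a b _ ih => exact ih.symm
  | trans a b c _ _ ih ih' => exact ih.trans ih'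

theorem con_empty (h : N.con ∅ x y) : x = y := by
  simpa using (h.iff_of (fun z => x = z) (by simp))

/-- A walk that cannot avoid the edge `e` splits at `e`. -/
theorem con.split (h : N.con E x y) (h' : ¬ N.con (E \ {e}) x y) :
    (N.con (E \ {e}) x (N.ends e).1 ∧ N.con (E \ {e}) (N.ends e).2 y) ∨
    (N.con (E \ {e}) x (N.ends e).2 ∧ N.con (E \ {e}) (N.ends e).1 y) := by
  have key := h.iff_of (fun z => N.con (E \ {e}) x z ∨
    (N.con (E \ {e}) x (N.ends e).1 ∧ N.con (E \ {e}) (N.ends e).2 z) ∨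
    (N.con (E \ {e}) x (N.ends e).2 ∧ N.con (E \ {e}) (N.ends e).1 z)) (by
      intro f hf
      by_cases hfe : f = e
      · subst hfe
        constructor
        · rintro (h | ⟨h, h'⟩ | ⟨h, -⟩)
          · exact Or.inr (Or.inl ⟨h, con_refl _⟩)
          · exact Or.inl (h.trans h'.symm)
          · exact Or.inl h
        · rintro (h | ⟨h, -⟩ | ⟨h, h'⟩)
          · exact Or.inr (Or.inr ⟨h, con_refl _⟩)
          · exact Or.inl h
          · exact Or.inl (h.trans h'.symm)
      · have hc : N.con (E \ {e}) (N.ends f).1 (N.ends f).2 := con_edge ⟨hf, hfe⟩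
        constructor
        · rintro (h | ⟨h, h'⟩ | ⟨h, h'⟩)
          · exact Or.inl (h.trans hc)
          · exact Or.inr (Or.inl ⟨h, h'.trans hc⟩)
          · exact Or.inr (Or.inr ⟨h, h'.trans hc⟩)
        · rintro (h | ⟨h, h'⟩ | ⟨h, h'⟩)
          · exact Or.inl (h.trans hc.symm)
          · exact Or.inr (Or.inl ⟨h, h'.trans hc.symm⟩)
          · exact Or.inr (Or.inr ⟨h, h'.trans hc.symm⟩))
  exact ((key.1 (Or.inl (con_refl _))).resolve_left h')

variable (N)

/-- The edges other than `e` that every walk in `E` joining the ends of `e` and avoiding `e` has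
to use. -/
def bri (E : Set β) (e : β) : Set β :=
  {f | f ∈ E ∧ f ≠ e ∧ ¬ N.con (E \ {e, f}) (N.ends e).1 (N.ends e).2}

/-- Either `e` is a bridge, or it lies in exactly one cycle, and this cycle is odd. -/
def GoodAt (E : Set β) (e : β) : Prop :=
  N.con (E \ {e}) (N.ends e).1 (N.ends e).2 →
    N.con (N.bri E e) (N.ends e).1 (N.ends e).2 ∧ Odd (N.wt e + ∑ᶠ f ∈ N.bri E e, N.wt f)

/-- The edges in `E` form a forest of odd cacti. -/
def Good (E : Set β) : Prop := ∀ e ∈ E, N.GoodAt E e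

variable {N}

/-- An edge missing from some connection that avoids `e` is not forced. So if the forced edges
connect the ends of `e`, they are the least set that does. -/
theorem bri_subset (hE : E' ⊆ E \ {e}) (h : N.con E' (N.ends e).1 (N.ends e).2) :
    N.bri E e ⊆ E' := by
  rintro f ⟨_, _, hf⟩
  by_contra hf'
  refine hf (h.mono fun g hg => ⟨(hE hg).1, ?_⟩)
  rintro (rfl | rfl)
  · exact (hE hg).2 rfl
  · exact hf' hg

/-- If the ends of `e` are still connected in `E' \ {e}`, every edge forced in `E` must have
survived, and the same edges are forced in `E'`. So the cycle through `e`, and its parity, do not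
change. -/
theorem GoodAt.mono (h : N.GoodAt E e) (hE : E' ⊆ E) : N.GoodAt E' e := by
  intro hc
  have hd : E' \ {e} ⊆ E \ {e} := Set.sdiff_subset_sdiff_left hE
  obtain ⟨h1, h2⟩ := h (hc.mono hd)
  have hsub : N.bri E e ⊆ E' \ {e} := bri_subset hd hc
  have heq : N.bri E' e = N.bri E e :=
    Set.Subset.antisymm (bri_subset hsub h1) fun f hf =>
      ⟨(hsub hf).1, hf.2.1, fun h => hf.2.2 (h.mono (Set.sdiff_subset_sdiff_left hE))⟩
  rw [heq]
  exact ⟨h1, h2⟩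

theorem Good.mono (h : N.Good E) (hE : E' ⊆ E) : N.Good E' :=
  fun e he => (h e (hE he)).mono hE

/-- If `E` retracts onto `E'`, the condition at an edge of `E'` can be checked in `E'`. -/
theorem GoodAt.of_retract (φ : V → V) (hE : E' ⊆ E)
    (hfix : ∀ f ∈ E', φ (N.ends f).1 = (N.ends f).1 ∧ φ (N.ends f).2 = (N.ends f).2)
    (hcol : ∀ f ∈ E, f ∉ E' → φ (N.ends f).1 = φ (N.ends f).2)
    (he : e ∈ E') (h : N.GoodAt E' e) : N.GoodAt E e := by
  -- The map `φ` carries a walk in `E` to a walk in `E'` with the same ends, edges outside `E'`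
  -- being contracted; hence `E` and `E'` separate the ends of `e` by the same sets.
  have key : ∀ D : Set β, N.con (E \ D) (N.ends e).1 (N.ends e).2 ↔
      N.con (E' \ D) (N.ends e).1 (N.ends e).2 := by
    refine fun D => ⟨fun hc => ?_, fun hc => hc.mono (Set.sdiff_subset_sdiff_left hE)⟩
    have := con_map_of (N' := N) (E' := E' \ D) φ (fun f hf => ?_) hc
    · rwa [(hfix e he).1, (hfix e he).2] at this
    · by_cases hf' : f ∈ E'
      · rw [(hfix f hf').1, (hfix f hf').2]
        exact con_edge ⟨hf', hf.2⟩
      · rw [hcol f hf.1 hf']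
        exact con_refl _
  intro hc
  have hc' := (key _).1 hc
  have heq : N.bri E e = N.bri E' e := by
    ext f
    constructor
    · intro hf
      exact ⟨(bri_subset (Set.sdiff_subset_sdiff_left hE) hc' hf).1, hf.2.1,
        fun h => hf.2.2 ((key _).2 h)⟩
    · intro hf
      exact ⟨hE hf.1, hf.2.1, fun h => hf.2.2 ((key _).1 h)⟩
  rw [heq]
  exact h hc'

/-- In a forest of odd cacti, two vertices that are joined by `E₁` (modulo `E₀`) and are joined
robustly by the edges outside `E₁` cannot exist. -/
theorem Good.not_triply_joined [Finite β] (hG : N.Good E) (h0 : E₀ ⊆ E) (h1 : E₁ ⊆ E)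
    (hd : Disjoint E₀ E₁) (hc : N.con (E₀ ∪ E₁) x y) (hn : ¬ N.con E₀ x y)
    (hf : ∀ f ∉ E₀, N.con ((E \ E₁) \ {f}) x y) : False := by
  induction hk : E₁.ncard using Nat.strong_induction_on generalizing E₁ with
  | _ k ih =>
  subst hk
  by_cases hmin : ∃ e ∈ E₁, N.con ((E₀ ∪ E₁) \ {e}) x y
  · obtain ⟨e, he, hce⟩ := hmin
    refine ih _ (Set.ncard_sdiff_singleton_lt_of_mem he (Set.toFinite _)) (E₁ := E₁ \ {e})
      (Set.sdiff_subset.trans h1) (hd.mono_right Set.sdiff_subset) (hce.mono ?_)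
      (fun f hf0 => (hf f hf0).mono ?_) rfl
    · rintro f ⟨hf | hf, hfe⟩
      · exact Or.inl hf
      · exact Or.inr ⟨hf, hfe⟩
    · rintro g ⟨⟨hg, hg'⟩, hgf⟩
      exact ⟨⟨hg, fun h => hg' h.1⟩, hgf⟩
  -- Now `E₁` is minimal: every connection of `x` and `y` in `E₀ ∪ E₁` uses each edge of `E₁`.
  · push Not at hmin
    have hne : E₁.Nonempty := by
      by_contra h
      rw [Set.not_nonempty_iff_eq_empty] at h
      simp only [h, Set.union_empty] at hc
      exact hn hc
    obtain ⟨e, he⟩ := hne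
    have heE0 : e ∉ E₀ := fun h => Set.disjoint_left.1 hd h he
    have hs := hc.split (hmin e he)
    have hsub : (E₀ ∪ E₁) \ {e} ⊆ E \ {e} :=
      Set.sdiff_subset_sdiff_left (Set.union_subset h0 h1)
    have aux : ∀ D : Set β, (E₀ ∪ E₁) \ {e} ⊆ D → N.con D x y →
        N.con D (N.ends e).1 (N.ends e).2 := by
      intro D hD hxy
      rcases hs with ⟨h, h'⟩ | ⟨h, h'⟩
      · exact (h.mono hD).symm.trans (hxy.trans (h'.mono hD).symm)
      · exact (h'.mono hD).trans (hxy.symm.trans (h.mono hD))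
    have hce : N.con (E \ {e}) (N.ends e).1 (N.ends e).2 := by
      refine aux _ hsub ((hf e heE0).mono ?_)
      rintro g ⟨⟨hg, _⟩, hge⟩
      exact ⟨hg, hge⟩
    obtain ⟨hb, -⟩ := hG e (h1 he) hce
    -- An edge `f` outside `E₀ ∪ E₁` is not forced for `e`: go from `e` to `x` and `y` inside `E₀ ∪
    -- E₁` and close up by the connection avoiding `E₁` and `f`. Thus the forced edges bypass `e`
    -- within `E₀ ∪ E₁`, against minimality.
    have hbs : N.bri E e ⊆ (E₀ ∪ E₁) \ {e} := by
      rintro f ⟨hfE, hfe, hfn⟩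
      refine ⟨?_, hfe⟩
      by_contra hf'
      have hf0 : f ∉ E₀ := fun h => hf' (Or.inl h)
      refine hfn (aux _ ?_ ((hf f hf0).mono ?_))
      · rintro g hg
        refine ⟨(hsub hg).1, ?_⟩
        rintro (rfl | rfl)
        · exact hg.2 rfl
        · exact hf' hg.1
      · rintro g ⟨⟨hg, hg'⟩, hgf⟩
        refine ⟨hg, ?_⟩
        rintro (rfl | rfl)
        · exact hg' he
        · exact hgf rfl
    have := hb.mono hbs
    rcases hs with ⟨h, h'⟩ | ⟨h, h'⟩
    · exact hmin e he (h.trans (this.trans h'))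
    · exact hmin e he (h.trans (this.symm.trans h'))

end Net
end EvenCycle

/-! ### Minor components, regions and the exchange argument. -/

namespace EvenCycle
namespace Net

variable {V β : Type*} (N : Net V β)

/-- The edges with both ends in `A`. -/
def ind (A : Set V) : Set β := {e | (N.ends e).1 ∈ A ∧ (N.ends e).2 ∈ A}

/-- The edge `e` joins `x` and `y`. -/
def Joins (e : β) (x y : V) : Prop := N.ends e = (x, y) ∨ N.ends e = (y, x)

/-- Adjacency. -/
def adj (x y : V) : Prop := ∃ e, N.Joins e x y

/-- The vertex set of the component of `w` in the subgraph induced by `A`. -/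
def comp (A : Set V) (w : V) : Set V := {z | z ∈ A ∧ N.con (N.ind A) w z}

/-- The neighbours of `P` in `A`. -/
def nb (A P : Set V) : Set V := {z | z ∈ A ∧ z ∉ P ∧ ∃ p ∈ P, N.adj p z}

/-- `P` is attached to a vertex of `U` and to at most one further vertex of `A`, and it forms a
forest of odd cacti together with that vertex. -/
def Minor (A U P : Set V) : Prop :=
  ∃ y ∈ U, y ∈ N.nb A P ∧ (N.nb A P \ {y}).Subsingleton ∧ N.Good (N.ind (P ∪ (N.nb A P \ {y})))

/-- `U` together with all minor components of `F \ U`. -/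
def reg (S F U : Set V) : Set V :=
  {w | w ∈ F ∧ (w ∈ U ∨ N.Minor (S ∪ F) U (N.comp (F \ U) w))}

variable {N} {A B P S F U X : Set V} {x y z w : V} {e f : β}

theorem Joins.symm (h : N.Joins e x y) : N.Joins e y x := Or.symm h

theorem joins_ends (e : β) : N.Joins e (N.ends e).1 (N.ends e).2 := Or.inl rfl

theorem Joins.ne (h : N.Joins e x y) : x ≠ y := by
  have := N.ne e
  rcases h with h | h <;> rw [h] at this
  · exact this
  · exact this.symm

theorem Joins.con {E : Set β} (h : N.Joins e x y) (he : e ∈ E) : N.con E x y := by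
  have := con_edge (N := N) he
  rcases h with h | h <;> rw [h] at this
  · exact this
  · exact this.symm

theorem Joins.mem_ind (h : N.Joins e x y) : e ∈ N.ind A ↔ x ∈ A ∧ y ∈ A := by
  rcases h with h | h <;> simp [ind, h, and_comm]

theorem Joins.eq_or_eq {x' y' : V} (h : N.Joins e x y) (h' : N.Joins e x' y') :
    (x = x' ∧ y = y') ∨ (x = y' ∧ y = x') := by
  rcases h with h | h <;> rcases h' with h' | h' <;> rw [h] at h' <;> simp_all

theorem adj.symm (h : N.adj x y) : N.adj y x := h.imp fun _ h => h.symm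

theorem adj.ne (h : N.adj x y) : x ≠ y := h.elim fun _ h => h.ne

theorem ind_mono (h : A ⊆ B) : N.ind A ⊆ N.ind B := fun _ he => ⟨h he.1, h he.2⟩

theorem adj.con (h : N.adj x y) (hx : x ∈ A) (hy : y ∈ A) : N.con (N.ind A) x y := by
  obtain ⟨e, he⟩ := h
  exact he.con (he.mem_ind.2 ⟨hx, hy⟩)

theorem con.mem_of_closed (h : N.con (N.ind A) x y) (hx : x ∈ B)
    (hB : ∀ z ∈ B, ∀ z' ∈ A, N.adj z z' → z' ∈ B) : y ∈ B :=
  (h.iff_of (· ∈ B) fun e he =>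
    ⟨fun h => hB _ h _ he.2 ⟨e, joins_ends e⟩,
      fun h => hB _ h _ he.1 ⟨e, (joins_ends e).symm⟩⟩).1 hx

theorem con.eq_or_mem (h : N.con (N.ind A) x y) : x = y ∨ (x ∈ A ∧ y ∈ A) := by
  by_cases hx : x ∈ A
  · exact Or.inr ⟨hx, h.mem_of_closed hx fun _ _ _ hz _ => hz⟩
  · refine Or.inl ((h.iff_of (fun z => x = z) fun e he => ?_).1 rfl)
    constructor
    · rintro rfl; exact absurd he.1 hx
    · rintro rfl; exact absurd he.2 hx

theorem mem_comp_self (h : w ∈ A) : w ∈ N.comp A w := ⟨h, con_refl _⟩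

theorem comp_subset : N.comp A w ⊆ A := fun _ h => h.1

theorem comp_eq (h : z ∈ N.comp A w) : N.comp A z = N.comp A w :=
  Set.ext fun _ => ⟨fun h' => ⟨h'.1, h.2.trans h'.2⟩, fun h' => ⟨h'.1, h.2.symm.trans h'.2⟩⟩

theorem comp_closed (h : z ∈ N.comp A w) (hx : x ∈ A) (ha : N.adj z x) : x ∈ N.comp A w :=
  ⟨hx, h.2.trans (ha.con h.1 hx)⟩

theorem comp_subset_of_closed (hw : w ∈ B) (hB : ∀ z ∈ B, ∀ z' ∈ A, N.adj z z' → z' ∈ B) :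
    N.comp A w ⊆ B := fun _ hz => hz.2.mem_of_closed hw hB

theorem comp_of_notMem (h : w ∉ A) : N.comp A w = ∅ := by
  ext z
  simp only [Set.mem_empty_iff_false, iff_false]
  rintro ⟨hz, hc⟩
  rcases hc.eq_or_mem with rfl | ⟨h', -⟩
  · exact h hz
  · exact h h'

theorem con_comp (hz : z ∈ N.comp A w) : N.con (N.ind (N.comp A w)) w z := by
  refine (hz.2.iff_of (fun z => N.con (N.ind (N.comp A w)) w z) fun e he => ?_).1 (con_refl _)
  have hcA : ∀ {z}, N.con (N.ind (N.comp A w)) w z → N.con (N.ind A) w z :=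
    fun h => h.mono (ind_mono comp_subset)
  have hj : N.adj (N.ends e).1 (N.ends e).2 := ⟨e, joins_ends e⟩
  constructor
  · intro h
    have h1 : (N.ends e).1 ∈ N.comp A w := ⟨he.1, hcA h⟩
    exact h.trans (hj.con h1 (comp_closed h1 he.2 hj))
  · intro h
    have h1 : (N.ends e).2 ∈ N.comp A w := ⟨he.2, hcA h⟩
    exact h.trans (hj.symm.con h1 (comp_closed h1 he.1 hj.symm))

theorem con_comp_of_mem (hx : x ∈ N.comp A w) (hz : z ∈ N.comp A w) :
    N.con (N.ind (N.comp A w)) x z :=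
  (con_comp hx).symm.trans (con_comp hz)

/-- A component of `F \ U` inside a connected set meeting `U` is adjacent to `U`. -/
theorem exists_adj_of_con (hw : w ∈ F \ U) (hu : x ∈ U) (hc : N.con (N.ind F) w x) :
    ∃ y ∈ U, y ∈ F ∧ ∃ p ∈ N.comp (F \ U) w, N.adj p y := by
  by_contra hno
  push Not at hno
  have := hc.mem_of_closed (B := N.comp (F \ U) w) (mem_comp_self hw) (fun z hz z' hz' ha => by
    by_cases hU : z' ∈ U
    · exact absurd ha (hno _ hU hz' _ hz)
    · exact comp_closed hz ⟨hz', hU⟩ ha)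
  exact this.1.2 hu

/-- Deleting an attachment vertex of a minor set is at least as good as deleting a part of the
set. -/
theorem good_exchange (hs : (N.nb A P \ {y}).Subsingleton)
    (hP : N.Good (N.ind (P ∪ (N.nb A P \ {y})))) (hX : N.Good (N.ind (A \ X))) :
    N.Good (N.ind (A \ (X \ P ∪ {y}))) := by
  classical
  -- Once `y` is deleted, `c` is the only vertex through which `P` is attached; if there is none,
  -- `y` serves as a dummy.
  obtain ⟨c, hc⟩ : ∃ c, N.nb A P \ {y} ⊆ {c} := by
    rcases hs.eq_empty_or_singleton with h | ⟨c, h⟩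
    · exact ⟨y, by simp [h]⟩
    · exact ⟨c, h.le⟩
  have hO : ∀ p ∈ P, ∀ z ∈ A \ (X \ P ∪ {y}), N.adj p z → z ∉ P → z ∈ N.nb A P \ {y} :=
    fun p hp z hz ha hzP => ⟨⟨hz.1, hzP, p, hp, ha⟩, fun h => hz.2 (Or.inr h)⟩
  have hcl : ∀ f ∈ N.ind (A \ (X \ P ∪ {y})), ((N.ends f).1 ∈ P ∨ (N.ends f).2 ∈ P) →
      ((N.ends f).1 ∈ P ∨ (N.ends f).1 ∈ N.nb A P \ {y}) ∧
      ((N.ends f).2 ∈ P ∨ (N.ends f).2 ∈ N.nb A P \ {y}) := by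
    intro f hf ht
    have ha : N.adj (N.ends f).1 (N.ends f).2 := ⟨f, joins_ends f⟩
    rcases ht with h | h
    · exact ⟨Or.inl h, or_iff_not_imp_left.2 fun h' => hO _ h _ hf.2 ha h'⟩
    · exact ⟨or_iff_not_imp_left.2 fun h' => hO _ h _ hf.1 ha.symm h', Or.inl h⟩
  intro e he
  -- The graph is glued at `c` from the edges touching `P` and the others. Each side is a retract:
  -- collapse the opposite side to `c`. The first is good by `hP`, the second is contained in what
  -- `X` leaves.
  by_cases ht : (N.ends e).1 ∈ P ∨ (N.ends e).2 ∈ P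
  · refine GoodAt.of_retract (E' := {f | f ∈ N.ind (A \ (X \ P ∪ {y})) ∧
      ((N.ends f).1 ∈ P ∨ (N.ends f).2 ∈ P)}) (fun z => if z ∈ P then z else c)
      (fun f hf => hf.1) ?_ ?_ ⟨he, ht⟩ ?_
    · rintro f ⟨hf, hft⟩
      obtain ⟨h1, h2⟩ := hcl f hf hft
      constructor
      · rcases h1 with h | h
        · simp [h]
        · have := hc h
          simp_all
      · rcases h2 with h | h
        · simp [h]
        · have := hc h
          simp_all
    · intro f hf hf'
      have : ¬ ((N.ends f).1 ∈ P ∨ (N.ends f).2 ∈ P) := fun h => hf' ⟨hf, h⟩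
      push Not at this
      simp [this.1, this.2]
    · refine (hP e (hcl e he ht)).mono ?_
      rintro f ⟨hf, hft⟩
      exact hcl f hf hft
  · refine GoodAt.of_retract (E' := {f | f ∈ N.ind (A \ (X \ P ∪ {y})) ∧
      ¬ ((N.ends f).1 ∈ P ∨ (N.ends f).2 ∈ P)}) (fun z => if z ∈ P then c else z)
      (fun f hf => hf.1) ?_ ?_ ⟨he, ht⟩ ?_
    · rintro f ⟨hf, hft⟩
      push Not at hft
      simp [hft.1, hft.2]
    · intro f hf hf'
      have : (N.ends f).1 ∈ P ∨ (N.ends f).2 ∈ P := by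
        by_contra h
        exact hf' ⟨hf, h⟩
      obtain ⟨h1, h2⟩ := hcl f hf this
      have e1 : (if (N.ends f).1 ∈ P then c else (N.ends f).1) = c := by
        rcases h1 with h | h
        · simp [h]
        · have := hc h
          simp_all
      have e2 : (if (N.ends f).2 ∈ P then c else (N.ends f).2) = c := by
        rcases h2 with h | h
        · simp [h]
        · have := hc h
          simp_all
      simp only [e1, e2]
    · have hsub : {f | f ∈ N.ind (A \ (X \ P ∪ {y})) ∧
          ¬ ((N.ends f).1 ∈ P ∨ (N.ends f).2 ∈ P)} ⊆ N.ind (A \ X) := by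
        rintro f ⟨hf, hft⟩
        push Not at hft
        exact ⟨⟨hf.1.1, fun h => hf.1.2 (Or.inl ⟨h, hft.1⟩)⟩,
          ⟨hf.2.1, fun h => hf.2.2 (Or.inl ⟨h, hft.2⟩)⟩⟩
      exact (hX e (hsub ⟨he, ht⟩)).mono hsub

variable (N) in
/-- At most `k` vertices of `F` can be deleted such that a forest of odd cacti is left. -/
def Sol (S F : Set V) (k : ℕ) (X : Finset V) : Prop :=
  ↑X ⊆ F ∧ X.card ≤ k ∧ N.Good (N.ind ((S ∪ F) \ X))

theorem reg_subset : N.reg S F U ⊆ F := fun _ h => h.1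

theorem subset_reg (hU : U ⊆ F) : U ⊆ N.reg S F U := fun _ h => ⟨hU h, Or.inl h⟩

theorem comp_subset_reg (hw : w ∈ N.reg S F U) : N.comp (F \ U) w ⊆ N.reg S F U := by
  intro z hz
  have hwU : w ∉ U := by
    intro h
    rw [comp_of_notMem (fun h' => h'.2 h)] at hz
    exact hz
  refine ⟨hz.1.1, Or.inr ?_⟩
  rw [comp_eq hz]
  exact hw.2.resolve_left hwU

/-- A minor component contains all its neighbours in `F \ U`, so within `F` the region can be left
only from `U`. -/
theorem reg_closed (hU : U ⊆ F) (hw : w ∈ N.reg S F U) (hwU : w ∉ U) (hz : z ∈ F)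
    (ha : N.adj w z) : z ∈ N.reg S F U := by
  by_cases hzU : z ∈ U
  · exact subset_reg hU hzU
  · exact comp_subset_reg hw (comp_closed (mem_comp_self ⟨hw.1, hwU⟩) ⟨hz, hzU⟩ ha)

theorem exists_con_of_mem_reg (hU : U ⊆ F) (hw : w ∈ N.reg S F U) :
    ∃ u ∈ U, N.con (N.ind (N.reg S F U)) w u := by
  by_cases hwU : w ∈ U
  · exact ⟨w, hwU, con_refl _⟩
  · obtain ⟨y, hyU, ⟨_, _, p, hp, ha⟩, _⟩ := hw.2.resolve_left hwU
    have hpR := comp_subset_reg hw hp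
    refine ⟨y, hyU, ((con_comp hp).mono (ind_mono (comp_subset_reg hw))).trans
      (ha.con hpR (subset_reg hU hyU))⟩

/-- Solutions meeting the region of `U` can be assumed to meet `U`. -/
theorem Sol.exchange {k : ℕ} {X : Finset V} (hU : U ⊆ F) (hX : N.Sol S F k X)
    (hw : w ∈ X) (hwR : w ∈ N.reg S F U) : ∃ X', N.Sol S F k X' ∧ ∃ u ∈ X', u ∈ U := by
  classical
  by_cases hwU : w ∈ U
  · exact ⟨X, hX, w, hw, hwU⟩
  obtain ⟨y, hyU, hy, hs, hG⟩ := hwR.2.resolve_left hwU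
  have hwP : w ∈ N.comp (F \ U) w := mem_comp_self ⟨hwR.1, hwU⟩
  -- The part of `X` in the component of `w` is replaced by `y`. Since `w` itself is dropped, the
  -- size does not grow.
  refine ⟨insert y (X.filter (· ∉ N.comp (F \ U) w)), ⟨?_, ?_, ?_⟩, y, Finset.mem_insert_self _ _,
    hyU⟩
  · intro z hz
    simp only [Finset.coe_insert, Finset.coe_filter, Set.mem_insert_iff, Set.mem_ofPred_eq] at hz
    rcases hz with rfl | hz
    · exact hU hyU
    · exact hX.1 hz.1
  · refine le_trans ((Finset.card_insert_le _ _).trans ?_) hX.2.1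
    refine Finset.card_lt_card (Finset.filter_ssubset.2 ⟨w, hw, ?_⟩)
    simpa using hwP
  · have := good_exchange hs hG hX.2.2
    convert this using 3
    ext z
    simp

/-- Together with `Sol.insert`, this is the correctness of the branches that delete `u`.
Disjointness of `S` and `F` ensures that `u` really disappears from `S ∪ (F \ {u})`. -/
theorem Sol.erase [DecidableEq V] {k : ℕ} {X : Finset V} {u : V} (hd : Disjoint S F)
    (hX : N.Sol S F (k + 1) X) (hu : u ∈ X) : N.Sol S (F \ {u}) k (X.erase u) := by
  refine ⟨?_, ?_, ?_⟩
  · intro z hz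
    simp only [Finset.coe_erase] at hz
    exact ⟨hX.1 hz.1, hz.2⟩
  · rw [Finset.card_erase_of_mem hu]
    have := hX.2.1
    omega
  · refine hX.2.2.mono (ind_mono ?_)
    rintro z ⟨hz, hz'⟩
    refine ⟨hz.imp_right fun h => h.1, fun h => hz' ?_⟩
    simp only [Finset.coe_erase, Set.mem_sdiff, Set.mem_singleton_iff]
    refine ⟨h, ?_⟩
    rintro rfl
    rcases hz with hz | hz
    · exact Set.disjoint_left.1 hd hz (hX.1 h)
    · exact hz.2 rfl

theorem Sol.insert [DecidableEq V] {k : ℕ} {X : Finset V} {u : V} (huF : u ∈ F)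
    (hX : N.Sol S (F \ {u}) k X) : N.Sol S F (k + 1) (insert u X) := by
  refine ⟨?_, ?_, ?_⟩
  · intro z hz
    simp only [Finset.coe_insert, Set.mem_insert_iff] at hz
    rcases hz with rfl | hz
    · exact huF
    · exact (hX.1 hz).1
  · exact (Finset.card_insert_le _ _).trans (Nat.succ_le_succ hX.2.1)
  · refine hX.2.2.mono (ind_mono ?_)
    rintro z ⟨hz, hz'⟩
    simp only [Finset.coe_insert, Set.mem_insert_iff, not_or] at hz'
    exact ⟨hz.imp_right fun h => ⟨h, hz'.1⟩, hz'.2⟩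

/-- Correctness of the branch that keeps `R`: moving `R` from `F` to `S` leaves the graph unchanged
and only forbids deletions in `R`. -/
theorem sol_keep_iff {k : ℕ} {X : Finset V} {R : Set V} (hR : R ⊆ F) :
    N.Sol (S ∪ R) (F \ R) k X ↔ N.Sol S F k X ∧ ∀ z ∈ X, z ∉ R := by
  have hA : S ∪ R ∪ F \ R = S ∪ F := by
    rw [Set.union_assoc, Set.union_sdiff_cancel hR]
  simp only [Sol, hA]
  constructor
  · rintro ⟨h1, h2, h3⟩
    exact ⟨⟨fun z hz => (h1 hz).1, h2, h3⟩, fun z hz => (h1 hz).2⟩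
  · rintro ⟨⟨h1, h2, h3⟩, h4⟩
    exact ⟨fun z hz => ⟨h1 hz, h4 z hz⟩, h2, h3⟩

end Net
end EvenCycle

/-! ### Cycles in a cactus and the vertex sets hanging from them. -/

namespace EvenCycle
namespace Net

variable {V β : Type*} (N : Net V β)

/-- A cyclic sequence `Q 0, …, Q n, Q (n + 1) = Q 0` of vertices joined by edges. -/
structure IsRing (n : ℕ) (Q : ℕ → V) (ε : ℕ → β) : Prop where
  two_le : 2 ≤ n
  closed : Q (n + 1) = Q 0
  inj : ∀ i j, i ≤ n → j ≤ n → Q i = Q j → i = j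
  joins : ∀ i ≤ n, N.Joins (ε i) (Q i) (Q (i + 1))

variable {N} {E : Set β} {P F : Set V} {n : ℕ} {Q : ℕ → V} {ε : ℕ → β} {v u₁ u₂ : V}

theorem con_arc {a b : ℕ} (h : ∀ i, a ≤ i → i < b → N.Joins (ε i) (Q i) (Q (i + 1)))
    (hab : a ≤ b) : N.con {e | ∃ l, a ≤ l ∧ l < b ∧ ε l = e} (Q a) (Q b) := by
  induction b, hab using Nat.le_induction with
  | base => exact con_refl _
  | succ b hab ih =>
    refine ((ih fun i h1 h2 => h i h1 (by omega)).mono ?_).trans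
      ((h b hab (by omega)).con ⟨b, hab, by omega, rfl⟩)
    rintro e ⟨l, h1, h2, h3⟩
    exact ⟨l, h1, by omega, h3⟩

namespace IsRing

theorem edge_inj (h : N.IsRing n Q ε) {i j : ℕ} (hij : i < j) (hj : j ≤ n) : ε i ≠ ε j := by
  intro he
  have h1 := h.joins i (by omega)
  rw [he] at h1
  rcases h1.eq_or_eq (h.joins j hj) with ⟨h2, -⟩ | ⟨h2, h3⟩
  · have := h.inj _ _ (by omega) hj h2
    omega
  · have h4 := h.inj _ _ (by omega) hj h3
    by_cases hjn : j = n
    · subst hjn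
      rw [h.closed] at h2
      have h5 := h.inj _ _ (by omega) (by omega) h2
      have := h.two_le
      omega
    · have := h.inj _ _ (by omega) (by omega) h2
      omega

/-- The two arcs between `Q i` and `Q j` share no edge, so `f` spares one of them. -/
theorem robust (h : N.IsRing n Q ε) {i j : ℕ} (hij : i < j) (hj : j ≤ n) (f : β) :
    N.con ({e | ∃ l ≤ n, ε l = e} \ {f}) (Q i) (Q j) := by
  by_cases hf : ∃ l, i ≤ l ∧ l < j ∧ ε l = f
  · obtain ⟨l, h1, h2, rfl⟩ := hf
    have c1 : N.con ({e | ∃ l ≤ n, ε l = e} \ {ε l}) (Q 0) (Q i) := by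
      refine (con_arc (fun m _ h' => h.joins m (by omega)) (Nat.zero_le i)).mono ?_
      rintro e ⟨m, -, h3, rfl⟩
      exact ⟨⟨m, by omega, rfl⟩, h.edge_inj (by omega) (by omega)⟩
    have c2 : N.con ({e | ∃ l ≤ n, ε l = e} \ {ε l}) (Q j) (Q (n + 1)) := by
      refine (con_arc (fun m _ h' => h.joins m (by omega)) (by omega)).mono ?_
      rintro e ⟨m, h3, h4, rfl⟩
      exact ⟨⟨m, by omega, rfl⟩, (h.edge_inj (by omega) (by omega)).symm⟩
    rw [h.closed] at c2
    exact (c2.trans c1).symm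
  · refine (con_arc (fun m _ h' => h.joins m (by omega)) hij.le).mono ?_
    rintro e ⟨m, h3, h4, rfl⟩
    refine ⟨⟨m, by omega, rfl⟩, ?_⟩
    rintro rfl
    exact hf ⟨m, h3, h4, rfl⟩

/-- A connection off the ring would be a third one besides the two arcs; this is `not_triply_joined`
with `E₀ = ∅`. -/
theorem no_ear [Finite β] (h : N.IsRing n Q ε) (hE : N.Good E) (hs : ∀ i ≤ n, ε i ∈ E) {i j : ℕ}
    (hij : i < j) (hj : j ≤ n) : ¬ N.con (E \ {e | ∃ l ≤ n, ε l = e}) (Q i) (Q j) := by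
  intro hc
  refine hE.not_triply_joined (E₀ := ∅) (E₁ := E \ {e | ∃ l ≤ n, ε l = e}) (by simp)
    Set.sdiff_subset (by simp) (by simpa using hc) (fun h0 => ?_) (fun f _ => ?_)
  · have := h.inj _ _ (by omega) hj (con_empty h0)
    omega
  · refine (h.robust hij hj f).mono ?_
    rintro e ⟨⟨l, hl, rfl⟩, hf⟩
    exact ⟨⟨hs l hl, fun h => h.2 ⟨l, hl, rfl⟩⟩, hf⟩

end IsRing

/-- A simple path in `P` from `u₁` to `u₂` is closed through `v`. Since `u₁ ≠ u₂`, the ring has at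
least three vertices. -/
theorem exists_isRing (hne : u₁ ≠ u₂) (h₂ : u₂ ∈ P) (hv : v ∉ P)
    (ha₁ : N.adj v u₁) (ha₂ : N.adj v u₂) (hc : N.con (N.ind P) u₁ u₂) :
    ∃ n Q ε, N.IsRing n Q ε ∧ Q 0 = v ∧ ∀ i, 1 ≤ i → i ≤ n → Q i ∈ P := by
  classical
  let H : SimpleGraph V :=
    { Adj := fun x y => x ∈ P ∧ y ∈ P ∧ N.adj x y
      symm := ⟨fun x y h => ⟨h.2.1, h.1, h.2.2.symm⟩⟩
      loopless := ⟨fun x h => h.2.2.ne rfl⟩ }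
  have hr : H.Reachable u₁ u₂ := by
    refine (hc.iff_of (fun z => H.Reachable u₁ z) fun e he => ?_).1 (.refl _)
    have : H.Adj (N.ends e).1 (N.ends e).2 := ⟨he.1, he.2, e, joins_ends e⟩
    exact ⟨fun h => h.trans this.reachable, fun h => h.trans this.symm.reachable⟩
  obtain ⟨p, hp⟩ := hr.exists_isPath
  have hlen : 1 ≤ p.length := by
    by_contra h
    exact hne (SimpleGraph.Walk.eq_of_length_eq_zero (p := p) (by omega))
  have hPm : ∀ i ≤ p.length, p.getVert i ∈ P := by
    intro i hi
    by_cases h : i < p.length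
    · exact (p.adj_getVert_succ h).1
    · obtain rfl : i = p.length := by omega
      simpa using h₂
  -- The path is shifted by one: `v` takes the indices `0` and `p.length + 2`, so the last vertex of
  -- the path is `Q n` with `n = p.length + 1`.
  set Q : ℕ → V := fun i => if i = 0 ∨ i = p.length + 2 then v else p.getVert (i - 1) with hQ
  have hQP : ∀ i, 1 ≤ i → i ≤ p.length + 1 → Q i = p.getVert (i - 1) := by
    intro i h1 h2
    simp only [hQ]
    rw [if_neg (by omega)]
  have hQ0 : Q 0 = v := by simp [hQ]
  have hQe : Q (p.length + 2) = v := by simp [hQ]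
  have hadj : ∀ i ≤ p.length + 1, N.adj (Q i) (Q (i + 1)) := by
    intro i hi
    rcases Nat.eq_zero_or_pos i with rfl | hi0
    · rw [hQ0, hQP 1 (by omega) (by omega)]
      simpa using ha₁
    · by_cases hl : i = p.length + 1
      · subst hl
        rw [hQe, hQP _ (by omega) (by omega)]
        simpa using ha₂.symm
      · rw [hQP _ hi0 (by omega), hQP _ (by omega) (by omega)]
        have := (p.adj_getVert_succ (i := i - 1) (by omega)).2.2
        rwa [Nat.sub_add_cancel hi0] at this
  have : ∀ i, ∃ e, i ≤ p.length + 1 → N.Joins e (Q i) (Q (i + 1)) := by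
    intro i
    by_cases h : i ≤ p.length + 1
    · obtain ⟨e, he⟩ := hadj i h
      exact ⟨e, fun _ => he⟩
    · exact ⟨ha₁.choose, fun h' => absurd h' h⟩
  choose ε hε using this
  refine ⟨p.length + 1, Q, ε, ⟨by omega, by rw [hQ0]; exact hQe, ?_, hε⟩, hQ0, ?_⟩
  · intro i j hi hj hij
    rcases Nat.eq_zero_or_pos i with rfl | hi0
    · rcases Nat.eq_zero_or_pos j with rfl | hj0
      · rfl
      · rw [hQ0, hQP j hj0 hj] at hij
        exact absurd (hij ▸ hPm (j - 1) (by omega)) hv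
    · rcases Nat.eq_zero_or_pos j with rfl | hj0
      · rw [hQ0, hQP i hi0 hi] at hij
        exact absurd (hij ▸ hPm (i - 1) (by omega)) hv
      · rw [hQP i hi0 hi, hQP j hj0 hj] at hij
        have := hp.getVert_injOn (by simp; omega) (by simp; omega) hij
        omega
  · intro i h1 h2
    rw [hQP i h1 h2]
    exact hPm _ (by omega)

/-- A ring with its last vertex outside `P`, and the assignment of the vertices of `P` to the
vertices of the ring from which they hang. -/
structure IsGated (N : Net V β) (P : Set V) (n : ℕ) (Q : ℕ → V) (ε : ℕ → β) (g : V → ℕ) :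
    Prop where
  ring : N.IsRing n Q ε
  notMem : Q 0 ∉ P
  mem : ∀ i, 1 ≤ i → i ≤ n → Q i ∈ P
  bounds : ∀ z ∈ P, 1 ≤ g z ∧ g z ≤ n
  gate : ∀ i, 1 ≤ i → i ≤ n → g (Q i) = i
  con : ∀ z ∈ P, N.con (N.ind {x | x ∈ P ∧ g x = g z}) z (Q (g z))
  step : ∀ z ∈ P, ∀ z' ∈ P, N.adj z z' → g z = g z' ∨
    ∃ i, 1 ≤ i ∧ i < n ∧ ((z = Q i ∧ z' = Q (i + 1)) ∨ (z' = Q i ∧ z = Q (i + 1)))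
  root : ∀ z ∈ P, N.adj (Q 0) z → z = Q 1 ∨ z = Q n

/-- Remove the ring edges. By `no_ear` the ring vertices then lie in different components of `F`,
while connectedness of `P` lets each of its vertices still reach some ring vertex other than the
root. The index of that vertex is `g`; outside `P` its value is irrelevant. -/
theorem exists_isGated [Finite β] (hF : N.Good (N.ind F)) (hPF : P ⊆ F) (hvF : Q 0 ∈ F)
    (hr : N.IsRing n Q ε) (hv : Q 0 ∉ P) (hm : ∀ i, 1 ≤ i → i ≤ n → Q i ∈ P)
    (hc : ∀ z ∈ P, ∀ z' ∈ P, N.con (N.ind P) z z') : ∃ g, N.IsGated P n Q ε g := by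
  set Ep : Set β := {e | ∃ l ≤ n, ε l = e} with hEp
  have hQF : ∀ i ≤ n + 1, Q i ∈ F := by
    intro i hi
    rcases Nat.eq_zero_or_pos i with rfl | hi0
    · exact hvF
    · by_cases h : i = n + 1
      · rw [h, hr.closed]; exact hvF
      · exact hPF (hm i hi0 (by omega))
  have huniq : ∀ i j, i < j → j ≤ n → ¬ N.con (N.ind F \ Ep) (Q i) (Q j) := fun i j hij hj =>
    hr.no_ear hF (fun i hi => (hr.joins i hi).mem_ind.2
      ⟨hQF i (by omega), hQF (i + 1) (by omega)⟩) hij hj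
  have huniq' : ∀ i j, i ≤ n → j ≤ n → N.con (N.ind F \ Ep) (Q i) (Q j) → i = j := by
    intro i j hi hj hc
    rcases lt_trichotomy i j with h | h | h
    · exact absurd hc (huniq i j h hj)
    · exact h
    · exact absurd hc.symm (huniq j i h hi)
  have hex : ∀ z ∈ P, ∃ j, 1 ≤ j ∧ j ≤ n ∧ N.con (N.ind P \ Ep) z (Q j) := by
    intro z hz
    have h1 : Q 1 ∈ P := hm 1 le_rfl (by have := hr.two_le; omega)
    refine ((hc _ h1 _ hz).iff_of
      (fun z => ∃ j, 1 ≤ j ∧ j ≤ n ∧ N.con (N.ind P \ Ep) z (Q j)) fun e he => ?_).1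
      ⟨1, le_rfl, by have := hr.two_le; omega, con_refl _⟩
    by_cases hep : e ∈ Ep
    · have hq : ∀ x, (x = (N.ends e).1 ∨ x = (N.ends e).2) → x ∈ P → ∃ j, 1 ≤ j ∧ j ≤ n ∧
          N.con (N.ind P \ Ep) x (Q j) := by
        intro x hx hxP
        obtain ⟨l, hl, rfl⟩ := hep
        have : x = Q l ∨ x = Q (l + 1) := by
          rcases (hr.joins l hl).eq_or_eq (joins_ends (ε l)) with ⟨h1, h2⟩ | ⟨h1, h2⟩ <;>
            rcases hx with rfl | rfl <;> simp [h1, h2]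
        rcases this with rfl | rfl
        · refine ⟨l, ?_, hl, con_refl _⟩
          rcases Nat.eq_zero_or_pos l with rfl | h
          · exact absurd hxP hv
          · exact h
        · refine ⟨l + 1, by omega, ?_, con_refl _⟩
          by_contra h
          obtain rfl : l = n := by omega
          rw [hr.closed] at hxP
          exact hv hxP
      exact ⟨fun _ => hq _ (Or.inr rfl) he.2, fun _ => hq _ (Or.inl rfl) he.1⟩
    · have hce : N.con (N.ind P \ Ep) (N.ends e).1 (N.ends e).2 := con_edge ⟨he, hep⟩
      exact ⟨fun ⟨j, h1, h2, h3⟩ => ⟨j, h1, h2, hce.symm.trans h3⟩,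
        fun ⟨j, h1, h2, h3⟩ => ⟨j, h1, h2, hce.trans h3⟩⟩
  have hex' : ∀ z, ∃ j, z ∈ P → 1 ≤ j ∧ j ≤ n ∧ N.con (N.ind P \ Ep) z (Q j) := by
    intro z
    by_cases hz : z ∈ P
    · exact (hex z hz).imp fun _ h _ => h
    · exact ⟨0, fun h => absurd h hz⟩
  choose g hg using hex'
  have hup : N.ind P \ Ep ⊆ N.ind F \ Ep := Set.sdiff_subset_sdiff_left (ind_mono hPF)
  have hsame : ∀ z ∈ P, ∀ z' ∈ P, N.con (N.ind F \ Ep) z z' → g z = g z' := by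
    intro z hz z' hz' h
    obtain ⟨-, h2, h3⟩ := hg z hz
    obtain ⟨-, h2', h3'⟩ := hg z' hz'
    exact huniq' _ _ h2 h2' ((h3.mono hup).symm.trans (h.trans (h3'.mono hup)))
  have hgate : ∀ i, 1 ≤ i → i ≤ n → g (Q i) = i := by
    intro i h1 h2
    obtain ⟨-, h2', h3⟩ := hg _ (hm i h1 h2)
    exact (huniq' _ _ h2 h2' (h3.mono hup)).symm
  refine ⟨g, hr, hv, hm, fun z hz => ⟨(hg z hz).1, (hg z hz).2.1⟩, hgate, ?_, ?_, ?_⟩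
  · intro z hz
    have := (hg z hz).2.2.iff_of (fun x => (x ∈ P ∧ g x = g z) ∧
      N.con (N.ind {x | x ∈ P ∧ g x = g z}) z x) (fun e he => ?_)
    · exact (this.1 ⟨⟨hz, rfl⟩, con_refl _⟩).2
    · have hge := hsame _ he.1.1 _ he.1.2 ((con_edge he).mono hup)
      constructor
      · rintro ⟨h1, h2⟩
        have h3 : (N.ends e).2 ∈ P ∧ g (N.ends e).2 = g z := ⟨he.1.2, by rw [← hge, h1.2]⟩
        exact ⟨h3, h2.trans (adj.con ⟨e, joins_ends e⟩ h1 h3)⟩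
      · rintro ⟨h1, h2⟩
        have h3 : (N.ends e).1 ∈ P ∧ g (N.ends e).1 = g z := ⟨he.1.1, by rw [hge, h1.2]⟩
        exact ⟨h3, h2.trans (adj.con ⟨e, (joins_ends e).symm⟩ h1 h3)⟩
  · rintro z hz z' hz' ⟨f, hf⟩
    by_cases hfe : f ∈ Ep
    · obtain ⟨l, hl, rfl⟩ := hfe
      right
      rcases hf.eq_or_eq (hr.joins l hl) with ⟨h1, h2⟩ | ⟨h1, h2⟩
      · refine ⟨l, ?_, ?_, Or.inl ⟨h1, h2⟩⟩
        · rcases Nat.eq_zero_or_pos l with rfl | h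
          · exact absurd (h1 ▸ hz) hv
          · exact h
        · by_contra h
          obtain rfl : l = n := by omega
          rw [hr.closed] at h2
          exact hv (h2 ▸ hz')
      · refine ⟨l, ?_, ?_, Or.inr ⟨h2, h1⟩⟩
        · rcases Nat.eq_zero_or_pos l with rfl | h
          · exact absurd (h2 ▸ hz') hv
          · exact h
        · by_contra h
          obtain rfl : l = n := by omega
          rw [hr.closed] at h1
          exact hv (h1 ▸ hz)
    · exact Or.inl (hsame z hz z' hz' (hf.con ⟨hf.mem_ind.2 ⟨hPF hz, hPF hz'⟩, hfe⟩))
  · rintro z hz ⟨f, hf⟩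
    by_cases hfe : f ∈ Ep
    · obtain ⟨l, hl, rfl⟩ := hfe
      rcases hf.eq_or_eq (hr.joins l hl) with ⟨h1, h2⟩ | ⟨h1, h2⟩
      · have := hr.inj _ _ (by omega) hl h1
        subst this
        exact Or.inl h2
      · by_cases h : l = n
        · subst h
          exact Or.inr h2
        · have := hr.inj _ _ (by omega) (by omega) h1
          omega
    · exfalso
      obtain ⟨h1, h2, h3⟩ := hg z hz
      have hf' : f ∈ N.ind F \ Ep := ⟨hf.mem_ind.2 ⟨hvF, hPF hz⟩, hfe⟩
      exact huniq 0 (g z) (by omega) h2 ((hf.con hf').trans (h3.mono hup))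

end Net
end EvenCycle

/-! ### Inert sets, and the situation in which no branching rule applies. -/

namespace EvenCycle
namespace Net

variable {V β : Type*} (N : Net V β)

/-- The vertices of `S` adjacent to `P`. -/
def tch (S P : Set V) : Set V := {a | a ∈ S ∧ ∃ p ∈ P, N.adj p a}

/-- `P` touches at most one vertex of `S` and forms a forest of odd cacti together with it. -/
def Inert (S P : Set V) : Prop := (N.tch S P).Subsingleton ∧ N.Good (N.ind (P ∪ N.tch S P))

/-- The vertices of `S` attached to `p` through `R`. -/
def Att (S R : Set V) (p : V) : Set V := {a | a ∈ S ∧ N.con (N.ind (insert a R)) p a}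

/-- No branching rule applies. -/
structure Stuck (S F : Set V) : Prop where
  disj : Disjoint S F
  fin : F.Finite
  goodS : N.Good (N.ind S)
  goodF : N.Good (N.ind F)
  triple : ∀ p ∈ F, ∀ q ∈ F, ∀ r ∈ F, N.Good (N.ind (S ∪ N.reg S F {p, q, r}))
  pair : ∀ p ∈ F, ∀ q ∈ F, N.con (N.ind (N.reg S F {p, q})) p q →
    ∀ a ∈ N.Att S (N.reg S F {p, q}) p, ∀ b ∈ N.Att S (N.reg S F {p, q}) p, N.con (N.ind S) a b
  single : ∀ p ∈ F, (N.Att S (N.reg S F {p}) p).Subsingleton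

variable {N} {P P' C S F U : Set V} {x y z v w a : V}

theorem tch_mono (h : P ⊆ P') : N.tch S P ⊆ N.tch S P' :=
  fun _ ⟨h1, p, hp, ha⟩ => ⟨h1, p, h hp, ha⟩

theorem Inert.mono (h : N.Inert S P') (hP : P ⊆ P') : N.Inert S P :=
  ⟨h.1.anti (tch_mono hP), h.2.mono (ind_mono (Set.union_subset_union hP (tch_mono hP)))⟩

theorem nb_comp (hz : z ∈ N.nb (S ∪ F) (N.comp (F \ U) w)) :
    (z ∈ N.tch S (N.comp (F \ U) w)) ∨ (z ∈ U ∧ z ∈ F ∧ ∃ p ∈ N.comp (F \ U) w, N.adj p z) := by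
  obtain ⟨hz1, hz2, p, hp, ha⟩ := hz
  rcases hz1 with hz1 | hz1
  · exact Or.inl ⟨hz1, p, hp, ha⟩
  · refine Or.inr ⟨?_, hz1, p, hp, ha⟩
    by_contra hU
    exact hz2 (comp_closed hp ⟨hz1, hU⟩ ha)

/-- Besides `y`, all neighbours of the component are in `S`, and inertness allows at most one of
these. -/
theorem minor_of_inert (hw : w ∈ F \ U) (hu : x ∈ U)
    (hc : N.con (N.ind F) w x)
    (huniq : ∀ z ∈ U, ∀ p ∈ N.comp (F \ U) w, N.adj p z → z = y)
    (hi : N.Inert S (N.comp (F \ U) w)) : N.Minor (S ∪ F) U (N.comp (F \ U) w) := by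
  obtain ⟨y', hyU, hyF, p, hp, ha⟩ := exists_adj_of_con hw hu hc
  obtain rfl : y' = y := huniq y' hyU p hp ha
  have hsub : N.nb (S ∪ F) (N.comp (F \ U) w) \ {y'} ⊆ N.tch S (N.comp (F \ U) w) := by
    rintro z ⟨hz, hzy⟩
    rcases nb_comp hz with h | ⟨h1, -, q, hq, hqa⟩
    · exact h
    · exact absurd (huniq z h1 q hq hqa) hzy
  exact ⟨y', hyU, ⟨Or.inr hyF, fun h => h.1.2 hyU, p, hp, ha⟩, hi.1.anti hsub,
    hi.2.mono (ind_mono (Set.union_subset_union_right _ hsub))⟩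

/-- Without contact to `S`, the component has at most the neighbours `x` and `y`, both in `F`. One
serves as the vertex of `U`; the component with the other is good because `F` is. -/
theorem minor_of_two (hF : N.Good (N.ind F)) (hw : w ∈ F \ U) (hu : v ∈ U)
    (hc : N.con (N.ind F) w v)
    (htwo : ∀ z ∈ U, ∀ p ∈ N.comp (F \ U) w, N.adj p z → z = x ∨ z = y)
    (ht : N.tch S (N.comp (F \ U) w) = ∅) : N.Minor (S ∪ F) U (N.comp (F \ U) w) := by
  obtain ⟨y', hyU, hyF, p, hp, ha⟩ := exists_adj_of_con hw hu hc
  have hnb : ∀ z ∈ N.nb (S ∪ F) (N.comp (F \ U) w), z ∈ F ∧ (z = x ∨ z = y) := by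
    intro z hz
    rcases nb_comp hz with h | ⟨h1, h2, q, hq, hqa⟩
    · rw [ht] at h; exact h.elim
    · exact ⟨h2, htwo z h1 q hq hqa⟩
  have hy' := htwo y' hyU p hp ha
  refine ⟨y', hyU, ⟨Or.inr hyF, fun h => h.1.2 hyU, p, hp, ha⟩, ?_, hF.mono (ind_mono ?_)⟩
  · rintro z ⟨hz, hzy⟩ z' ⟨hz', hzy'⟩
    have h1 := (hnb z hz).2
    have h2 := (hnb z' hz').2
    simp only [Set.mem_singleton_iff] at hzy hzy'
    rcases hy' with rfl | rfl <;> rcases h1 with rfl | rfl <;> rcases h2 with rfl | rfl <;>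
      simp_all
  · rintro z (hz | hz)
    · exact hz.1.1
    · exact (hnb z hz.1).1

theorem mem_att (ht : a ∈ N.tch S C) (hv : ∀ z ∈ C, N.con (N.ind C) v z) {R : Set V}
    (hC : C ⊆ R) : a ∈ N.Att S R v := by
  obtain ⟨haS, p, hp, ha⟩ := ht
  exact ⟨haS, ((hv p hp).mono (ind_mono (hC.trans (Set.subset_insert _ _)))).trans
    (ha.con (Set.mem_insert_of_mem _ (hC hp)) (Set.mem_insert _ _))⟩

/-- All vertices of `S` touched by `C` are attached to `v` through its region, so `single` leaves at
most one; goodness is `triple` for `p = q = r = v`. -/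
theorem Stuck.inert_of_subset_reg (h : N.Stuck S F) (hv : v ∈ F) (hC : C ⊆ N.reg S F {v})
    (hc : ∀ z ∈ C, N.con (N.ind C) v z) : N.Inert S C := by
  refine ⟨(h.single v hv).anti fun a ha => mem_att ha hc hC, ?_⟩
  have := h.triple v hv v hv v hv
  simp only [Set.mem_singleton_iff, Set.insert_eq_of_mem] at this
  refine this.mono (ind_mono ?_)
  rintro z (hz | hz)
  · exact Or.inr (hC hz)
  · exact Or.inl hz.1

theorem mem_reg_singleton (hw : w ∈ F) (hc : N.con (N.ind F) w v)
    (hi : w ≠ v → N.Inert S (N.comp (F \ {v}) w)) : w ∈ N.reg S F {v} := by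
  refine ⟨hw, ?_⟩
  by_cases hwv : w = v
  · exact Or.inl hwv
  · exact Or.inr (minor_of_inert (y := v) ⟨hw, hwv⟩ (Set.mem_singleton v) hc
      (fun z hz _ _ _ => hz) (hi hwv))

/-- If all components are inert, then the whole graph is a forest of odd cacti. -/
theorem Stuck.good_of_inert (h : N.Stuck S F) (hi : ∀ v ∈ F, N.Inert S (N.comp F v)) :
    N.Good (N.ind (S ∪ F)) := by
  classical
  -- An edge meeting `F` lies in a component of `F` extended by its only contact vertex `c` in `S`;
  -- everything outside the component is collapsed to `c`.
  have key : ∀ e ∈ N.ind (S ∪ F), ∀ x y, N.Joins e x y → x ∈ F → N.GoodAt (N.ind (S ∪ F)) e := by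
    intro e he x y hj hx
    obtain ⟨c, hc⟩ : ∃ c, N.tch S (N.comp F x) ⊆ {c} := by
      rcases (hi x hx).1.eq_empty_or_singleton with h | ⟨c, h⟩
      · exact ⟨x, by simp [h]⟩
      · exact ⟨c, h.le⟩
    have hcl : ∀ f ∈ N.ind (S ∪ F), ∀ u u', N.Joins f u u' → u ∈ N.comp F x →
        u' ∈ N.comp F x ∪ N.tch S (N.comp F x) := by
      intro f hf u u' hj hu
      rcases (hj.mem_ind.1 hf).2 with h | h
      · exact Or.inr ⟨h, u, hu, f, hj⟩
      · exact Or.inl (comp_closed hu h ⟨f, hj⟩)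
    refine GoodAt.of_retract (E' := N.ind (N.comp F x ∪ N.tch S (N.comp F x)))
      (fun z => if z ∈ N.comp F x then z else c) (ind_mono ?_) ?_ ?_ ?_ ?_
    · rintro z (hz | hz)
      · exact Or.inr hz.1
      · exact Or.inl hz.1
    · have : ∀ z ∈ N.comp F x ∪ N.tch S (N.comp F x),
          (if z ∈ N.comp F x then z else c) = z := by
        rintro z (hz | hz)
        · simp [hz]
        · have := hc hz
          simp_all
      exact fun f hf => ⟨this _ hf.1, this _ hf.2⟩
    · intro f hf hf'
      have h1 : (N.ends f).1 ∉ N.comp F x := fun h => hf' ⟨Or.inl h, hcl f hf _ _ (joins_ends f) h⟩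
      have h2 : (N.ends f).2 ∉ N.comp F x :=
        fun h => hf' ⟨hcl f hf _ _ (joins_ends f).symm h, Or.inl h⟩
      simp [h1, h2]
    · exact hj.mem_ind.2 ⟨Or.inl (mem_comp_self hx), hcl e he _ _ hj (mem_comp_self hx)⟩
    · exact (hi x hx).2 e
        (hj.mem_ind.2 ⟨Or.inl (mem_comp_self hx), hcl e he _ _ hj (mem_comp_self hx)⟩)
  intro e he
  by_cases h1 : (N.ends e).1 ∈ F
  · exact key e he _ _ (joins_ends e) h1
  by_cases h2 : (N.ends e).2 ∈ F
  · exact key e he _ _ (joins_ends e).symm h2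
  have heS : e ∈ N.ind S := ⟨he.1.resolve_right h1, he.2.resolve_right h2⟩
  -- For the edges inside `S`, each component of `F` is folded onto its contact vertex in `S`. A
  -- component without contact may go anywhere, as no edge leaves it.
  let r : Set V → V := fun K =>
    if hK : (N.tch S K).Nonempty then hK.some else (N.ends e).1
  refine GoodAt.of_retract (E' := N.ind S) (fun z => if z ∈ F then r (N.comp F z) else z)
    (ind_mono Set.subset_union_left) ?_ ?_ heS (h.goodS e heS)
  · have hnF : ∀ z ∈ S, z ∉ F := fun z hz => Set.disjoint_left.1 h.disj hz
    intro f hf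
    simp [hnF _ hf.1, hnF _ hf.2]
  · have aux : ∀ f u u', N.Joins f u u' → u ∈ F → u' ∈ S →
        r (N.comp F u) = u' := by
      intro f u u' hj hu hu'
      have hm : u' ∈ N.tch S (N.comp F u) := ⟨hu', u, mem_comp_self hu, f, hj⟩
      have hne : (N.tch S (N.comp F u)).Nonempty := ⟨_, hm⟩
      simp only [r, hne, dif_pos]
      exact (hi u hu).1 hne.some_mem hm
    intro f hf hf'
    by_cases hf1 : (N.ends f).1 ∈ F <;> by_cases hf2 : (N.ends f).2 ∈ F
    · have : N.comp F (N.ends f).2 = N.comp F (N.ends f).1 :=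
        comp_eq ⟨hf2, con_edge ⟨hf1, hf2⟩⟩
      simp only [hf1, hf2, if_true, this]
    · simp only [hf1, hf2, if_true, if_false]
      exact aux f _ _ (joins_ends f) hf1 (hf.2.resolve_right hf2)
    · simp only [hf1, hf2, if_true, if_false]
      exact (aux f _ _ (joins_ends f).symm hf2 (hf.1.resolve_right hf1)).symm
    · exact absurd ⟨hf.1.resolve_right hf1, hf.2.resolve_right hf2⟩ hf'

end Net
end EvenCycle

/-! ### A ring with inert fibres: how many fibres can touch the kept vertices. -/

namespace EvenCycle
namespace Net

variable {V β : Type*} {N : Net V β} {P C S F U : Set V} {x y z v w a b c : V}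
  {n : ℕ} {Q : ℕ → V} {ε : ℕ → β} {g : V → ℕ} {i j l lo hi : ℕ}

/-- The vertices of `P` with value `j`. -/
def fib (P : Set V) (g : V → ℕ) (j : ℕ) : Set V := {x | x ∈ P ∧ g x = j}

/-- Both ends of such an edge would be `x`, but there are no loops. -/
theorem ind_disjoint {A B : Set V} (h : A ∩ B ⊆ {x}) {e : β} (hA : e ∈ N.ind A)
    (hB : e ∈ N.ind B) : False :=
  N.ne e ((h ⟨hA.1, hB.1⟩).trans (h ⟨hA.2, hB.2⟩).symm)

/-- A gated set inside `F` that is connected to the rest of `F` by the root of the ring only. -/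
structure IsPendant (N : Net V β) (S F P : Set V) (n : ℕ) (Q : ℕ → V) (ε : ℕ → β) (g : V → ℕ) :
    Prop extends N.IsGated P n Q ε g where
  sub : P ⊆ F
  root_mem : Q 0 ∈ F
  closed : ∀ z ∈ P, ∀ z' ∈ F, z' ≠ Q 0 → N.adj z z' → z' ∈ P
  con_root : ∀ z ∈ P, N.con (N.ind F) z (Q 0)
  stuck : N.Stuck S F

namespace IsPendant

/-- A run of consecutive fibres can be left within `F` only through the ring vertices at its two
ends. The value `hi = n + 1` stands for the root, reached from the other side. -/
theorem edge_out (h : N.IsPendant S F P n Q ε g) (hz : z ∈ P) (h1 : lo < g z) (h2 : g z < hi)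
    (hhi : hi ≤ n + 1) (hy : y ∈ F) (ha : N.adj z y) :
    (y ∈ P ∧ lo < g y ∧ g y < hi) ∨ y = Q lo ∨ y = Q hi := by
  have hn := h.ring.two_le
  by_cases hy0 : y = Q 0
  · subst hy0
    rcases h.root z hz ha.symm with rfl | rfl
    · rw [h.gate 1 le_rfl (by omega)] at h1
      obtain rfl : lo = 0 := by omega
      exact Or.inr (Or.inl rfl)
    · rw [h.gate n (by omega) le_rfl] at h2
      obtain rfl : hi = n + 1 := by omega
      exact Or.inr (Or.inr h.ring.closed.symm)
  · have hyP := h.closed z hz y hy hy0 ha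
    rcases h.step z hz y hyP ha with he | ⟨i, hi1, hin, ⟨rfl, rfl⟩ | ⟨rfl, rfl⟩⟩
    · exact Or.inl ⟨hyP, he ▸ h1, he ▸ h2⟩
    · rw [h.gate i hi1 hin.le] at h1 h2
      by_cases hb : i + 1 = hi
      · exact Or.inr (Or.inr (by rw [hb]))
      · refine Or.inl ⟨hyP, ?_⟩
        rw [h.gate _ (by omega) (by omega)]
        omega
    · rw [h.gate (i + 1) (by omega) hin] at h1 h2
      by_cases hb : i = lo
      · exact Or.inr (Or.inl (by rw [hb]))
      · refine Or.inl ⟨hyP, ?_⟩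
        rw [h.gate _ (by omega) (by omega)]
        omega

theorem mem_F (h : N.IsPendant S F P n Q ε g) (hi : i ≤ n + 1) : Q i ∈ F := by
  rcases Nat.eq_zero_or_pos i with rfl | h0
  · exact h.root_mem
  · by_cases hin : i = n + 1
    · rw [hin, h.ring.closed]; exact h.root_mem
    · exact h.sub (h.mem i h0 (by omega))

theorem con_Q (h : N.IsPendant S F P n Q ε g) (hz : z ∈ P) (hj : j ≤ n + 1) :
    N.con (N.ind F) z (Q j) := by
  rcases Nat.eq_zero_or_pos j with rfl | h0
  · exact h.con_root z hz
  · by_cases hjn : j = n + 1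
    · rw [hjn, h.ring.closed]; exact h.con_root z hz
    · exact (h.con_root z hz).trans (h.con_root _ (h.mem j h0 (by omega))).symm

/-- A fibre is attached to the rest of `F` at its ring vertex only. -/
theorem fib_edge (h : N.IsPendant S F P n Q ε g) (hz : z ∈ fib P g j) (hzj : z ≠ Q j)
    (hy : y ∈ F) (ha : N.adj z y) : y ∈ fib P g j := by
  obtain ⟨hzP, rfl⟩ := hz
  have hn := h.ring.two_le
  by_cases hy0 : y = Q 0
  · subst hy0
    rcases h.root z hzP ha.symm with rfl | rfl
    · rw [h.gate 1 le_rfl (by omega)] at hzj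
      exact absurd rfl hzj
    · rw [h.gate n (by omega) le_rfl] at hzj
      exact absurd rfl hzj
  · have hyP := h.closed z hzP y hy hy0 ha
    rcases h.step z hzP y hyP ha with he | ⟨i, hi1, hin, ⟨rfl, rfl⟩ | ⟨rfl, rfl⟩⟩
    · exact ⟨hyP, he.symm⟩
    · rw [h.gate i hi1 hin.le] at hzj
      exact absurd rfl hzj
    · rw [h.gate (i + 1) (by omega) hin] at hzj
      exact absurd rfl hzj

theorem fib_con (h : N.IsPendant S F P n Q ε g) (hz : z ∈ fib P g j) :
    N.con (N.ind (fib P g j)) (Q j) z := by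
  obtain ⟨hzP, rfl⟩ := hz
  exact (h.con z hzP).symm

theorem comp_subset_fib (h : N.IsPendant S F P n Q ε g) (hQ : Q j ∈ U) (hw : w ∈ fib P g j)
    (hwU : w ∉ U) : N.comp (F \ U) w ⊆ fib P g j \ {Q j} := by
  refine comp_subset_of_closed ⟨hw, fun h => hwU (h ▸ hQ)⟩ ?_
  rintro z ⟨hz, hzj⟩ y ⟨hy, hyU⟩ ha
  exact ⟨h.fib_edge hz hzj hy ha, fun h => hyU (h ▸ hQ)⟩

/-- The components hanging from `Q j` inside its fibre miss `Q j`, so they are smaller than `P` and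
inert by minimality. Hence the fibre lies in the region of `Q j`. -/
theorem fib_inert (h : N.IsPendant S F P n Q ε g)
    (hmin : ∀ v ∈ F, ∀ w ∈ F, w ≠ v → N.con (N.ind F) w v → N.comp (F \ {v}) w ⊂ P →
      N.Inert S (N.comp (F \ {v}) w)) (h1 : 1 ≤ j) (h2 : j ≤ n) : N.Inert S (fib P g j) := by
  refine h.stuck.inert_of_subset_reg (h.mem_F (i := j) (by omega)) ?_ fun z hz => h.fib_con hz
  intro w hw
  refine mem_reg_singleton (h.sub hw.1) (h.con_Q hw.1 (by omega)) fun hne => ?_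
  refine hmin _ (h.mem_F (by omega)) _ (h.sub hw.1) hne (h.con_Q hw.1 (by omega)) ?_
  have hsub := h.comp_subset_fib (Set.mem_singleton (Q j)) hw hne
  refine ⟨fun z hz => (hsub hz).1.1, fun hP => ?_⟩
  exact (hsub (hP (h.mem j h1 h2))).2 rfl

theorem fib_reg (h : N.IsPendant S F P n Q ε g) (hi : N.Inert S (fib P g j)) (hj : j ≤ n)
    (hQ : Q j ∈ U) (hU : U ⊆ F) (hU' : ∀ z ∈ U, z ∈ fib P g j → z = Q j) :
    fib P g j ⊆ N.reg S F U := by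
  intro w hw
  refine ⟨h.sub hw.1, ?_⟩
  by_cases hwU : w ∈ U
  · exact Or.inl hwU
  have hsub := h.comp_subset_fib hQ hw hwU
  refine Or.inr (minor_of_inert (y := Q j) ⟨h.sub hw.1, hwU⟩ hQ (h.con_Q hw.1 (by omega)) ?_
    (hi.mono fun z hz => (hsub hz).1))
  intro z hz p hp ha
  obtain ⟨h1, h2⟩ := hsub hp
  exact hU' z hz (h.fib_edge h1 h2 (hU hz) ha)

/-- A run of fibres without contact to `S` has only `Q lo` and `Q hi` as neighbours in `U`, so its
components are minor by `minor_of_two`. -/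
theorem seg_reg (h : N.IsPendant S F P n Q ε g) (hhi : hi ≤ n + 1) (hlo : lo ≤ hi)
    (hQlo : Q lo ∈ U) (hQhi : Q hi ∈ U) (hU : U ⊆ F) (hU' : ∀ z ∈ U, z ∈ P → g z ≤ lo ∨ hi ≤ g z)
    (ht : ∀ j, lo < j → j < hi → ¬ (N.tch S (fib P g j)).Nonempty) (hw : w ∈ P)
    (h1 : lo < g w) (h2 : g w < hi) : w ∈ N.reg S F U := by
  have hwU : w ∉ U := fun hwU => by have := hU' w hwU hw; omega
  have hsub : N.comp (F \ U) w ⊆ {z | z ∈ P ∧ lo < g z ∧ g z < hi} := by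
    refine comp_subset_of_closed ⟨hw, h1, h2⟩ ?_
    rintro z ⟨hz, hz1, hz2⟩ y ⟨hy, hyU⟩ ha
    rcases h.edge_out hz hz1 hz2 hhi hy ha with h | rfl | rfl
    · exact h
    · exact absurd hQlo hyU
    · exact absurd hQhi hyU
  refine ⟨h.sub hw, Or.inr (minor_of_two (x := Q lo) (y := Q hi) h.stuck.goodF
    ⟨h.sub hw, hwU⟩ hQlo (h.con_Q hw (by omega)) ?_ ?_)⟩
  · intro z hz p hp ha
    obtain ⟨hp1, hp2, hp3⟩ := hsub hp
    rcases h.edge_out hp1 hp2 hp3 hhi (hU hz) ha with ⟨h1, h2, h3⟩ | h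
    · have := hU' z hz h1
      omega
    · exact h
  · rw [Set.eq_empty_iff_forall_notMem]
    rintro a ⟨haS, p, hp, ha⟩
    obtain ⟨hp1, hp2, hp3⟩ := hsub hp
    exact ht _ hp2 hp3 ⟨a, haS, p, ⟨hp1, rfl⟩, ha⟩

/-- The ends of a ring edge lie in different fibres, or one of them is the root. -/
theorem ring_notMem (h : N.IsPendant S F P n Q ε g) (hl : l ≤ n) :
    ε l ∉ N.ind (S ∪ fib P g j) := by
  intro he
  rw [(h.ring.joins l hl).mem_ind] at he
  have aux : ∀ i ≤ n + 1, Q i ∈ S ∪ fib P g j → 1 ≤ i ∧ i ≤ n ∧ i = j := by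
    rintro i hi (hS | ⟨hP, hg⟩)
    · exact absurd (h.mem_F hi) (Set.disjoint_left.1 h.stuck.disj hS)
    · have h0 : 1 ≤ i := by
        rcases Nat.eq_zero_or_pos i with rfl | h0
        · exact absurd hP h.notMem
        · exact h0
      have hn : i ≤ n := by
        by_contra hn
        obtain rfl : i = n + 1 := by omega
        rw [h.ring.closed] at hP
        exact h.notMem hP
      rw [h.gate i h0 hn] at hg
      exact ⟨h0, hn, hg⟩
  have h1 := aux l (by omega) he.1
  have h2 := aux (l + 1) (by omega) he.2
  omega

theorem con_tch (h : N.IsPendant S F P n Q ε g) (ha : a ∈ N.tch S (fib P g j)) :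
    N.con (N.ind (insert a (fib P g j))) (Q j) a := by
  obtain ⟨-, p, hp, hpa⟩ := ha
  exact ((h.fib_con hp).mono (ind_mono (Set.subset_insert _ _))).trans
    (hpa.con (Set.mem_insert_of_mem _ hp) (Set.mem_insert _ _))

/-- For two successive fibres touching `S`, the region of `{Q i, Q j}` contains both fibres and
everything between them. The arc connects `Q i` and `Q j` in it, so failure of the pair rule puts
`a` and `b` in one component of `S`. -/
theorem con_pair (h : N.IsPendant S F P n Q ε g) (hin : ∀ j, 1 ≤ j → j ≤ n → N.Inert S (fib P g j))
    (hi : 1 ≤ i) (hij : i < j) (hj : j ≤ n)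
    (hb : ∀ l, i < l → l < j → ¬ (N.tch S (fib P g l)).Nonempty)
    (ha : a ∈ N.tch S (fib P g i)) (hb' : b ∈ N.tch S (fib P g j)) : N.con (N.ind S) a b := by
  have hU : ({Q i, Q j} : Set V) ⊆ F := by
    rintro z (rfl | rfl)
    · exact h.mem_F (by omega)
    · exact h.mem_F (by omega)
  have gi := h.gate i hi (by omega)
  have gj := h.gate j (by omega) hj
  have hfi : fib P g i ⊆ N.reg S F {Q i, Q j} := by
    refine h.fib_reg (hin i hi (by omega)) (by omega) (by simp) hU ?_
    rintro z (rfl | rfl) ⟨_, hz⟩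
    · rfl
    · omega
  have hfj : fib P g j ⊆ N.reg S F {Q i, Q j} := by
    refine h.fib_reg (hin j (by omega) hj) (by omega) (by simp) hU ?_
    rintro z (rfl | rfl) ⟨_, hz⟩
    · omega
    · rfl
  have hseg : ∀ z ∈ P, i < g z → g z < j → z ∈ N.reg S F {Q i, Q j} := by
    intro z hz h1 h2
    refine h.seg_reg (by omega) hij.le (by simp) (by simp) hU ?_ hb hz h1 h2
    rintro z (rfl | rfl) _ <;> omega
  have hQ : ∀ l, i ≤ l → l ≤ j → Q l ∈ N.reg S F {Q i, Q j} := by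
    intro l h1 h2
    have hg := h.gate l (by omega) (by omega)
    have hP := h.mem l (by omega) (by omega)
    by_cases hl : l = i
    · exact hfi ⟨hP, by omega⟩
    by_cases hl' : l = j
    · exact hfj ⟨hP, by omega⟩
    exact hseg _ hP (by omega) (by omega)
  have hpq : N.con (N.ind (N.reg S F {Q i, Q j})) (Q i) (Q j) := by
    refine (con_arc (fun m _ h' => h.ring.joins m (by omega)) hij.le).mono ?_
    rintro e ⟨m, h1, h2, rfl⟩
    exact (h.ring.joins m (by omega)).mem_ind.2 ⟨hQ _ h1 h2.le, hQ _ (by omega) h2⟩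
  refine h.stuck.pair _ (hU (by simp)) _ (hU (by simp)) hpq a ⟨ha.1, ?_⟩ b ⟨hb'.1, ?_⟩
  · exact (h.con_tch ha).mono (ind_mono (Set.insert_subset_insert hfi))
  · exact (hpq.mono (ind_mono (Set.subset_insert _ _))).trans
      ((h.con_tch hb').mono (ind_mono (Set.insert_subset_insert hfj)))

/-- If only two fibres touch `S`, the region of `{Q 0, Q i, Q j}` contains `P` and thus the whole
ring. The walk from `Q i` through `a`, `S` and `b` to `Q j` is an ear of the ring inside a graph
that is good by `triple`. -/
theorem not_two [Finite β] (h : N.IsPendant S F P n Q ε g)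
    (hin : ∀ j, 1 ≤ j → j ≤ n → N.Inert S (fib P g j))
    (hi : 1 ≤ i) (hij : i < j) (hj : j ≤ n)
    (hb : ∀ l, l ≠ i → l ≠ j → ¬ (N.tch S (fib P g l)).Nonempty)
    (ha : a ∈ N.tch S (fib P g i)) (hb' : b ∈ N.tch S (fib P g j)) : False := by
  have hab := h.con_pair hin hi hij hj (fun l h1 h2 => hb l (by omega) (by omega)) ha hb'
  have hU : ({Q 0, Q i, Q j} : Set V) ⊆ F := by
    rintro z (rfl | rfl | rfl) <;> exact h.mem_F (by omega)
  have gi := h.gate i hi (by omega)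
  have gj := h.gate j (by omega) hj
  have hP : P ⊆ N.reg S F {Q 0, Q i, Q j} := by
    intro z hz
    have hbd := h.bounds z hz
    rcases lt_trichotomy (g z) i with hzi | hzi | hzi
    · refine h.seg_reg (lo := 0) (hi := i) (by omega) (by omega) (by simp) (by simp) hU ?_
        (fun l h1 h2 => hb l (by omega) (by omega)) hz (by omega) hzi
      rintro z (rfl | rfl | rfl) hz
      · exact absurd hz h.notMem
      · omega
      · omega
    · refine h.fib_reg (hin i hi (by omega)) (by omega) (by simp) hU ?_ ⟨hz, hzi⟩
      rintro z (rfl | rfl | rfl) ⟨hz, hz'⟩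
      · exact absurd hz h.notMem
      · rfl
      · omega
    rcases lt_trichotomy (g z) j with hzj | hzj | hzj
    · refine h.seg_reg (lo := i) (hi := j) (by omega) (by omega) (by simp) (by simp) hU ?_
        (fun l h1 h2 => hb l (by omega) (by omega)) hz hzi hzj
      rintro z (rfl | rfl | rfl) hz
      · exact absurd hz h.notMem
      · omega
      · omega
    · refine h.fib_reg (hin j (by omega) hj) (by omega) (by simp) hU ?_ ⟨hz, hzj⟩
      rintro z (rfl | rfl | rfl) ⟨hz, hz'⟩
      · exact absurd hz h.notMem
      · omega
      · rfl
    · refine h.seg_reg (lo := j) (hi := n + 1) le_rfl (by omega) (by simp)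
        (by simp [h.ring.closed]) hU ?_
        (fun l h1 h2 => hb l (by omega) (by omega)) hz hzj (by omega)
      rintro z (rfl | rfl | rfl) hz
      · exact absurd hz h.notMem
      · omega
      · omega
  have hQ : ∀ l ≤ n + 1, Q l ∈ N.reg S F {Q 0, Q i, Q j} := by
    intro l hl
    have h0 : Q 0 ∈ N.reg S F {Q 0, Q i, Q j} := subset_reg hU (by simp)
    rcases Nat.eq_zero_or_pos l with rfl | hl0
    · exact h0
    · by_cases hln : l = n + 1
      · rw [hln, h.ring.closed]; exact h0
      · exact hP (h.mem l hl0 (by omega))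
  have hG := h.stuck.triple _ (hU (by simp : Q 0 ∈ _)) _ (hU (by simp : Q i ∈ _)) _
    (hU (by simp : Q j ∈ _))
  refine h.ring.no_ear hG (fun l hl => (h.ring.joins l hl).mem_ind.2
    ⟨Or.inr (hQ l (by omega)), Or.inr (hQ _ (by omega))⟩) hij hj ?_
  have hup : ∀ m, N.ind (S ∪ fib P g m) ⊆
      N.ind (S ∪ N.reg S F {Q 0, Q i, Q j}) \ {e | ∃ l ≤ n, ε l = e} := by
    intro m e he
    refine ⟨ind_mono (Set.union_subset_union_right _ fun z hz => hP hz.1) he, ?_⟩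
    rintro ⟨l, hl, rfl⟩
    exact h.ring_notMem hl he
  have hins : ∀ m a, a ∈ S → insert a (fib P g m) ⊆ S ∪ fib P g m := by
    rintro m a ha z (rfl | hz)
    · exact Or.inl ha
    · exact Or.inr hz
  exact (((h.con_tch ha).mono (ind_mono (hins _ _ ha.1))).mono (hup i)).trans
    ((hab.mono ((ind_mono Set.subset_union_left).trans (hup i))).trans
      (((h.con_tch hb').mono (ind_mono (hins _ _ hb'.1))).mono (hup j)).symm)

/-- In `S` with the region of `{Q i, Q j, Q l}`, the vertices `Q j` and `b` are joined inside fibre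
`j`, and also by detours through fibres `i` and `l` that return to `b` through `S`. The detours
share only edges of `S`, so no other edge cuts both. This is the forbidden configuration with `E₀`
the edges of `S` and `E₁` those of fibre `j` with `b`. -/
theorem not_three [Finite β] (h : N.IsPendant S F P n Q ε g)
    (hin : ∀ j, 1 ≤ j → j ≤ n → N.Inert S (fib P g j))
    (hi : 1 ≤ i) (hij : i < j) (hjl : j < l) (hl : l ≤ n)
    (hb : ∀ m, i < m → m < l → m ≠ j → ¬ (N.tch S (fib P g m)).Nonempty)
    (ha : a ∈ N.tch S (fib P g i)) (hb' : b ∈ N.tch S (fib P g j))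
    (hc : c ∈ N.tch S (fib P g l)) : False := by
  have hab := h.con_pair hin hi hij (by omega) (fun l h1 h2 => hb l h1 (by omega) (by omega)) ha hb'
  have hbc := h.con_pair hin (by omega) hjl hl (fun l h1 h2 => hb l (by omega) h2 (by omega)) hb' hc
  have hU : ({Q i, Q j, Q l} : Set V) ⊆ F := by
    rintro z (rfl | rfl | rfl) <;> exact h.mem_F (by omega)
  have gi := h.gate i hi (by omega)
  have gj := h.gate j (by omega) (by omega)
  have gl := h.gate l (by omega) hl
  have hR : ∀ z ∈ P, i ≤ g z → g z ≤ l → z ∈ N.reg S F {Q i, Q j, Q l} := by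
    intro z hz h1 h2
    rcases h1.eq_or_lt with h1 | h1
    · refine h.fib_reg (hin i hi (by omega)) (by omega) (by simp) hU ?_ ⟨hz, h1.symm⟩
      rintro z (rfl | rfl | rfl) ⟨hz, hz'⟩
      · rfl
      · omega
      · omega
    rcases h2.eq_or_lt with h2 | h2
    · refine h.fib_reg (hin l (by omega) hl) (by omega) (by simp) hU ?_ ⟨hz, h2⟩
      rintro z (rfl | rfl | rfl) ⟨hz, hz'⟩
      · omega
      · omega
      · rfl
    rcases lt_trichotomy (g z) j with hzj | hzj | hzj
    · refine h.seg_reg (lo := i) (hi := j) (by omega) (by omega) (by simp) (by simp) hU ?_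
        (fun l h1 h2 => hb l (by omega) (by omega) (by omega)) hz h1 hzj
      rintro z (rfl | rfl | rfl) hz <;> omega
    · refine h.fib_reg (hin j (by omega) (by omega)) (by omega) (by simp) hU ?_ ⟨hz, hzj⟩
      rintro z (rfl | rfl | rfl) ⟨hz, hz'⟩
      · omega
      · rfl
      · omega
    · refine h.seg_reg (lo := j) (hi := l) (by omega) (by omega) (by simp) (by simp) hU ?_
        (fun l h1 h2 => hb l (by omega) (by omega) (by omega)) hz hzj h2
      rintro z (rfl | rfl | rfl) hz <;> omega
  have hG := h.stuck.triple _ (hU (by simp : Q i ∈ _)) _ (hU (by simp : Q j ∈ _)) _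
    (hU (by simp : Q l ∈ _))
  have hQ : ∀ m, i ≤ m → m ≤ l → Q m ∈ N.reg S F {Q i, Q j, Q l} := by
    intro m h1 h2
    have := h.gate m (by omega) (by omega)
    exact hR _ (h.mem m (by omega) (by omega)) (by omega) (by omega)
  have hPS : ∀ z ∈ P, z ∉ S := fun z hz hS => Set.disjoint_left.1 h.stuck.disj hS (h.sub hz)
  have hfib : ∀ m, i ≤ m → m ≤ l → ∀ d ∈ S,
      insert d (fib P g m) ⊆ S ∪ N.reg S F {Q i, Q j, Q l} := by
    rintro m h1 h2 d hd z (rfl | ⟨hz, rfl⟩)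
    · exact Or.inl hd
    · exact Or.inr (hR z hz h1 h2)
  have hcap : ∀ m m' d d', d ∈ S → d' ∈ S → m ≠ m' →
      insert d (fib P g m) ∩ insert d' (fib P g m') ⊆ {d} := by
    rintro m m' d d' hd hd' hm z ⟨rfl | ⟨hz, rfl⟩, rfl | ⟨hz', hz''⟩⟩
    · rfl
    · rfl
    · exact absurd hd' (hPS _ hz)
    · exact absurd hz'' hm
  have hnr : ∀ m m' d, d ∈ S → m ≤ n → ε m ∉ N.ind (insert d (fib P g m')) := by
    intro m m' d hd hm he
    refine h.ring_notMem (j := m') hm (ind_mono ?_ he)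
    rintro z (rfl | hz)
    · exact Or.inl hd
    · exact Or.inr hz
  set E := N.ind (S ∪ N.reg S F {Q i, Q j, Q l}) with hE
  set arc : ℕ → ℕ → Set β := fun s t => {e | ∃ m, s ≤ m ∧ m < t ∧ ε m = e} with harc
  have hcarc : ∀ s t, i ≤ s → s ≤ t → t ≤ l → N.con (arc s t) (Q s) (Q t) := fun s t _ h2 h3 =>
    con_arc (fun m _ h' => h.ring.joins m (by omega)) h2
  have harcE : ∀ s t, i ≤ s → t ≤ l → arc s t ⊆ E := by
    rintro s t h1 h2 e ⟨m, h3, h4, rfl⟩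
    exact (h.ring.joins m (by omega)).mem_ind.2
      ⟨Or.inr (hQ _ (by omega) (by omega)), Or.inr (hQ _ (by omega) (by omega))⟩
  -- a detour through the neighbouring fibre
  have route : ∀ (s t m : ℕ) (d : V), i ≤ s → s ≤ t → t ≤ l → m ≠ j → i ≤ m → m ≤ l →
      d ∈ N.tch S (fib P g m) → N.con (N.ind S) d b → N.con (arc s t) (Q j) (Q m) →
      ∀ f ∉ N.ind S, f ∉ arc s t ∪ N.ind (insert d (fib P g m)) →
      N.con ((E \ N.ind (insert b (fib P g j))) \ {f}) (Q j) b := by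
    intro s t m d h1 h2 h3 hmj hm1 hm2 hd hdb hcm f hfS hf
    have i1 : arc s t ⊆ (E \ N.ind (insert b (fib P g j))) \ {f} := by
      intro e he
      refine ⟨⟨harcE s t h1 h3 he, ?_⟩, fun h => hf (h ▸ Or.inl he)⟩
      obtain ⟨r, h3, h4, rfl⟩ := he
      exact hnr _ _ _ hb'.1 (by omega)
    have i2 : N.ind (insert d (fib P g m)) ⊆ (E \ N.ind (insert b (fib P g j))) \ {f} := by
      intro e he
      refine ⟨⟨ind_mono (hfib m hm1 hm2 d hd.1) he, fun he' => ?_⟩, fun h => hf (h ▸ Or.inr he)⟩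
      exact ind_disjoint (hcap m j d b hd.1 hb'.1 hmj) he he'
    have i3 : N.ind S ⊆ (E \ N.ind (insert b (fib P g j))) \ {f} := by
      intro e he
      refine ⟨⟨ind_mono Set.subset_union_left he, fun he' => ?_⟩, fun h => hfS (h ▸ he)⟩
      refine ind_disjoint (x := b) ?_ he he'
      rintro z ⟨hz, rfl | hz'⟩
      · rfl
      · exact absurd hz (hPS _ hz'.1)
    exact (hcm.mono i1).trans (((h.con_tch hd).mono i2).trans (hdb.mono i3))
  refine hG.not_triply_joined (E₀ := N.ind S) (E₁ := N.ind (insert b (fib P g j))) (x := Q j)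
    (y := b) (ind_mono Set.subset_union_left) (ind_mono (hfib j (by omega) (by omega) b hb'.1)) ?_
    ((h.con_tch hb').mono Set.subset_union_right) ?_ ?_
  · rw [Set.disjoint_left]
    intro e he he'
    refine ind_disjoint (x := b) ?_ he he'
    rintro z ⟨hz, rfl | hz'⟩
    · rfl
    · exact absurd hz (hPS _ hz'.1)
  · intro hcon
    have hjP := h.mem j (by omega) (by omega)
    rcases hcon.eq_or_mem with he | ⟨he, -⟩
    · exact hPS _ hjP (he ▸ hb'.1)
    · exact hPS _ hjP he
  · intro f hf
    -- If `f` spoils the detour through fibre `i`, the one through fibre `l` avoids it.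
    by_cases hf1 : f ∈ arc i j ∪ N.ind (insert a (fib P g i))
    · refine route j l l c (by omega) (by omega) le_rfl (by omega) (by omega) le_rfl hc hbc.symm
        (hcarc j l (by omega) (by omega) le_rfl) f hf ?_
      rintro (hf2 | hf2)
      · obtain ⟨m, h3, h4, rfl⟩ := hf2
        rcases hf1 with ⟨m', h5, h6, h7⟩ | hf1
        · exact h.ring.edge_inj (by omega) (by omega) h7
        · exact hnr _ _ _ ha.1 (by omega) hf1
      · rcases hf1 with ⟨m', h5, h6, rfl⟩ | hf1
        · exact hnr _ _ _ hc.1 (by omega) hf2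
        · exact ind_disjoint (hcap i l a c ha.1 hc.1 (by omega)) hf1 hf2
    · exact route i j i a le_rfl hij.le (by omega) (by omega) le_rfl (by omega) ha hab
        (hcarc i j le_rfl hij.le (by omega)).symm f hf hf1

end IsPendant

end Net
end EvenCycle

/-! ### The minimal counterexample and the existence of a branching set. -/

namespace EvenCycle
namespace Net

variable {V β : Type*} {N : Net V β} {P C S F U : Set V} {x y z v w a b c : V}
  {n : ℕ} {Q : ℕ → V} {ε : ℕ → β} {g : V → ℕ} {i j l lo hi : ℕ}

/-- The only fibre touching `S`, with its contact vertex, is glued to the rest of `P` at `Q j`. The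
former is good because it is inert, the latter because it lies in `F`; the two parts are checked by
retractions onto `Q j`. -/
theorem IsPendant.inert_of_one (h : N.IsPendant S F P n Q ε g)
    (hin : ∀ j, 1 ≤ j → j ≤ n → N.Inert S (fib P g j))
    (hone : ∀ i j, (N.tch S (fib P g i)).Nonempty → (N.tch S (fib P g j)).Nonempty → i = j) :
    N.Inert S P := by
  classical
  have hfib : ∀ a ∈ N.tch S P, ∃ j, 1 ≤ j ∧ j ≤ n ∧ a ∈ N.tch S (fib P g j) := by
    rintro a ⟨haS, p, hp, ha⟩
    exact ⟨g p, (h.bounds p hp).1, (h.bounds p hp).2, haS, p, ⟨hp, rfl⟩, ha⟩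
  refine ⟨?_, ?_⟩
  · intro a ha b hb
    obtain ⟨j, h1, h2, ha⟩ := hfib a ha
    obtain ⟨j', -, -, hb⟩ := hfib b hb
    obtain rfl := hone j j' ⟨a, ha⟩ ⟨b, hb⟩
    exact (hin j h1 h2).1 ha hb
  rcases (N.tch S P).eq_empty_or_nonempty with he | ⟨a, ha⟩
  · rw [he, Set.union_empty]
    exact h.stuck.goodF.mono (ind_mono h.sub)
  obtain ⟨j, hj1, hj2, haj⟩ := hfib a ha
  have htch : N.tch S P ⊆ N.tch S (fib P g j) := by
    intro b hb
    obtain ⟨j', -, -, hb⟩ := hfib b hb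
    obtain rfl := hone j j' ⟨a, haj⟩ ⟨b, hb⟩
    exact hb
  set D := fib P g j ∪ N.tch S (fib P g j) with hD
  have hPS : ∀ z ∈ P, z ∉ S := fun z hz hS => Set.disjoint_left.1 h.stuck.disj hS (h.sub hz)
  have hcross : ∀ f x y, N.Joins f x y → x ∈ D → y ∈ P ∪ N.tch S P → y ∉ D → x = Q j ∧ y ∈ P := by
    intro f x y hf hx hy hyD
    have hyP : y ∈ P := hy.resolve_right fun h => hyD (Or.inr (htch h))
    refine ⟨?_, hyP⟩
    rcases hx with hx | hx
    · by_contra hne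
      exact hyD (Or.inl (h.fib_edge hx hne (h.sub hyP) ⟨f, hf⟩))
    · have : x ∈ N.tch S (fib P g (g y)) := ⟨hx.1, y, ⟨hyP, rfl⟩, f, hf.symm⟩
      exact absurd (Or.inl ⟨hyP, hone _ _ ⟨x, this⟩ ⟨a, haj⟩⟩) hyD
  have hDP : D ⊆ P ∪ N.tch S P :=
    Set.union_subset_union (fun z hz => hz.1) (tch_mono fun z hz => hz.1)
  intro e he
  by_cases heD : e ∈ N.ind D
  · refine GoodAt.of_retract (E' := N.ind D) (fun z => if z ∈ D then z else Q j)
      (ind_mono hDP) (fun f hf => by simp [hf.1, hf.2]) ?_ heD ((hin j hj1 hj2).2 e heD)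
    intro f hf hfD
    by_cases h1 : (N.ends f).1 ∈ D <;> by_cases h2 : (N.ends f).2 ∈ D
    · exact absurd ⟨h1, h2⟩ hfD
    · simp only [h1, h2, if_true, if_false]
      exact (hcross f _ _ (joins_ends f) h1 hf.2 h2).1
    · simp only [h1, h2, if_true, if_false]
      exact (hcross f _ _ (joins_ends f).symm h2 hf.1 h1).1.symm
    · simp [h1, h2]
  · have hout : ∀ f ∈ N.ind (P ∪ N.tch S P) \ N.ind D, ∀ x y, N.Joins f x y →
        (x ∈ D → x = Q j) ∧ x ∈ P := by
      rintro f ⟨hf, hfD⟩ x y hj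
      rw [hj.mem_ind] at hf hfD
      by_cases hx : x ∈ D
      · have hy : y ∉ D := fun hy => hfD ⟨hx, hy⟩
        have := (hcross f x y hj hx hf.2 hy).1
        exact ⟨fun _ => this, this ▸ h.mem j hj1 hj2⟩
      · exact ⟨fun h => absurd h hx, hf.1.resolve_right fun h => hx (Or.inr (htch h))⟩
    refine GoodAt.of_retract (E' := N.ind (P ∪ N.tch S P) \ N.ind D)
      (fun z => if z ∈ D then Q j else z) Set.sdiff_subset ?_ ?_ ⟨he, heD⟩ ?_
    · intro f hf
      have h1 := (hout f hf _ _ (joins_ends f)).1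
      have h2 := (hout f hf _ _ (joins_ends f).symm).1
      constructor
      · by_cases h : (N.ends f).1 ∈ D
        · simp only [h, if_true]; exact (h1 h).symm
        · simp [h]
      · by_cases h : (N.ends f).2 ∈ D
        · simp only [h, if_true]; exact (h2 h).symm
        · simp [h]
    · intro f hf hf'
      have : f ∈ N.ind D := by
        by_contra h
        exact hf' ⟨hf, h⟩
      simp [this.1, this.2]
    · have hsub : N.ind (P ∪ N.tch S P) \ N.ind D ⊆ N.ind F := fun f hf =>
        ⟨h.sub (hout f hf _ _ (joins_ends f)).2, h.sub (hout f hf _ _ (joins_ends f).symm).2⟩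
      exact (h.stuck.goodF e (hsub ⟨he, heD⟩)).mono hsub

/-- Taking the first two or three indices of fibres that touch `S`, `not_two` and `not_three` leave
only the case of at most one such fibre. -/
theorem IsPendant.inert [Finite β] (h : N.IsPendant S F P n Q ε g)
    (hin : ∀ j, 1 ≤ j → j ≤ n → N.Inert S (fib P g j)) : N.Inert S P := by
  classical
  by_contra hni
  let act : ℕ → Prop := fun j => (N.tch S (fib P g j)).Nonempty
  have hbd : ∀ j, act j → 1 ≤ j ∧ j ≤ n := by
    rintro j ⟨a, -, p, hp, -⟩
    obtain ⟨hp, rfl⟩ := hp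
    exact h.bounds p hp
  have h2 : ∃ i, act i ∧ ∃ j, i < j ∧ act j := by
    by_contra hno
    push Not at hno
    refine hni (h.inert_of_one hin fun i j hi hj => ?_)
    rcases lt_trichotomy i j with hij | hij | hij
    · exact absurd hj (hno i hi j hij)
    · exact hij
    · exact absurd hi (hno j hj i hij)
  obtain ⟨i₀, hi₀, j₀, hij₀, hj₀⟩ := h2
  have hex : ∃ i, act i := ⟨i₀, hi₀⟩
  have hex2 : ∃ j, Nat.find hex < j ∧ act j :=
    ⟨j₀, (Nat.find_min' hex hi₀).trans_lt hij₀, hj₀⟩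
  obtain ⟨a, ha⟩ := Nat.find_spec hex
  obtain ⟨hij, b, hb⟩ := Nat.find_spec hex2
  have hmin1 : ∀ m, act m → Nat.find hex ≤ m := fun m hm => Nat.find_min' hex hm
  have hmin2 : ∀ m, Nat.find hex < m → act m → Nat.find hex2 ≤ m :=
    fun m h1 hm => Nat.find_min' hex2 ⟨h1, hm⟩
  by_cases hex3 : ∃ l, Nat.find hex2 < l ∧ act l
  · obtain ⟨hjl, c, hc⟩ := Nat.find_spec hex3
    have hmin3 : ∀ m, Nat.find hex2 < m → act m → Nat.find hex3 ≤ m :=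
      fun m h1 hm => Nat.find_min' hex3 ⟨h1, hm⟩
    refine h.not_three hin (hbd _ ⟨a, ha⟩).1 hij hjl (hbd _ ⟨c, hc⟩).2 ?_ ha hb hc
    intro m h1 h2 h3 hm
    have := hmin2 m h1 hm
    have := hmin3 m (by omega) hm
    omega
  · refine h.not_two hin (hbd _ ⟨a, ha⟩).1 hij (hbd _ ⟨b, hb⟩).2 ?_ ha hb
    intro m h1 h2 hm
    have := hmin1 m hm
    have := hmin2 m (by omega) hm
    exact hex3 ⟨m, by omega, hm⟩

/-- If no branching rule applies, then the graph is a forest of odd cacti. -/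
theorem Stuck.good [Finite β] (h : N.Stuck S F) : N.Good (N.ind (S ∪ F)) := by
  classical
  refine h.good_of_inert fun v hv => ?_
  by_contra hK
  -- The counterexample is taken over all components hanging from a single vertex `v`, and `P` is a
  -- smallest one. Some bad pair exists, since otherwise the whole component would lie in the region
  -- of one vertex and be inert.
  let bad : V → V → Prop := fun v w => v ∈ F ∧ w ∈ F ∧ w ≠ v ∧ N.con (N.ind F) w v ∧
    ¬ N.Inert S (N.comp (F \ {v}) w)
  have hbad : ∃ k v w, bad v w ∧ (N.comp (F \ {v}) w).ncard = k := by
    by_contra hno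
    push Not at hno
    refine hK (h.inert_of_subset_reg hv (fun w hw => ?_) fun z hz => con_comp hz)
    refine mem_reg_singleton hw.1 hw.2.symm fun hne => ?_
    by_contra hni
    exact hno _ v w ⟨hv, hw.1, hne, hw.2.symm, hni⟩ rfl
  obtain ⟨v, w, ⟨hv, hw, hwv, hc, hni⟩, hk⟩ := Nat.find_spec hbad
  set P := N.comp (F \ {v}) w with hP
  have hPfin : P.Finite := h.fin.subset fun z hz => hz.1.1
  have hPF : P ⊆ F := fun z hz => hz.1.1
  have hvP : v ∉ P := fun h => h.1.2 rfl
  have hmin : ∀ v ∈ F, ∀ w ∈ F, w ≠ v → N.con (N.ind F) w v → N.comp (F \ {v}) w ⊂ P →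
      N.Inert S (N.comp (F \ {v}) w) := by
    intro v' hv' w' hw' hne' hc' hlt
    by_contra hni'
    have := Nat.find_min' hbad ⟨v', w', ⟨hv', hw', hne', hc', hni'⟩, rfl⟩
    have := Set.ncard_lt_ncard hlt hPfin
    omega
  have hclosed : ∀ z ∈ P, ∀ z' ∈ F, z' ≠ v → N.adj z z' → z' ∈ P :=
    fun z hz z' hz' hne ha => comp_closed hz ⟨hz', hne⟩ ha
  have hcv : ∀ z ∈ P, N.con (N.ind F) z v :=
    fun z hz => (hz.2.mono (ind_mono Set.sdiff_subset)).symm.trans hc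
  obtain ⟨y, hy, -, u, hu, hua⟩ := exists_adj_of_con (F := F) (U := {v}) (w := w)
    ⟨hw, hwv⟩ rfl hc
  obtain rfl : y = v := hy
  -- If `u` were the only neighbour of `y` in `P`, possibly by parallel edges, the components of `F
  -- \ {u}` inside `P` would be smaller than `P` and inert; then `P` would lie in the region of `u`
  -- and be inert.
  have hu2 : ∃ u' ∈ P, u' ≠ u ∧ N.adj y u' := by
    by_contra hno
    push Not at hno
    refine hni (h.inert_of_subset_reg (hPF hu) (fun z hz => ?_) fun z hz => con_comp_of_mem hu hz)
    have hzu : N.con (N.ind F) z u := (hcv z hz).trans (hcv u hu).symm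
    refine mem_reg_singleton (hPF hz) hzu fun hne => hmin u (hPF hu) z (hPF hz) hne hzu ?_
    have hsub : N.comp (F \ {u}) z ⊆ P \ {u} := by
      refine comp_subset_of_closed ⟨hz, hne⟩ ?_
      rintro x ⟨hx, hxu⟩ x' ⟨hx', hxu'⟩ ha
      refine ⟨hclosed x hx x' hx' ?_ ha, hxu'⟩
      rintro rfl
      exact hno x hx hxu ha.symm
    exact ⟨fun x hx => (hsub hx).1, fun hh => (hsub (hh hu)).2 rfl⟩
  obtain ⟨u', hu', hne, hua'⟩ := hu2
  obtain ⟨n, Q, ε, hr, hQ0, hQm⟩ := exists_isRing hne.symm hu' hvP hua.symm hua'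
    (con_comp_of_mem hu hu')
  subst hQ0
  obtain ⟨g, hg⟩ := exists_isGated h.goodF hPF hv hr hvP hQm fun z hz z' hz' =>
    con_comp_of_mem hz hz'
  have hpend : N.IsPendant S F P n Q ε g := ⟨hg, hPF, hv, hclosed, hcv, h⟩
  exact hni (hpend.inert fun j h1 h2 => hpend.fib_inert hmin h1 h2)

/-- The vertices of a list. -/
def vset (U : List V) : Set V := {z | z ∈ U}

/-- The list `U` is suitable for branching. -/
def Test (N : Net V β) (S F : Set V) (U : List V) : Prop :=
  ¬ N.Good (N.ind (S ∪ N.reg S F (vset U))) ∨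
  (∃ p, U = [p] ∧ ¬ (N.Att S (N.reg S F (vset U)) p).Subsingleton) ∨
  (∃ p q, U = [p, q] ∧ N.con (N.ind (N.reg S F (vset U))) p q ∧
    ∃ a ∈ N.Att S (N.reg S F (vset U)) p, ∃ b ∈ N.Att S (N.reg S F (vset U)) p,
      ¬ N.con (N.ind S) a b)

/-- If no list passes, the three alternatives of `Test` fail, which are the fields `triple`,
`single` and `pair` of `Stuck`; then `Stuck.good` applies. -/
theorem exists_test [Finite β] (hd : Disjoint S F) (hf : F.Finite) (hS : N.Good (N.ind S))
    (hF : N.Good (N.ind F)) (hn : ¬ N.Good (N.ind (S ∪ F))) :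
    ∃ U : List V, U ≠ [] ∧ U.length ≤ 3 ∧ (∀ u ∈ U, u ∈ F) ∧ N.Test S F U := by
  by_contra hno
  push Not at hno
  have h3 : ∀ p q r : V, vset [p, q, r] = {p, q, r} := fun p q r => by ext; simp [vset]
  have h2 : ∀ p q : V, vset [p, q] = {p, q} := fun p q => by ext; simp [vset]
  have h1 : ∀ p : V, vset [p] = {p} := fun p => by ext; simp [vset]
  refine hn (Stuck.good ⟨hd, hf, hS, hF, ?_, ?_, ?_⟩)
  · intro p hp q hq r hr
    by_contra hG
    refine hno [p, q, r] (by simp) (by simp) (by simp [hp, hq, hr]) (Or.inl ?_)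
    rwa [h3]
  · intro p hp q hq hc a ha b hb
    by_contra hG
    refine hno [p, q] (by simp) (by simp) (by simp [hp, hq]) (Or.inr (Or.inr ⟨p, q, rfl, ?_⟩))
    rw [h2]
    exact ⟨hc, a, ha, b, hb, hG⟩
  · intro p hp
    by_contra hG
    refine hno [p] (by simp) (by simp) (by simp [hp]) (Or.inr (Or.inl ⟨p, rfl, ?_⟩))
    rwa [h1]

end Net
end EvenCycle

/-! ### The branching measure. -/

namespace EvenCycle

/-- The number of classes of a relation that meet a set. -/
noncomputable def ncl {V : Type*} (r : V → V → Prop) (A : Set V) : ℕ :=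
  ((fun x => {y | r x y}) '' A).ncard

section

variable {V : Type*} {r r' : V → V → Prop} {A B A' U : Set V}

theorem class_eq_iff (hr : Equivalence r) {x y : V} : {z | r x z} = {z | r y z} ↔ r x y := by
  constructor
  · intro h
    have : y ∈ {z | r x z} := by rw [h]; exact hr.refl y
    exact this
  · intro h
    ext z
    exact ⟨fun h' => hr.trans (hr.symm h) h', fun h' => hr.trans h h'⟩

/-- Each class of the coarser relation meeting `A'` is the closure of a class of the finer one
meeting `A`. -/
theorem ncl_le (hr : Equivalence r) (hr' : Equivalence r') (hle : ∀ x y, r x y → r' x y)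
    (hA : A.Finite) (h : ∀ a' ∈ A', ∃ a ∈ A, r' a' a) : ncl r' A' ≤ ncl r A := by
  have hfin : ((fun x => {y | r x y}) '' A).Finite := hA.image _
  refine le_trans (Set.ncard_le_ncard (t := (fun c => {y | ∃ x ∈ c, r' x y}) ''
    ((fun x => {y | r x y}) '' A)) ?_ (hfin.image _)) (Set.ncard_image_le hfin)
  rintro _ ⟨a', ha', rfl⟩
  obtain ⟨a, ha, haa⟩ := h a' ha'
  refine ⟨_, ⟨a, ha, rfl⟩, ?_⟩
  ext y
  constructor
  · rintro ⟨x, hx, hxy⟩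
    exact hr'.trans haa (hr'.trans (hle _ _ hx) hxy)
  · intro hy
    exact ⟨a, hr.refl a, hr'.trans (hr'.symm haa) hy⟩

/-- The class of `y` can be dropped from the count, since `x` represents it in the coarser relation.
-/
theorem ncl_lt (hr : Equivalence r) (hr' : Equivalence r') (hle : ∀ x y, r x y → r' x y)
    (hA : A.Finite) (h : ∀ a' ∈ A', ∃ a ∈ A, r' a' a) {x y : V} (hx : x ∈ A) (hy : y ∈ A)
    (hxy : r' x y) (hn : ¬ r x y) : ncl r' A' < ncl r A := by
  refine lt_of_le_of_lt (ncl_le (A := {a | a ∈ A ∧ ¬ r a y}) hr hr' hle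
    (hA.subset fun a h => h.1) fun a' ha' => ?_) ?_
  · obtain ⟨a, ha, haa⟩ := h a' ha'
    by_cases hay : r a y
    · exact ⟨x, ⟨hx, hn⟩, hr'.trans haa (hr'.trans (hle _ _ hay) (hr'.symm hxy))⟩
    · exact ⟨a, ⟨ha, hay⟩, haa⟩
  · refine Set.ncard_lt_ncard ⟨Set.image_mono fun a h => h.1, fun hsub => ?_⟩ (hA.image _)
    obtain ⟨a, ⟨_, ha'⟩, he⟩ := hsub ⟨y, hy, rfl⟩
    exact ha' ((class_eq_iff hr).1 he)

theorem ncl_union_le (hU : U.Finite) :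
    ncl r (A ∪ U) ≤ ncl r A + U.ncard := by
  rw [ncl, Set.image_union]
  exact (Set.ncard_union_le _ _).trans (Nat.add_le_add_left (Set.ncard_image_le hU) _)

theorem ncl_le_ncard (hA : A.Finite) : ncl r A ≤ A.ncard := Set.ncard_image_le hA

end

namespace Net

variable {V β : Type*} (N : Net V β)

/-- No single edge of `E` separates `x` from `y` in `E`. -/
def tcon (E : Set β) (x y : V) : Prop := ∀ f, N.con (E \ {f}) x y

/-- The vertices of `S` adjacent to `F`. -/
def bdry (S F : Set V) : Set V := {s | s ∈ S ∧ ∃ z ∈ F, N.adj s z}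

/-- The part of the branching measure that depends on the kept vertices. -/
noncomputable def mu (S F : Set V) : ℝ :=
  -- The bases are fixed by two tight cases of `mu_keep`. One vertex and one boundary class lost: `1
  -- + 6 * (5/6) = 6`. Two vertices, one component lost and two boundary classes gained: `2 + 6 *
  -- (6/5)^2 / (54/25) = 6`.
  (54 / 25) ^ ncl (N.con (N.ind S)) S * (6 / 5) ^ ncl (N.tcon (N.ind S)) (N.bdry S F)

variable {N} {S F R U : Set V} {E E' : Set β} {p q a b x y z u : V}

theorem con_equivalence : Equivalence (N.con E) := ⟨con_refl, con.symm, con.trans⟩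

theorem tcon_equivalence : Equivalence (N.tcon E) :=
  ⟨fun x _ => con_refl x, fun h f => (h f).symm, fun h h' f => (h f).trans (h' f)⟩

theorem one_le_mu : 1 ≤ N.mu S F :=
  one_le_mul_of_one_le_of_one_le (one_le_pow₀ (by norm_num)) (one_le_pow₀ (by norm_num))

theorem bdry_subset : N.bdry S F ⊆ S := fun _ h => h.1

theorem mu_delete (hS : S.Finite) : N.mu S (F \ {u}) ≤ N.mu S F := by
  refine mul_le_mul_of_nonneg_left (pow_le_pow_right₀ (by norm_num) ?_) (by positivity)
  refine ncl_le tcon_equivalence tcon_equivalence (fun _ _ h => h) (hS.subset bdry_subset) ?_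
  rintro s ⟨hs, z, hz, ha⟩
  exact ⟨s, ⟨hs, z, hz.1, ha⟩, tcon_equivalence.refl _⟩

theorem mu_initial {k : ℕ} (hS : S.Finite) (hk : S.ncard ≤ k + 1) :
    6 ^ k * N.mu S F ≤ 3 * 16.64 ^ k := by
  have h1 : ncl (N.con (N.ind S)) S ≤ k + 1 := (ncl_le_ncard hS).trans hk
  have h2 : ncl (N.tcon (N.ind S)) (N.bdry S F) ≤ k + 1 :=
    (ncl_le_ncard (hS.subset bdry_subset)).trans ((Set.ncard_le_ncard bdry_subset hS).trans hk)
  have h3 : N.mu S F ≤ (54 / 25) ^ (k + 1) * (6 / 5) ^ (k + 1) :=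
    mul_le_mul (pow_le_pow_right₀ (by norm_num) h1) (pow_le_pow_right₀ (by norm_num) h2)
      (by positivity) (by positivity)
  calc (6 : ℝ) ^ k * N.mu S F ≤ 6 ^ k * ((54 / 25) ^ (k + 1) * (6 / 5) ^ (k + 1)) := by gcongr
    -- The extra factor from `k + 1` is `2.592 ≤ 3`, and the base is `15.552 ≤ 16.64`.
    _ = (54 / 25 * (6 / 5)) * (6 * (54 / 25) * (6 / 5)) ^ k := by
      rw [mul_pow, mul_pow]; ring
    _ ≤ 3 * 16.64 ^ k := by
      refine mul_le_mul (by norm_num) (pow_le_pow_left₀ (by norm_num) (by norm_num) k)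
        (by positivity) (by norm_num)

/-- By `reg_closed`, a vertex of the region outside `U` has no neighbour in the remaining part of
`F`. -/
theorem bdry_keep (hU : U ⊆ F) :
    N.bdry (S ∪ N.reg S F U) (F \ N.reg S F U) ⊆ N.bdry S F ∪ U := by
  rintro s ⟨hs | hs, z, hz, ha⟩
  · exact Or.inl ⟨hs, z, hz.1, ha⟩
  · by_contra h
    exact hz.2 (reg_closed hU hs (fun h' => h (Or.inr h')) hz.1 ha)

/-- A vertex attached to `p` through the region of `p` is attached through a single component. -/
theorem exists_link (hd : Disjoint S F) (hp : p ∈ F)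
    (ha : a ∈ N.Att S (N.reg S F {p}) p) : ∃ w, N.comp (F \ {p}) w ⊆ N.reg S F {p} ∧
      N.tch S (N.comp (F \ {p}) w) ⊆ {a} ∧ (w = p ∨ a ∈ N.tch S (N.comp (F \ {p}) w)) ∧
      N.con (N.ind ({p, a} ∪ N.comp (F \ {p}) w)) p a ∧ ∃ z ∈ F, N.adj a z := by
  have hpF : ({p} : Set V) ⊆ F := by simpa using hp
  have haF : a ∉ F := fun h => Set.disjoint_left.1 hd ha.1 h
  obtain ⟨w, hw, hwa⟩ : ∃ w ∈ N.reg S F {p}, N.adj w a := by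
    by_contra hno
    push Not at hno
    refine haF (reg_subset (ha.2.mem_of_closed (B := N.reg S F {p}) (subset_reg hpF rfl) ?_))
    rintro z hz z' (rfl | hz') hzz
    · exact absurd hzz (hno z hz)
    · exact hz'
  -- Here `w = p` encodes direct adjacency of `p` and `a`, the component then being empty.
  by_cases hwp : w = p
  · subst hwp
    have he : N.comp (F \ {w}) w = ∅ := comp_of_notMem fun h => h.2 rfl
    refine ⟨w, by simp [he], ?_, Or.inl rfl, ?_, w, hp, hwa.symm⟩
    · rw [he]
      rintro z ⟨-, p, hp, -⟩
      exact hp.elim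
    · exact hwa.con (by simp) (by simp)
  · obtain ⟨y, hyp, ⟨_, _, p', hp', hpa⟩, hs, -⟩ := hw.2.resolve_left hwp
    obtain rfl : y = p := hyp
    have hwc : w ∈ N.comp (F \ {y}) w := mem_comp_self ⟨hw.1, hwp⟩
    have hnb : ∀ z ∈ N.tch S (N.comp (F \ {y}) w), z ∈ N.nb (S ∪ F) (N.comp (F \ {y}) w) \ {y} := by
      rintro z ⟨hzS, q, hq, hqa⟩
      refine ⟨⟨Or.inl hzS, fun h => Set.disjoint_left.1 hd hzS h.1.1, q, hq, hqa⟩, ?_⟩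
      rintro rfl
      exact Set.disjoint_left.1 hd hzS hp
    have haT : a ∈ N.tch S (N.comp (F \ {y}) w) := ⟨ha.1, w, hwc, hwa⟩
    refine ⟨w, comp_subset_reg hw, fun z hz => hs (hnb z hz) (hnb a haT), Or.inr haT, ?_, w, hw.1,
      hwa.symm⟩
    refine (hpa.symm.con (A := {y, a} ∪ N.comp (F \ {y}) w) (by simp) (Or.inr hp')).trans ?_
    exact ((con_comp_of_mem hp' hwc).mono (ind_mono Set.subset_union_right)).trans
      (hwa.con (Or.inr hwc) (by simp))

/-- The links from `p` to `a` and to `b` share no edge, and with a walk from `a` to `b` in `S` they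
close up, so no single edge separates any two of `p`, `a`, `b` any more. Before, `a` and `b` were in
different classes; otherwise the new connection would be a third one. Thus one class is lost and `p`
adds none. -/
theorem keep_single [Finite β] (hd : Disjoint S F) (hS : S.Finite) (hp : p ∈ F)
    (hG : N.Good (N.ind (S ∪ N.reg S F {p})))
    (ha : a ∈ N.Att S (N.reg S F {p}) p) (hb : b ∈ N.Att S (N.reg S F {p}) p) (hab : a ≠ b)
    (hc : N.con (N.ind S) a b) :
    ncl (N.tcon (N.ind (S ∪ N.reg S F {p})))
      (N.bdry (S ∪ N.reg S F {p}) (F \ N.reg S F {p})) <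
    ncl (N.tcon (N.ind S)) (N.bdry S F) := by
  have hpF : ({p} : Set V) ⊆ F := by simpa using hp
  set R := N.reg S F {p} with hR
  have hRF : R ⊆ F := reg_subset
  have hpR : p ∈ R := subset_reg hpF rfl
  obtain ⟨w₁, hsub₁, ht₁, hw₁, hcon₁, hz₁⟩ := exists_link hd hp ha
  obtain ⟨w₂, hsub₂, ht₂, hw₂, hcon₂, hz₂⟩ := exists_link hd hp hb
  have hSF : ∀ z ∈ S, z ∉ F := fun z hz => Set.disjoint_left.1 hd hz
  have hle : ∀ x y, N.tcon (N.ind S) x y → N.tcon (N.ind (S ∪ R)) x y := fun x y h f =>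
    (h f).mono (Set.sdiff_subset_sdiff_left (ind_mono Set.subset_union_left))
  have hins : ∀ c ∈ S, ∀ e ∈ N.ind (insert c R), e ∉ N.ind S := by
    intro c hc e he he'
    refine ind_disjoint (x := c) ?_ he he'
    rintro z ⟨rfl | hz, hz'⟩
    · rfl
    · exact absurd (hRF hz) (hSF z hz')
  have hinsub : ∀ c ∈ S, N.ind (insert c R) ⊆ N.ind (S ∪ R) := by
    intro c hc
    refine ind_mono ?_
    rintro z (rfl | hz)
    · exact Or.inl hc
    · exact Or.inr hz
  have hcR : N.con (N.ind (S ∪ R) \ N.ind S) a b := by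
    have h1 : ∀ c ∈ S, N.ind (insert c R) ⊆ N.ind (S ∪ R) \ N.ind S := fun c hc e he =>
      ⟨hinsub c hc he, hins c hc e he⟩
    exact (ha.2.mono (h1 a ha.1)).symm.trans (hb.2.mono (h1 b hb.1))
  have htab : N.tcon (N.ind (S ∪ R)) a b := by
    intro f
    by_cases hf : f ∈ N.ind S
    · refine hcR.mono ?_
      rintro e ⟨he, he'⟩
      exact ⟨he, fun h => he' (h ▸ hf)⟩
    · refine hc.mono fun e he => ⟨ind_mono Set.subset_union_left he, fun h => hf (h ▸ he)⟩
  have hntab : ¬ N.tcon (N.ind S) a b := by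
    intro h
    refine hG.not_triply_joined (E₀ := ∅) (E₁ := N.ind (S ∪ R) \ N.ind S) (by simp)
      Set.sdiff_subset (by simp) (by simpa using hcR) (fun h0 => hab (con_empty h0)) fun f _ => ?_
    refine (h f).mono ?_
    rintro e ⟨he, hef⟩
    exact ⟨⟨ind_mono Set.subset_union_left he, fun h => h.2 he⟩, hef⟩
  -- The two links run through different components, since each component touches only its own
  -- vertex of `S`.
  have hdisj : ({p, a} ∪ N.comp (F \ {p}) w₁) ∩ ({p, b} ∪ N.comp (F \ {p}) w₂) ⊆ {p} := by
    have hpc : ∀ w, p ∉ N.comp (F \ {p}) w := fun w h => h.1.2 rfl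
    rintro z ⟨(rfl | rfl) | hz, (hz' | hz') | hz'⟩
    · rfl
    · rfl
    · rfl
    · exact hz'
    · exact absurd hz' hab
    · exact absurd hz'.1.1 (hSF z ha.1)
    · exact hz'
    · rw [Set.mem_singleton_iff] at hz'
      rw [hz'] at hz
      exact absurd hz.1.1 (hSF _ hb.1)
    · exfalso
      have he : N.comp (F \ {p}) w₁ = N.comp (F \ {p}) w₂ := (comp_eq hz).symm.trans (comp_eq hz')
      rcases hw₂ with rfl | hw₂
      · rw [comp_of_notMem fun h => h.2 rfl] at hz'
        exact hz'
      · rw [← he] at hw₂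
        exact hab (ht₁ hw₂).symm
  have hup : ∀ w c, c ∈ S → N.comp (F \ {p}) w ⊆ R →
      N.ind ({p, c} ∪ N.comp (F \ {p}) w) ⊆ N.ind (S ∪ R) := by
    intro w c hc hw
    refine ind_mono ?_
    rintro z ((rfl | rfl) | hz)
    · exact Or.inr hpR
    · exact Or.inl hc
    · exact Or.inr (hw hz)
  have htp : N.tcon (N.ind (S ∪ R)) p a := by
    intro f
    by_cases hf : f ∈ N.ind ({p, a} ∪ N.comp (F \ {p}) w₁)
    · refine con.trans ?_ (htab f).symm
      refine hcon₂.mono fun e he => ⟨hup w₂ b hb.1 hsub₂ he, fun h => ?_⟩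
      rw [Set.mem_singleton_iff] at h
      subst h
      exact ind_disjoint hdisj hf he
    · exact hcon₁.mono fun e he => ⟨hup w₁ a ha.1 hsub₁ he, fun h => hf (h ▸ he)⟩
  refine ncl_lt tcon_equivalence tcon_equivalence hle (hS.subset bdry_subset) ?_
    (x := a) (y := b) ⟨ha.1, hz₁⟩ ⟨hb.1, hz₂⟩ htab hntab
  intro m hm
  rcases bdry_keep hpF hm with h | h
  · exact ⟨m, h, tcon_equivalence.refl _⟩
  · obtain rfl : m = p := h
    exact ⟨a, ⟨ha.1, hz₁⟩, htp⟩

theorem keep_bdry (hS : S.Finite) (hU : U ⊆ F) (hUf : U.Finite) :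
    ncl (N.tcon (N.ind (S ∪ N.reg S F U))) (N.bdry (S ∪ N.reg S F U) (F \ N.reg S F U)) ≤
      ncl (N.tcon (N.ind S)) (N.bdry S F) + U.ncard := by
  have hb : (N.bdry S F).Finite := hS.subset bdry_subset
  refine le_trans (Set.ncard_le_ncard (Set.image_mono (bdry_keep hU)) ((hb.union hUf).image _))
    ((ncl_union_le hUf).trans (Nat.add_le_add_right ?_ _))
  exact ncl_le tcon_equivalence tcon_equivalence
    (fun x y h f => (h f).mono (Set.sdiff_subset_sdiff_left (ind_mono Set.subset_union_left))) hb
    fun a ha => ⟨a, ha, tcon_equivalence.refl _⟩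

theorem con_of_att (ha : a ∈ N.Att S R p) : N.con (N.ind (S ∪ R)) p a := by
  refine ha.2.mono (ind_mono ?_)
  rintro z (rfl | hz)
  · exact Or.inl ha.1
  · exact Or.inr hz

/-- The branching inequality. -/
theorem mu_keep [Finite β] {U : List V} (hd : Disjoint S F) (hS : S.Finite)
    (hU : ∀ u ∈ U, u ∈ F) (ht : N.Test S F U)
    (hG : N.Good (N.ind (S ∪ N.reg S F (vset U)))) :
    U.length * N.mu S F + 6 * N.mu (S ∪ N.reg S F (vset U)) (F \ N.reg S F (vset U)) ≤
      6 * N.mu S F := by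
  have hUF : vset U ⊆ F := hU
  set R := N.reg S F (vset U) with hR
  have hle : ∀ x y, N.con (N.ind S) x y → N.con (N.ind (S ∪ R)) x y :=
    fun x y h => h.mono (ind_mono Set.subset_union_left)
  have hUc : ∀ (T : List V), (vset T).Finite ∧ (vset T).ncard ≤ T.length := by
    classical
    intro T
    have : vset T = (T.toFinset : Set V) := by ext; simp [vset]
    rw [this, Set.ncard_coe_finset]
    exact ⟨Finset.finite_toSet _, List.toFinset_card_le T⟩
  have hbd := keep_bdry (N := N) hS hUF (hUc U).1
  have hbd' := hbd.trans (Nat.add_le_add_left (hUc U).2 _)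
  clear hbd
  rcases ht with ht | ⟨p, rfl, ht⟩ | ⟨p, q, rfl, hpq, a, ha, b, hb, hab⟩
  · exact absurd hG ht
  · have hv : vset [p] = {p} := by ext; simp [vset]
    have hp : p ∈ F := hU p (by simp)
    rw [Set.not_subsingleton_iff] at ht
    obtain ⟨a, ha, b, hb, hab⟩ := ht
    -- Everything in the region is connected to `p` and hence to `a`, so keeping it creates no new
    -- component.
    have hcov : ∀ a' ∈ S ∪ R, ∃ c ∈ S, N.con (N.ind (S ∪ R)) a' c := by
      rintro a' (h | h)
      · exact ⟨a', h, con_refl _⟩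
      · obtain ⟨u, hu, hc⟩ := exists_con_of_mem_reg hUF h
        rw [hv, Set.mem_singleton_iff] at hu
        subst hu
        exact ⟨a, ha.1, (hc.mono (ind_mono Set.subset_union_right)).trans (con_of_att ha)⟩
    -- Inside one component the measure drops by the factor `5/6`. Otherwise a component is lost and
    -- at most one boundary class gained, a factor of at most `5/9`.
    by_cases hc : N.con (N.ind S) a b
    · have h1 := ncl_le con_equivalence con_equivalence hle hS hcov
      have h2 : ncl (N.tcon (N.ind (S ∪ R))) (N.bdry (S ∪ R) (F \ R)) <
          ncl (N.tcon (N.ind S)) (N.bdry S F) := by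
        have hG' : N.Good (N.ind (S ∪ N.reg S F {p})) := by rw [← hv]; exact hG
        rw [hv] at ha hb
        have := keep_single hd hS hp hG' ha hb hab hc
        rw [← hv] at this
        exact this
      have h3 : N.mu (S ∪ R) (F \ R) * (6 / 5) ≤ N.mu S F := by
        rw [mu, mu, mul_assoc, ← pow_succ]
        exact mul_le_mul (pow_le_pow_right₀ (by norm_num) h1)
          (pow_le_pow_right₀ (by norm_num) h2) (by positivity) (by positivity)
      simp only [List.length_singleton, Nat.cast_one]
      linarith
    · have h1 := ncl_lt con_equivalence con_equivalence hle hS hcov ha.1 hb.1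
        ((con_of_att ha).symm.trans (con_of_att hb)) hc
      have h3 : N.mu (S ∪ R) (F \ R) * (54 / 25) ≤ N.mu S F * (6 / 5) := by
        rw [mu, mu, mul_right_comm, ← pow_succ, mul_assoc ((54 / 25 : ℝ) ^ _), ← pow_succ]
        exact mul_le_mul (pow_le_pow_right₀ (by norm_num) h1)
          (pow_le_pow_right₀ (by norm_num) hbd') (by positivity) (by positivity)
      have := one_le_mu (N := N) (S := S) (F := F)
      simp only [List.length_singleton, Nat.cast_one]
      linarith
  · have hcov : ∀ a' ∈ S ∪ R, ∃ c ∈ S, N.con (N.ind (S ∪ R)) a' c := by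
      rintro a' (h | h)
      · exact ⟨a', h, con_refl _⟩
      · obtain ⟨u, hu, hc⟩ := exists_con_of_mem_reg hUF h
        have hcu : N.con (N.ind R) p u := by
          have : u = p ∨ u = q := by simpa [vset] using hu
          rcases this with rfl | rfl
          · exact con_refl _
          · exact hpq
        exact ⟨a, ha.1, ((hc.trans hcu.symm).mono (ind_mono Set.subset_union_right)).trans
          (con_of_att ha)⟩
    -- One component is lost and at most two boundary classes are gained: a factor of at most `2/3`.
    have h1 := ncl_lt con_equivalence con_equivalence hle hS hcov ha.1 hb.1
      ((con_of_att ha).symm.trans (con_of_att hb)) hab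
    have h3 : N.mu (S ∪ R) (F \ R) * (54 / 25) ≤ N.mu S F * (6 / 5) ^ 2 := by
      rw [mu, mu, mul_right_comm, ← pow_succ, mul_assoc ((54 / 25 : ℝ) ^ _), ← pow_add]
      exact mul_le_mul (pow_le_pow_right₀ (by norm_num) h1)
        (pow_le_pow_right₀ (by norm_num) hbd') (by positivity) (by positivity)
    simp only [List.length_cons, List.length_nil]
    norm_num
    linarith

end Net
end EvenCycle

/-! ### The edge condition characterizes forests of odd cacti. -/

namespace EvenCycle

open Net

variable {α β : Type*} {G : Graph α β} {N : Net α β} {E : Set β}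

section

variable {n : ℕ} {v : Fin (n + 1) → α} {c : Fin (n + 1) → β} {i j : Fin (n + 1)}

/-- Induction on the cyclic distance from `i + 1`: walking round the cycle, `i` is reached last and
`c i` is never used. -/
theorem cyclic_con (hinj : Function.Injective c) (hj : ∀ i, N.Joins (c i) (v i) (v (i + 1))) :
    N.con (Set.range c \ {c i}) (N.ends (c i)).1 (N.ends (c i)).2 := by
  have key : ∀ s : ℕ, ∀ l : Fin (n + 1), (l - (i + 1)).val = s →
      N.con (Set.range c \ {c i}) (v (i + 1)) (v l) := by
    intro s
    induction s with
    | zero =>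
      intro l hl
      have : l - (i + 1) = 0 := Fin.ext hl
      rw [sub_eq_zero.1 this]
      exact con_refl _
    | succ s ih =>
      intro l hl
      have hx : l - (i + 1) = (l - 1 - (i + 1)) + 1 := by abel
      rw [hx, Fin.val_add_one] at hl
      split_ifs at hl with h
      refine (ih (l - 1) (by omega)).trans ?_
      have hne : l - 1 ≠ i := by
        rintro rfl
        rw [sub_add_cancel, sub_sub_cancel_left] at h hl
        have h1 : (-1 : Fin (n + 1)) + 1 = 0 := by simp
        have h2 := Fin.val_add_one (-1 : Fin (n + 1))
        rw [if_neg h, h1] at h2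
        simp at h2
      have := (hj (l - 1)).con (E := Set.range c \ {c i}) ⟨⟨_, rfl⟩, fun h => hne (hinj h)⟩
      rwa [sub_add_cancel] at this
  have h1 := key _ i rfl
  rcases (hj i).eq_or_eq (joins_ends (c i)) with ⟨h3, h4⟩ | ⟨h3, h4⟩
  · rw [← h3, ← h4]; exact h1.symm
  · rw [← h3, ← h4]; exact h1

/-- The vertices at cyclic distance `1` to `j - i` after `i` form an arc whose only boundary edges
are `c i` and `c j`. Membership in it is invariant along the remaining edges but differs at the ends
of `c i`. -/
theorem cyclic_not_con (vinj : Function.Injective v) (hn : 1 ≤ n)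
    (hG : ∀ i, N.Joins (c i) (v i) (v (i + 1))) (hij : j ≠ i) :
    ¬ N.con (Set.range c \ {c i, c j}) (N.ends (c i)).1 (N.ends (c i)).2 := by
  have hji : (j - i).val ≠ 0 := fun h => hij (sub_eq_zero.1 (Fin.ext h))
  intro hc
  let p : α → Prop := fun z => ∃ l, v l = z ∧ 1 ≤ (l - i).val ∧ (l - i).val ≤ (j - i).val
  have hp : ∀ l, p (v l) ↔ 1 ≤ (l - i).val ∧ (l - i).val ≤ (j - i).val := by
    intro l
    constructor
    · rintro ⟨l', h, h'⟩
      rw [vinj h] at h'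
      exact h'
    · exact fun h => ⟨l, rfl, h⟩
  have hj' := (j - i).isLt
  have hstep : ∀ l : Fin (n + 1), (l + 1 - i).val =
      if l - i = Fin.last n then 0 else (l - i).val + 1 := by
    intro l
    rw [← Fin.val_add_one]
    congr 1
    abel
  have hiff : p (N.ends (c i)).1 ↔ p (N.ends (c i)).2 := by
    refine hc.iff_of p ?_
    rintro _ ⟨⟨l, rfl⟩, hl⟩
    have hli : l ≠ i := fun h => hl (by simp [h])
    have hlj : l ≠ j := fun h => hl (by simp [h])
    have h0 : (l - i).val ≠ 0 := fun h => hli (sub_eq_zero.1 (Fin.ext h))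
    have h1 : (l - i).val ≠ (j - i).val := fun h => hlj (sub_left_injective (Fin.ext h))
    have hl' := (l - i).isLt
    have : p (v l) ↔ p (v (l + 1)) := by
      rw [hp, hp, hstep]
      by_cases h : l - i = Fin.last n
      · rw [if_pos h]
        rw [Fin.ext_iff, Fin.val_last] at h
        omega
      · rw [if_neg h]
        omega
    rcases (hG l).eq_or_eq (joins_ends (c l)) with ⟨h3, h4⟩ | ⟨h3, h4⟩
    · rw [← h3, ← h4]; exact this
    · rw [← h3, ← h4]; exact this.symm
  have hni : ¬ p (v i) := by
    rw [hp, sub_self]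
    simp
  have hpi : p (v (i + 1)) := by
    rw [hp, hstep, sub_self]
    have : (0 : Fin (n + 1)) ≠ Fin.last n := by
      intro h
      have := congrArg Fin.val h
      simp at this
      omega
    rw [if_neg this, Fin.val_zero]
    exact ⟨le_rfl, Nat.one_le_iff_ne_zero.2 hji⟩
  rcases (hG i).eq_or_eq (joins_ends (c i)) with ⟨h3, h4⟩ | ⟨h3, h4⟩
  · rw [← h3, ← h4] at hiff
    exact hni (hiff.2 hpi)
  · rw [← h3, ← h4] at hiff
    exact hni (hiff.1 hpi)

end

theorem GraphCycle.con_diff (hG : ∀ e x y, G.IsLink e x y → N.Joins e x y) (C : GraphCycle G)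
    {e : β} (he : e ∈ C.edges) : N.con (C.edges \ {e}) (N.ends e).1 (N.ends e).2 := by
  obtain ⟨len, two, v, c, v_inj, c_inj, link⟩ := C
  obtain ⟨n, rfl⟩ : ∃ n, len = n + 1 := ⟨len - 1, by omega⟩
  obtain ⟨i, rfl⟩ := he
  exact cyclic_con c_inj fun i => by simpa only [finRotate_apply] using hG _ _ _ (link i)

theorem GraphCycle.not_con_diff (hG : ∀ e x y, G.IsLink e x y → N.Joins e x y) (C : GraphCycle G)
    {e f : β} (he : e ∈ C.edges) (hf : f ∈ C.edges) (hef : f ≠ e) :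
    ¬ N.con (C.edges \ {e, f}) (N.ends e).1 (N.ends e).2 := by
  obtain ⟨len, two, v, c, v_inj, c_inj, link⟩ := C
  obtain ⟨n, rfl⟩ : ∃ n, len = n + 1 := ⟨len - 1, by omega⟩
  obtain ⟨i, rfl⟩ := he
  obtain ⟨j, rfl⟩ := hf
  exact cyclic_not_con v_inj (by omega)
    (fun i => by simpa only [finRotate_apply] using hG _ _ _ (link i)) fun h => hef (by rw [h])

theorem GraphCycle.weight_eq [Finite β] (C : GraphCycle G) (w : β → Fin 2)
    (hw : ∀ e, N.wt e = (w e : ℕ)) {e : β} (h : C.edges = insert e (N.bri E e)) :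
    C.weight w = N.wt e + ∑ᶠ f ∈ N.bri E e, N.wt f := by
  rw [← finsum_mem_insert _ (fun h => h.2.1 rfl) (Set.toFinite _), ← h, GraphCycle.edges,
    finsum_mem_range C.e_inj, finsum_eq_sum_of_fintype, GraphCycle.weight]
  simp [hw]

theorem exists_path [hβ : Nonempty β] {D : Set β} {x y : α} (h : N.con D x y) :
    ∃ (t : ℕ) (q : ℕ → α) (ε : ℕ → β),
    q 0 = x ∧ q t = y ∧ (∀ i j, i ≤ t → j ≤ t → q i = q j → i = j) ∧
    ∀ i < t, ε i ∈ D ∧ N.Joins (ε i) (q i) (q (i + 1)) := by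
  classical
  let H : SimpleGraph α :=
    { Adj := fun x y => ∃ e ∈ D, N.Joins e x y
      symm := ⟨fun x y ⟨e, he, h⟩ => ⟨e, he, h.symm⟩⟩
      loopless := ⟨fun x ⟨e, _, h⟩ => h.ne rfl⟩ }
  have hr : H.Reachable x y := by
    refine (h.iff_of (fun z => H.Reachable x z) fun e he => ?_).1 (.refl _)
    have : H.Adj (N.ends e).1 (N.ends e).2 := ⟨e, he, joins_ends e⟩
    exact ⟨fun h => h.trans this.reachable, fun h => h.trans this.symm.reachable⟩
  obtain ⟨p, hp⟩ := hr.exists_isPath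
  have : ∀ i, ∃ e, i < p.length → e ∈ D ∧ N.Joins e (p.getVert i) (p.getVert (i + 1)) := by
    intro i
    by_cases hi : i < p.length
    · obtain ⟨e, he, hj⟩ := p.adj_getVert_succ hi
      exact ⟨e, fun _ => ⟨he, hj⟩⟩
    · exact ⟨hβ.some, fun h => absurd h hi⟩
  choose ε hε using this
  exact ⟨p.length, p.getVert, ε, by simp, by simp,
    fun i j hi hj hij => hp.getVert_injOn (by simpa using hi) (by simpa using hj) hij, hε⟩

/-- An edge and a walk joining its ends and avoiding it contain a cycle through the edge. -/
theorem exists_cycle (hG : ∀ e ∈ E, ∀ x y, N.Joins e x y → G.IsLink e x y) {D : Set β} {e : β}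
    (he : e ∈ E) (hD : D ⊆ E \ {e}) (h : N.con D (N.ends e).1 (N.ends e).2) :
    ∃ C : GraphCycle G, e ∈ C.edges ∧ C.edges ⊆ insert e D := by
  have : Nonempty β := ⟨e⟩
  obtain ⟨t, q, ε, h0, ht, hinj, hε⟩ := exists_path h
  have ht0 : t ≠ 0 := by
    rintro rfl
    exact N.ne e (h0.symm.trans ht)
  have hcl : N.Joins e (q t) (q 0) := by rw [h0, ht]; exact (joins_ends e).symm
  have hεinj : ∀ i j, i < j → j < t → ε i ≠ ε j := by
    intro i j hij hj he'
    have h1 := (hε i (by omega)).2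
    rw [he'] at h1
    rcases h1.eq_or_eq (hε j hj).2 with ⟨h2, -⟩ | ⟨h2, -⟩
    · have := hinj _ _ (by omega) (by omega) h2
      omega
    · have := hinj _ _ (by omega) (by omega) h2
      omega
  -- The edge `e` closes the path from `q t` back to `q 0` and gets the last index. The case `t = 1`
  -- is a pair of parallel edges.
  refine ⟨⟨t + 1, by omega, fun i => q i, fun i => if (i : ℕ) < t then ε i else e, ?_, ?_, ?_⟩,
    ⟨Fin.last t, by simp⟩, ?_⟩
  · intro i j hij
    exact Fin.ext (hinj _ _ (by omega) (by omega) hij)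
  · intro i j hij
    simp only at hij
    have hi := i.isLt
    have hj := j.isLt
    split_ifs at hij with h1 h2 h2
    · rcases lt_trichotomy (i : ℕ) j with h | h | h
      · exact absurd hij (hεinj _ _ h h2)
      · exact Fin.ext h
      · exact absurd hij.symm (hεinj _ _ h h1)
    · exact absurd hij (hD (hε _ h1).1).2
    · exact absurd hij.symm (hD (hε _ h2).1).2
    · exact Fin.ext (by omega)
  · intro i
    by_cases hi : (i : ℕ) < t
    · rw [if_pos hi, finRotate_apply, Fin.val_add_one,
        if_neg (fun h => by rw [h] at hi; simp at hi)]
      exact hG _ (hD (hε _ hi).1).1 _ _ (hε _ hi).2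
    · have : i = Fin.last t := Fin.ext (by simp; omega)
      subst this
      rw [if_neg hi, finRotate_last]
      exact hG _ he _ _ hcl
  · rintro _ ⟨i, rfl⟩
    simp only
    split_ifs with hi
    · exact Or.inr (hε _ hi).1
    · exact Or.inl rfl

theorem con_inter_comp {A : Set α} {D : Set β} {x z : α} (hD : D ⊆ N.ind A)
    (h : N.con D x z) : N.con (D ∩ N.ind (N.comp A x)) x z := by
  refine (h.iff_of (fun z => N.con (D ∩ N.ind (N.comp A x)) x z) fun f hf => ?_).1 (con_refl _)
  have key : ∀ y y', N.Joins f y y' → N.con (D ∩ N.ind (N.comp A x)) x y →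
      N.con (D ∩ N.ind (N.comp A x)) x y' := by
    intro y y' hj hy
    have hA := hj.mem_ind.1 (hD hf)
    have hyc : y ∈ N.comp A x := ⟨hA.1, hy.mono fun g hg => hD hg.1⟩
    have hfc : f ∈ D ∩ N.ind (N.comp A x) :=
      ⟨hf, hj.mem_ind.2 ⟨hyc, comp_closed hyc hA.2 ⟨f, hj⟩⟩⟩
    exact hy.trans (hj.con hfc)
  exact ⟨key _ _ (joins_ends f), key _ _ (joins_ends f).symm⟩

namespace Inst

variable (I : Inst)

/-- The network of an instance. -/
def net : Net (Fin I.n) (Fin I.m) := ⟨I.ends, fun e => (I.weight e : ℕ), I.loopless⟩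

variable {I} {X : Set (Fin I.n)} {x y z : Fin I.n} {e : Fin I.m}

theorem deleteVerts_isLink : (I.graph.deleteVerts X).IsLink e x y ↔
    I.net.Joins e x y ∧ x ∉ X ∧ y ∉ X := by
  rw [Graph.deleteVerts_isLink]
  rfl

theorem deleteVerts_adj : (I.graph.deleteVerts X).Adj x y ↔ I.net.adj x y ∧ x ∉ X ∧ y ∉ X := by
  constructor
  · rintro ⟨e, he⟩
    rw [deleteVerts_isLink] at he
    exact ⟨⟨e, he.1⟩, he.2⟩
  · rintro ⟨⟨e, he⟩, h⟩
    exact ⟨e, deleteVerts_isLink.2 ⟨he, h⟩⟩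

theorem mem_deleteVerts : x ∈ V(I.graph.deleteVerts X) ↔ x ∉ X := by
  simp [Inst.graph]

theorem reach_iff :
    (y ∈ V(I.graph.deleteVerts X) ∧ Relation.ReflTransGen (I.graph.deleteVerts X).Adj x y) ↔
    y ∈ I.net.comp Xᶜ x := by
  rw [mem_deleteVerts]
  refine and_congr_right fun hy => ⟨fun h => ?_, fun h => ?_⟩
  · clear hy
    induction h with
    | refl => exact con_refl _
    | tail _ h ih =>
      rw [deleteVerts_adj] at h
      exact ih.trans (h.1.con h.2.1 h.2.2)
  · refine (h.iff_of (fun z => Relation.ReflTransGen (I.graph.deleteVerts X).Adj x z)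
      fun e he => ?_).1 .refl
    have : (I.graph.deleteVerts X).Adj (I.net.ends e).1 (I.net.ends e).2 :=
      deleteVerts_adj.2 ⟨⟨e, joins_ends e⟩, he.1, he.2⟩
    exact ⟨fun h => h.tail this, fun h => h.tail this.symm⟩

theorem component_isLink : (component (I.graph.deleteVerts X) x).IsLink e y z ↔
    I.net.Joins e y z ∧ y ∈ I.net.comp Xᶜ x ∧ z ∈ I.net.comp Xᶜ x := by
  rw [component, Graph.induce_isLink, deleteVerts_isLink]
  simp only [Set.mem_ofPred_eq]
  rw [reach_iff, reach_iff]
  constructor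
  · rintro ⟨⟨h, -, -⟩, h'⟩
    exact ⟨h, h'⟩
  · rintro ⟨h, h'⟩
    exact ⟨⟨h, h'.1.1, h'.2.1⟩, h'⟩

/-- Forests of odd cacti are characterized by the condition `Good`. -/
theorem isOddCactusForest_iff :
    IsOddCactusForest (I.graph.deleteVerts X) I.weight ↔ I.net.Good (I.net.ind Xᶜ) := by
  constructor
  · intro h e he hc
    set x := (I.net.ends e).1 with hx
    obtain ⟨⟨-, huniq⟩, hodd⟩ := h x (mem_deleteVerts.2 he.1)
    have hG : ∀ f ∈ I.net.ind (I.net.comp Xᶜ x), ∀ y z, I.net.Joins f y z →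
        (component (I.graph.deleteVerts X) x).IsLink f y z := by
      intro f hf y z hj
      rw [component_isLink]
      exact ⟨hj, hj.mem_ind.1 hf⟩
    have hec : e ∈ I.net.ind (I.net.comp Xᶜ x) :=
      ⟨mem_comp_self he.1, comp_closed (mem_comp_self he.1) he.2 ⟨e, joins_ends e⟩⟩
    have hcyc : ∀ D ⊆ I.net.ind Xᶜ \ {e}, I.net.con D x (I.net.ends e).2 →
        ∃ C : GraphCycle (component (I.graph.deleteVerts X) x), e ∈ C.edges ∧
          C.edges ⊆ insert e D := by
      intro D hD hcD
      obtain ⟨C, h1, h2⟩ := exists_cycle hG hec (D := D ∩ I.net.ind (I.net.comp Xᶜ x))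
        (fun f hf => ⟨hf.2, (hD hf.1).2⟩)
        (con_inter_comp (hD.trans Set.sdiff_subset) hcD)
      exact ⟨C, h1, h2.trans (Set.insert_subset_insert Set.inter_subset_left)⟩
    obtain ⟨C, hC1, hC2⟩ := hcyc _ Set.Subset.rfl hc
    have hG1 : ∀ e y z, (component (I.graph.deleteVerts X) x).IsLink e y z → I.net.Joins e y z :=
      fun e y z h => (component_isLink.1 h).1
    have hcon := C.con_diff hG1 hC1
    have hCE : C.edges \ {e} ⊆ I.net.ind Xᶜ \ {e} := fun f hf => (hC2 hf.1).resolve_left hf.2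
    have hsub := bri_subset hCE hcon
    -- If an edge of `C` other than `e` were not forced, there would be a cycle through `e` avoiding
    -- it, against uniqueness.
    have hsup : C.edges \ {e} ⊆ I.net.bri (I.net.ind Xᶜ) e := by
      intro f hf
      refine ⟨(hCE hf).1, hf.2, fun hcf => ?_⟩
      obtain ⟨C', h1, h2⟩ := hcyc _ (Set.sdiff_subset_sdiff_right (by simp)) hcf
      rcases h2 (huniq C C' e hC1 h1 ▸ hf.1) with h3 | h3
      · exact hf.2 h3
      · exact h3.2 (Or.inr rfl)
    have heq : C.edges = insert e (I.net.bri (I.net.ind Xᶜ) e) := by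
      rw [Set.Subset.antisymm hsub hsup, Set.insert_sdiff_singleton, Set.insert_eq_of_mem hC1]
    refine ⟨hcon.mono hsup, ?_⟩
    rw [← C.weight_eq (N := I.net) I.weight (fun _ => rfl) heq]
    exact hodd C
  · intro hG x hx
    rw [mem_deleteVerts] at hx
    have hG1 : ∀ e y z, (component (I.graph.deleteVerts X) x).IsLink e y z → I.net.Joins e y z :=
      fun e y z h => (component_isLink.1 h).1
    -- Every cycle through `e` consists of `e` and the forced edges: these lie on it and already
    -- connect the ends of `e`, whereas a cycle without `e` and one further edge does not connect
    -- them. Uniqueness and parity follow.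
    have hedge : ∀ (C : GraphCycle (component (I.graph.deleteVerts X) x)), ∀ e ∈ C.edges,
        C.edges = insert e (I.net.bri (I.net.ind Xᶜ) e) := by
      intro C e he
      have hsub : C.edges ⊆ I.net.ind Xᶜ := by
        rintro _ ⟨i, rfl⟩
        obtain ⟨h1, h2, h3⟩ := component_isLink.1 (C.link i)
        exact h1.mem_ind.2 ⟨h2.1, h3.1⟩
      have hcon := C.con_diff hG1 he
      have hd : C.edges \ {e} ⊆ I.net.ind Xᶜ \ {e} := Set.sdiff_subset_sdiff_left hsub
      obtain ⟨hb, -⟩ := hG e (hsub he) (hcon.mono hd)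
      have hbs := bri_subset hd hcon
      refine Set.Subset.antisymm (fun f hf => ?_) ?_
      · by_contra hf'
        have hfe : f ≠ e := fun h => hf' (Or.inl h)
        refine C.not_con_diff hG1 he hf hfe (hb.mono fun g hg => ⟨(hbs hg).1, ?_⟩)
        rintro (rfl | rfl)
        · exact hg.2.1 rfl
        · exact hf' (Or.inr hg)
      · rintro f (rfl | hf)
        · exact he
        · exact (hbs hf).1
    refine ⟨⟨?_, ?_⟩, ?_⟩
    · have hall : ∀ y ∈ V(component (I.graph.deleteVerts X) x),
          Relation.ReflTransGen (component (I.graph.deleteVerts X) x).Adj x y := by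
        intro y hy
        have hy' : y ∈ I.net.comp Xᶜ x := (reach_iff).1 hy
        refine ((con_comp hy').iff_of (fun z => Relation.ReflTransGen
          (component (I.graph.deleteVerts X) x).Adj x z) fun e he => ?_).1 .refl
        have : (component (I.graph.deleteVerts X) x).Adj (I.net.ends e).1 (I.net.ends e).2 :=
          ⟨e, component_isLink.2 ⟨joins_ends e, he.1, he.2⟩⟩
        exact ⟨fun h => h.tail this, fun h => h.tail this.symm⟩
      intro y hy z hz
      have : Std.Symm (component (I.graph.deleteVerts X) x).Adj := ⟨fun _ _ h => h.symm⟩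
      exact (Relation.ReflTransGen.stdSymm.symm _ _ (hall y hy)).trans (hall z hz)
    · intro C D e hC hD
      rw [hedge C e hC, hedge D e hD]
    · intro C
      have he : C.e ⟨0, by have := C.two_le; omega⟩ ∈ C.edges := ⟨_, rfl⟩
      rw [C.weight_eq (N := I.net) I.weight (fun _ => rfl) (hedge C _ he)]
      refine (hG _ ?_ ?_).2
      · obtain ⟨h1, h2, h3⟩ := component_isLink.1 (C.link ⟨0, by have := C.two_le; omega⟩)
        exact h1.mem_ind.2 ⟨h2.1, h3.1⟩
      · refine (C.con_diff hG1 he).mono ?_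
        rintro f ⟨⟨i, rfl⟩, hf⟩
        obtain ⟨h1, h2, h3⟩ := component_isLink.1 (C.link i)
        exact ⟨h1.mem_ind.2 ⟨h2.1, h3.1⟩, hf⟩

end Inst

end EvenCycle

/-! ### Evaluation with upper bounds on the number of steps. -/

namespace TreeMachine

/-- Evaluation within a given number of steps. -/
def Ev (P : Program) (env : List Data) (a : Expr) (d : Data) (T : ℕ) : Prop :=
  ∃ t ≤ T, Eval P env a d t

/-- Evaluation to a truth value, `nil` meaning `False`. -/
def EvB (P : Program) (env : List Data) (a : Expr) (p : Prop) (T : ℕ) : Prop :=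
  ∃ d, (d ≠ .nil ↔ p) ∧ Ev P env a d T

/-- The `f`-th function of the program, applied to `x`, returns `y` within a given number of
steps. -/
def Fn (P : Program) (f : ℕ) (x y : Data) (T : ℕ) : Prop :=
  ∃ body, P[f]? = some body ∧ Ev P [x] body y T

/-- The `f`-th function of the program, applied to `x`, returns the truth value of `p`. -/
def FnB (P : Program) (f : ℕ) (x : Data) (p : Prop) (T : ℕ) : Prop :=
  ∃ d, (d ≠ .nil ↔ p) ∧ Fn P f x d T

/-- The first component of a pair. -/
def Expr.fst (a : Expr) : Expr := .case a .nil (.var 0)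

/-- The second component of a pair. -/
def Expr.snd (a : Expr) : Expr := .case a .nil (.var 1)

/-- The truth value `True`. -/
def Expr.tt : Expr := .node .nil .nil

/-- Negation. -/
def Expr.not (a : Expr) : Expr := .case a .tt .nil

variable {P : Program} {env : List Data} {a b c : Expr} {x y z d : Data} {s t u T T' i f : ℕ}
  {p q : Prop}

theorem Ev.mono (h : Ev P env a d T) (hT : T ≤ T') : Ev P env a d T' :=
  let ⟨t, ht, h⟩ := h; ⟨t, ht.trans hT, h⟩

theorem Ev.var (h : env[i]? = some d) : Ev P env (.var i) d 1 := ⟨1, le_rfl, .var h⟩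

theorem Ev.nil : Ev P env .nil .nil 1 := ⟨1, le_rfl, .nil⟩

theorem Ev.node (h : Ev P env a x s) (h' : Ev P env b y t) :
    Ev P env (.node a b) (.node x y) (s + t + 1) :=
  let ⟨_, hs, h⟩ := h; let ⟨_, ht, h'⟩ := h'; ⟨_, by omega, .node h h'⟩

theorem Ev.bind (h : Ev P env a x s) (h' : Ev P (x :: env) b y t) :
    Ev P env (.bind a b) y (s + t + 1) :=
  let ⟨_, hs, h⟩ := h; let ⟨_, ht, h'⟩ := h'; ⟨_, by omega, .bind h h'⟩

theorem Ev.case_nil (h : Ev P env a .nil s) (h' : Ev P env b y t) :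
    Ev P env (.case a b c) y (s + t + 1) :=
  let ⟨_, hs, h⟩ := h; let ⟨_, ht, h'⟩ := h'; ⟨_, by omega, .case_nil h h'⟩

theorem Ev.case_node (h : Ev P env a (.node x z) s) (h' : Ev P (x :: z :: env) c y t) :
    Ev P env (.case a b c) y (s + t + 1) :=
  let ⟨_, hs, h⟩ := h; let ⟨_, ht, h'⟩ := h'; ⟨_, by omega, .case_node h h'⟩

theorem Ev.call (h : Ev P env a x s) (h' : Fn P f x y t) :
    Ev P env (.call f a) y (s + t + 1) :=
  let ⟨_, hs, h⟩ := h; let ⟨_, hb, _, ht, h'⟩ := h'; ⟨_, by omega, .call hb h h'⟩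

theorem Ev.fst (h : Ev P env a (.node x y) s) : Ev P env (.fst a) x (s + 2) :=
  Ev.case_node h (Ev.var rfl)

theorem Ev.snd (h : Ev P env a (.node x y) s) : Ev P env (.snd a) y (s + 2) :=
  Ev.case_node h (Ev.var rfl)

theorem Ev.tt : Ev P env .tt (.node .nil .nil) 3 := Ev.node .nil .nil

/-- A conditional. -/
theorem Ev.ite (h : EvB P env a p s) (h0 : ¬ p → Ev P env b y t)
    (h1 : p → ∀ d d', Ev P (d :: d' :: env) c y t) : Ev P env (.case a b c) y (s + t + 1) := by
  obtain ⟨d, hd, h⟩ := h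
  cases d with
  | nil => exact .case_nil h (h0 fun hp => hd.2 hp rfl)
  | node d d' => exact .case_node h (h1 (hd.1 (by simp)) d d')

theorem EvB.mono (h : EvB P env a p T) (hT : T ≤ T') : EvB P env a p T' :=
  let ⟨d, hd, h⟩ := h; ⟨d, hd, h.mono hT⟩

theorem EvB.congr (h : EvB P env a p T) (hp : p ↔ q) : EvB P env a q T :=
  let ⟨d, hd, h⟩ := h; ⟨d, hd.trans hp, h⟩

theorem EvB.of_ev (h : Ev P env a d T) (hp : d ≠ .nil ↔ p) : EvB P env a p T := ⟨d, hp, h⟩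

theorem EvB.tt (hp : p) : EvB P env .tt p 3 := ⟨_, by simp [hp], Ev.tt⟩

theorem EvB.nil (hp : ¬ p) : EvB P env .nil p 1 := ⟨_, by simp [hp], Ev.nil⟩

theorem EvB.bind (h : Ev P env a x s) (h' : EvB P (x :: env) b p t) :
    EvB P env (.bind a b) p (s + t + 1) :=
  let ⟨d, hd, h'⟩ := h'; ⟨d, hd, h.bind h'⟩

theorem EvB.case_nil (h : Ev P env a .nil s) (h' : EvB P env b p t) :
    EvB P env (.case a b c) p (s + t + 1) :=
  let ⟨d, hd, h'⟩ := h'; ⟨d, hd, h.case_nil h'⟩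

theorem EvB.case_node (h : Ev P env a (.node x z) s) (h' : EvB P (x :: z :: env) c p t) :
    EvB P env (.case a b c) p (s + t + 1) :=
  let ⟨d, hd, h'⟩ := h'; ⟨d, hd, h.case_node h'⟩

theorem EvB.call (h : Ev P env a x s) (h' : FnB P f x p t) :
    EvB P env (.call f a) p (s + t + 1) :=
  let ⟨d, hd, h'⟩ := h'; ⟨d, hd, h.call h'⟩

theorem EvB.ite (h : EvB P env a p s) (h0 : ¬ p → EvB P env b q t)
    (h1 : p → ∀ d d', EvB P (d :: d' :: env) c q t) : EvB P env (.case a b c) q (s + t + 1) := by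
  obtain ⟨d, hd, h⟩ := h
  cases d with
  | nil => exact .case_nil h (h0 fun hp => hd.2 hp rfl)
  | node d d' => exact .case_node h (h1 (hd.1 (by simp)) d d')

theorem EvB.not (h : EvB P env a p s) : EvB P env (.not a) (¬ p) (s + 4) :=
  EvB.ite h (fun hp => EvB.tt hp) fun hp _ _ => (EvB.nil (by simpa using hp)).mono (by omega)

theorem Fn.intro (hb : P[f]? = some b) (h : Ev P [x] b y T) : Fn P f x y T := ⟨b, hb, h⟩

theorem FnB.intro (hb : P[f]? = some b) (h : EvB P [x] b p T) : FnB P f x p T :=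
  let ⟨d, hd, h⟩ := h; ⟨d, hd, b, hb, h⟩

theorem Fn.mono (h : Fn P f x y T) (hT : T ≤ T') : Fn P f x y T' :=
  let ⟨b, hb, h⟩ := h; ⟨b, hb, h.mono hT⟩

theorem FnB.mono (h : FnB P f x p T) (hT : T ≤ T') : FnB P f x p T' :=
  let ⟨d, hd, h⟩ := h; ⟨d, hd, h.mono hT⟩

theorem FnB.congr (h : FnB P f x p T) (hp : p ↔ q) : FnB P f x q T :=
  let ⟨d, hd, h⟩ := h; ⟨d, hd.trans hp, h⟩

/-! ### Lists -/

section

variable {α : Type*}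

/-- The encoding of a list, given an encoding of its elements. -/
def encL (enc : α → Data) (L : List α) : Data := encList (L.map enc)

theorem encL_nil (enc : α → Data) : encL enc [] = .nil := rfl

theorem encL_cons (enc : α → Data) (x : α) (L : List α) :
    encL enc (x :: L) = .node (enc x) (encL enc L) := rfl

theorem encL_ne_nil {enc : α → Data} {L : List α} : encL enc L ≠ .nil ↔ L ≠ [] := by
  cases L <;> simp [encL_nil, encL_cons]

/-- The elements of a list satisfying a predicate. -/
noncomputable def sel (p : α → Prop) (L : List α) : List α :=
  @List.filter α (fun x => @decide (p x) (Classical.propDecidable _)) L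

variable {p q : α → Prop} {L : List α} {x : α}

@[simp]
theorem mem_sel : x ∈ sel p L ↔ x ∈ L ∧ p x := by
  classical
  simp [sel]

theorem sel_sublist : (sel p L).Sublist L := List.filter_sublist

theorem length_sel_le : (sel p L).length ≤ L.length := sel_sublist.length_le

theorem sel_cons_pos (h : p x) : sel p (x :: L) = x :: sel p L :=
  List.filter_cons_of_pos (by simpa using h)

theorem sel_cons_neg (h : ¬ p x) : sel p (x :: L) = sel p L :=
  List.filter_cons_of_neg (by simpa using h)

theorem sel_ne_nil : sel p L ≠ [] ↔ ∃ x ∈ L, p x := by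
  constructor
  · intro h
    obtain ⟨x, hx⟩ := List.exists_mem_of_ne_nil _ h
    exact ⟨x, mem_sel.1 hx⟩
  · rintro ⟨x, hx⟩ h
    have : x ∈ sel p L := mem_sel.2 hx
    simp [h] at this

end

/-- The body of a function with index `i` that, for a pair of a context and a list, returns the
elements of the list that, together with the context, are accepted by the function with
index `g`. -/
def filterBody (i g : ℕ) : Expr :=
  .case (.snd (.var 0)) .nil
    (.bind (.call i (.node (.fst (.var 2)) (.var 1)))
      (.case (.call g (.node (.fst (.var 3)) (.var 1))) (.var 0) (.node (.var 3) (.var 2))))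

/-- The tail is filtered before the head is tested, so both outcomes of the test only have to return
or extend a finished list. The constant `25` pays for the bookkeeping per element. -/
theorem fn_filter {α : Type*} {g : ℕ} {enc : α → Data} {ctx : Data} {p : α → Prop} (L : List α)
    (hP : P[i]? = some (filterBody i g))
    (h : ∀ x ∈ L, FnB P g (.node ctx (enc x)) (p x) T) :
    Fn P i (.node ctx (encL enc L)) (encL enc (sel p L)) ((T + 25) * (L.length + 1)) := by
  induction L with
  | nil =>
    exact Fn.intro hP ((Ev.case_nil (.snd (.var rfl)) .nil).mono (by simp))
  | cons x L ih =>
    have ih := ih fun y hy => h y (List.mem_cons_of_mem _ hy)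
    refine Fn.intro hP (Ev.mono (Ev.case_node (.snd (.var rfl))
      (Ev.bind (.call (.node (.fst (.var rfl)) (.var rfl)) ih)
      (Ev.ite (t := 3) (.call (.node (.fst (.var rfl)) (.var rfl)) (h x List.mem_cons_self))
        (fun hp => ?_) (fun hp d d' => ?_)))) ?_)
    · rw [sel_cons_neg hp]
      exact (Ev.var rfl).mono (by omega)
    · rw [sel_cons_pos hp]
      exact Ev.node (.var rfl) (.var rfl)
    · simp only [List.length_cons]
      ring_nf
      omega

/-! ### Polynomial bounds -/

/-- Functions bounded by a polynomial. -/
@[fun_prop]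
def PolyBd (T : ℕ → ℕ) : Prop := ∃ c, ∀ N, T N ≤ (N + 2) ^ c

namespace PolyBd

@[fun_prop]
theorem id : PolyBd fun N => N := ⟨1, fun N => by simp⟩

@[fun_prop]
theorem const (k : ℕ) : PolyBd fun _ => k :=
  ⟨k, fun N => Nat.lt_two_pow_self.le.trans (Nat.pow_le_pow_left (by omega) k)⟩

@[fun_prop]
theorem comp {f g : ℕ → ℕ} (hf : PolyBd f) (hg : PolyBd g) : PolyBd fun N => f (g N) := by
  obtain ⟨c, hc⟩ := hf
  obtain ⟨d, hd⟩ := hg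
  -- Indeed `g N + 2 ≤ (N + 2) ^ (d + 2)`: a base of at least `2` absorbs the summand.
  refine ⟨(d + 2) * c, fun N => (hc _).trans ?_⟩
  rw [pow_mul]
  refine Nat.pow_le_pow_left ?_ c
  have h1 := hd N
  have h2 : 1 ≤ (N + 2) ^ d := Nat.one_le_pow _ _ (by omega)
  have h3 : 2 ^ 2 ≤ (N + 2) ^ 2 := Nat.pow_le_pow_left (by omega) 2
  rw [pow_add]
  nlinarith

@[fun_prop]
theorem add {f g : ℕ → ℕ} (hf : PolyBd f) (hg : PolyBd g) : PolyBd fun N => f N + g N := by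
  obtain ⟨c, hc⟩ := hf
  obtain ⟨d, hd⟩ := hg
  refine ⟨c + d + 1, fun N => ?_⟩
  have h1 := hc N
  have h2 := hd N
  have h3 : (N + 2) ^ c ≤ (N + 2) ^ (c + d) := Nat.pow_le_pow_right (by omega) (by omega)
  have h4 : (N + 2) ^ d ≤ (N + 2) ^ (c + d) := Nat.pow_le_pow_right (by omega) (by omega)
  rw [pow_succ]
  nlinarith

@[fun_prop]
theorem mul {f g : ℕ → ℕ} (hf : PolyBd f) (hg : PolyBd g) : PolyBd fun N => f N * g N := by
  obtain ⟨c, hc⟩ := hf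
  obtain ⟨d, hd⟩ := hg
  refine ⟨c + d, fun N => ?_⟩
  rw [pow_add]
  exact Nat.mul_le_mul (hc N) (hd N)

end PolyBd

end TreeMachine

namespace EvenCycle

open TreeMachine

/-! ### The program -/

namespace Code

/-- Main function: number the edges, compute the vertices outside `S`, and solve. -/
def main : Expr :=
  .bind (.call 37 (.node .nil (.fst (.snd (.var 0)))))
    (.bind (.fst (.snd (.snd (.var 1))))
      (.call 39 (.node (.snd (.snd (.snd (.var 2)))) (.node (.var 1)
        (.node (.var 0) (.call 20 (.node (.var 0) (.call 38 (.fst (.var 2))))))))))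

/-- Equality of two numbers. -/
def natEq : Expr :=
  .case (.fst (.var 0)) (.case (.snd (.var 0)) .tt .nil)
    (.case (.snd (.var 2)) .nil (.call 1 (.node (.var 3) (.var 1))))

/-- `(A, e)`: both ends of the edge `e` are in `A`. -/
def edgeIn : Expr :=
  .case (.call 2 (.node (.fst (.snd (.snd (.var 0)))) (.fst (.var 0)))) .nil
    (.call 2 (.node (.fst (.snd (.snd (.snd (.var 2))))) (.fst (.var 2))))

/-- `((a, b), z)`: replace the vertex `b` by `a`. -/
def renV : Expr :=
  .case (.call 1 (.node (.snd (.var 0)) (.snd (.fst (.var 0))))) (.snd (.var 0))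
    (.fst (.fst (.var 2)))

/-- `((a, b), L)`: replace the vertex `b` by `a` in the list of edges `L`. -/
def renL : Expr :=
  .case (.snd (.var 0)) .nil
    (.node
      (.node (.fst (.var 0))
        (.node (.call 5 (.node (.fst (.var 2)) (.fst (.snd (.var 0)))))
          (.node (.call 5 (.node (.fst (.var 2)) (.fst (.snd (.snd (.var 0))))))
            (.snd (.snd (.snd (.var 0)))))))
      (.call 6 (.node (.fst (.var 2)) (.var 1))))

/-- `(L, (x, y))`: the edges in the list `L` connect `x` and `y`. -/
def conn : Expr :=
  .case (.fst (.var 0)) (.call 1 (.snd (.var 0)))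
    (.bind (.node (.fst (.snd (.var 0))) (.fst (.snd (.snd (.var 0)))))
      (.call 7 (.node (.call 6 (.node (.var 0) (.var 2)))
        (.node (.call 5 (.node (.var 0) (.fst (.snd (.var 3)))))
          (.call 5 (.node (.var 0) (.snd (.snd (.var 3)))))))))

/-- `(e, f)`: the edges `e` and `f` are different. -/
def idNe : Expr := .not (.call 1 (.node (.fst (.fst (.var 0))) (.fst (.snd (.var 0)))))

/-- `((L, (u, v)), f)`: the edges in `L` other than `f` do not connect `u` and `v`. -/
def bridge : Expr :=
  .not (.call 7 (.node (.call 9 (.node (.snd (.var 0)) (.fst (.fst (.var 0)))))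
    (.snd (.fst (.var 0)))))

/-- The total weight of a list of edges is odd. -/
def parity : Expr :=
  .case (.var 0) .nil
    (.case (.snd (.snd (.snd (.var 0)))) (.call 12 (.var 1)) (.not (.call 12 (.var 3))))

/-- `(L, e)`: the edge `e` violates the condition for a forest of odd cacti in `L`. -/
def viol : Expr :=
  .bind (.call 9 (.node (.snd (.var 0)) (.fst (.var 0))))
    (.bind (.node (.fst (.snd (.snd (.var 1)))) (.fst (.snd (.snd (.snd (.var 1))))))
      (.case (.call 7 (.node (.var 1) (.var 0))) .nil
        (.bind (.call 11 (.node (.node (.var 3) (.var 2)) (.var 3)))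
          (.case (.call 7 (.node (.var 0) (.var 3))) .tt
            (.not (.call 12 (.node (.snd (.var 7)) (.var 2))))))))

/-- `(A, E)`: the edges of `E` inside `A` do not form a forest of odd cacti. -/
def bad : Expr := .bind (.call 4 (.var 0)) (.call 14 (.node (.var 0) (.var 0)))

/-- `((A, E), (x, y))`: the edges of `E` inside `A` connect `x` and `y`. -/
def connIn : Expr := .call 7 (.node (.call 4 (.fst (.var 0))) (.snd (.var 0)))

/-- `((L, w), z)`: the edges in `L` connect `w` and `z`. -/
def reach : Expr :=
  .call 7 (.node (.fst (.fst (.var 0))) (.node (.snd (.fst (.var 0))) (.snd (.var 0))))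

/-- `(A, x)`: the vertex `x` is not in `A`. -/
def notMem : Expr := .not (.call 2 (.node (.snd (.var 0)) (.fst (.var 0))))

/-- `((E, (P, w)), z)`: the vertex `z` is a neighbour of the component `P` of `w`. -/
def nbr : Expr :=
  .case (.call 2 (.node (.snd (.var 0)) (.fst (.snd (.fst (.var 0))))))
    (.call 16 (.node
      (.node (.node (.snd (.var 0)) (.fst (.snd (.fst (.var 0))))) (.fst (.fst (.var 0))))
      (.node (.snd (.snd (.fst (.var 0)))) (.snd (.var 0)))))
    .nil

/-- `((E, (P, M)), y)`: the vertex `y` is in the list `M` of neighbours of `P`, there is at most one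
further neighbour, and `P` forms a forest of odd cacti with it. -/
def dom : Expr :=
  .case (.call 2 (.node (.snd (.var 0)) (.snd (.snd (.fst (.var 0)))))) .nil
    (.bind (.call 20 (.node (.node (.snd (.var 2)) .nil) (.snd (.snd (.fst (.var 2))))))
      (.case (.var 0)
        (.not (.call 15 (.node (.fst (.snd (.fst (.var 3)))) (.fst (.fst (.var 3))))))
        (.case (.var 1)
          (.not (.call 15 (.node (.node (.var 0) (.fst (.snd (.fst (.var 5)))))
            (.fst (.fst (.var 5))))))
          .nil)))

/-- `((E, (A, (U, (D, L)))), w)`: the vertex `w` is in the region of `U`. -/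
def inReg : Expr :=
  .case (.call 2 (.node (.snd (.var 0)) (.fst (.snd (.snd (.fst (.var 0)))))))
    (.bind (.call 18 (.node (.node (.snd (.snd (.snd (.snd (.fst (.var 0)))))) (.snd (.var 0)))
        (.fst (.snd (.snd (.snd (.fst (.var 0))))))))
      (.bind (.call 22 (.node (.node (.fst (.fst (.var 1))) (.node (.var 0) (.snd (.var 1))))
          (.fst (.snd (.fst (.var 1))))))
        (.call 24 (.node (.node (.fst (.fst (.var 2))) (.node (.var 1) (.var 0)))
          (.fst (.snd (.snd (.fst (.var 2)))))))))
    .tt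

/-- `((E, (S, F)), U)`: the region of `U`. -/
def region : Expr :=
  .bind (.call 20 (.node (.snd (.var 0)) (.snd (.snd (.fst (.var 0))))))
    (.bind (.call 4 (.node (.var 0) (.fst (.fst (.var 1)))))
      (.call 26 (.node
        (.node (.fst (.fst (.var 2)))
          (.node (.call 28 (.node (.fst (.snd (.fst (.var 2)))) (.snd (.snd (.fst (.var 2))))))
            (.node (.snd (.var 2)) (.node (.var 1) (.var 0)))))
        (.snd (.snd (.fst (.var 2)))))))

/-- Concatenation of two lists. -/
def append : Expr :=
  .case (.fst (.var 0)) (.snd (.var 0))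
    (.node (.var 0) (.call 28 (.node (.var 1) (.snd (.var 2)))))

/-- `((E, (R, p)), s)`: the vertex `s` is attached to `p` through `R`. -/
def attached : Expr :=
  .call 16 (.node
    (.node (.node (.snd (.var 0)) (.fst (.snd (.fst (.var 0))))) (.fst (.fst (.var 0))))
    (.node (.snd (.snd (.fst (.var 0)))) (.snd (.var 0))))

/-- `((L, w), z)`: the edges in `L` do not connect `w` and `z`. -/
def notReach : Expr := .not (.call 17 (.var 0))

/-- `((E, (S, F)), U)`: the list `U` is suitable for branching. -/
def test : Expr :=
  .bind (.call 27 (.var 0))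
    (.case (.call 15 (.node (.call 28 (.node (.fst (.snd (.fst (.var 1)))) (.var 0)))
        (.fst (.fst (.var 1)))))
      (.case (.snd (.var 1)) .nil
        (.bind (.call 30 (.node (.node (.fst (.fst (.var 3))) (.node (.var 2) (.var 0)))
            (.fst (.snd (.fst (.var 3))))))
          (.case (.var 0) .nil
            (.case (.var 4) (.var 1)
              (.case (.var 1)
                (.case (.call 16 (.node (.node (.var 7) (.fst (.fst (.var 8))))
                    (.node (.var 5) (.var 0)))) .nil
                  (.call 32 (.node
                    (.node (.call 4 (.node (.fst (.snd (.fst (.var 10)))) (.fst (.fst (.var 10)))))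
                      (.var 4))
                    (.var 6))))
                .nil)))))
      .tt)

/-- `(U, (F, L))`: the lists obtained by adding an element of `F` to `U`, followed by `L`. -/
def consAll : Expr :=
  .case (.fst (.snd (.var 0))) (.snd (.snd (.var 0)))
    (.node (.node (.var 0) (.fst (.var 2)))
      (.call 35 (.node (.fst (.var 2)) (.node (.var 1) (.snd (.snd (.var 2)))))))

/-- `(F, (Us, L))`: the lists obtained by adding an element of `F` to an element of `Us`, followed
by `L`. -/
def extend : Expr :=
  .case (.fst (.snd (.var 0))) (.snd (.snd (.var 0)))
    (.call 35 (.node (.var 0) (.node (.fst (.var 2))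
      (.call 36 (.node (.fst (.var 2)) (.node (.var 1) (.snd (.snd (.var 2)))))))))

/-- `(i, L)`: number the elements of the list `L`, starting with `i`. -/
def number : Expr :=
  .case (.snd (.var 0)) .nil
    (.node (.node (.fst (.var 2)) (.var 0))
      (.call 37 (.node (.node .nil (.fst (.var 2))) (.var 1))))

/-- The list of the numbers below a given number. -/
def range : Expr := .case (.var 0) .nil (.node (.var 1) (.call 38 (.var 1)))

/-- The lists with at most three elements of a given list. -/
def cands : Expr :=
  .bind (.call 36 (.node (.var 0) (.node (.node .nil .nil) (.node .nil .nil))))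
    (.bind (.call 36 (.node (.var 1) (.node (.var 0) (.var 0))))
      (.call 36 (.node (.var 2) (.node (.var 0) (.var 0)))))

/-- `(k, (E, (S, F)))`: solve an instance. -/
def solve : Expr :=
  .case (.call 15 (.node (.call 28 (.snd (.snd (.var 0)))) (.fst (.snd (.var 0)))))
    (.node .nil .nil)
    (.case (.fst (.var 2)) .nil
      (.case (.call 15 (.node (.fst (.snd (.snd (.var 4)))) (.fst (.snd (.var 4)))))
        (.case (.call 34 (.node (.snd (.var 4)) (.call 41 (.snd (.snd (.snd (.var 4))))))) .nil
          (.call 40 (.node (.var 0) (.node (.var 0) (.node (.var 3) (.snd (.var 6)))))))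
        .nil))

/-- `(U', (U, (k, (E, (S, F)))))`: solve an instance with parameter `k + 1` by deleting an element
of `U'` or keeping the region of `U`. -/
def branch : Expr :=
  .case (.fst (.var 0))
    (.bind (.call 27 (.node (.snd (.snd (.snd (.var 0)))) (.fst (.snd (.var 0)))))
      (.call 39 (.node (.node .nil (.fst (.snd (.snd (.var 1)))))
        (.node (.fst (.snd (.snd (.snd (.var 1)))))
          (.node (.call 28 (.node (.fst (.snd (.snd (.snd (.snd (.var 1)))))) (.var 0)))
            (.call 20 (.node (.var 0) (.snd (.snd (.snd (.snd (.snd (.var 1)))))))))))))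
    (.case (.call 39 (.node (.fst (.snd (.snd (.var 2))))
        (.node (.fst (.snd (.snd (.snd (.var 2)))))
          (.node (.fst (.snd (.snd (.snd (.snd (.var 2))))))
            (.call 20 (.node (.node (.var 0) .nil) (.snd (.snd (.snd (.snd (.snd (.var 2))))))))))))
      (.call 40 (.node (.var 1) (.snd (.var 2))))
      (.node .nil (.node (.var 2) (.var 1))))

end Code

/-- The program. -/
def prog : Program :=
  [Code.main, Code.natEq, filterBody 2 1, Code.edgeIn, filterBody 4 3, Code.renV, Code.renL,
    Code.conn, Code.idNe, filterBody 9 8, Code.bridge, filterBody 11 10, Code.parity, Code.viol,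
    filterBody 14 13, Code.bad, Code.connIn, Code.reach, filterBody 18 17, Code.notMem,
    filterBody 20 19, Code.nbr, filterBody 22 21, Code.dom, filterBody 24 23, Code.inReg,
    filterBody 26 25, Code.region, Code.append, Code.attached, filterBody 30 29, Code.notReach,
    filterBody 32 31, Code.test, filterBody 34 33, Code.consAll, Code.extend, Code.number,
    Code.range, Code.solve, Code.branch, Code.cands]

/-! ### Numbers and connectivity -/

/-- The recursion ends when the first number is used up, so only that number enters the bound. -/
theorem fn_natEq {N a : ℕ} (ha : a ≤ N) (b : ℕ) :
    FnB prog 1 (.node (encNat a) (encNat b)) (a = b) (20 * (N + 1)) := by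
  induction a generalizing N b with
  | zero =>
    cases b with
    | zero =>
      exact FnB.intro rfl ((EvB.case_nil (.fst (.var rfl)) (.case_nil (.snd (.var rfl))
        (.tt rfl))).mono (by omega))
    | succ b =>
      exact FnB.intro rfl ((EvB.case_nil (.fst (.var rfl)) (.case_node (.snd (.var rfl))
        (.nil (by simp)))).mono (by omega))
  | succ a ih =>
    obtain ⟨N, rfl⟩ : ∃ M, N = M + 1 := ⟨N - 1, by omega⟩
    cases b with
    | zero =>
      exact FnB.intro rfl ((EvB.case_node (.fst (.var rfl)) (.case_nil (.snd (.var rfl))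
        (.nil (by simp)))).mono (by omega))
    | succ b =>
      refine FnB.intro rfl (EvB.mono (EvB.case_node (.fst (.var rfl)) (.case_node (.snd (.var rfl))
        (.call (.node (.var rfl) (.var rfl)) ((ih (N := N) (by omega) b).congr ?_)))) ?_)
      · omega
      · omega

/-- Raw edges: a label, two ends, and a weight. -/
abbrev RawEdge := Data × ℕ × ℕ × Data

/-- The encoding of a raw edge. -/
def encRaw (r : RawEdge) : Data :=
  .node r.1 (.node (encNat r.2.1) (.node (encNat r.2.2.1) r.2.2.2))

/-- Connectivity by a list of raw edges. -/
def RawCon (L : List RawEdge) : ℕ → ℕ → Prop :=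
  Relation.EqvGen fun a b => ∃ r ∈ L, (r.2.1, r.2.2.1) = (a, b)

theorem RawCon.map {L L' : List RawEdge} (φ : ℕ → ℕ)
    (h : ∀ r ∈ L, RawCon L' (φ r.2.1) (φ r.2.2.1)) {x y : ℕ} (hxy : RawCon L x y) :
    RawCon L' (φ x) (φ y) := by
  induction hxy with
  | rel a b hab => obtain ⟨r, hr, hab⟩ := hab; cases hab; exact h r hr
  | refl a => exact .refl _
  | symm a b _ ih => exact .symm _ _ ih
  | trans a b c _ _ ih ih' => exact .trans _ _ _ ih ih'

/-- Replace `b` by `a`. -/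
def ren (a b z : ℕ) : ℕ := if z = b then a else z

/-- Replace `b` by `a` in a raw edge. -/
def renRaw (a b : ℕ) (r : RawEdge) : RawEdge := (r.1, ren a b r.2.1, ren a b r.2.2.1, r.2.2.2)

theorem rawCon_nil {x y : ℕ} : RawCon [] x y ↔ x = y := by
  constructor
  · intro h
    induction h with
    | rel a b hab => obtain ⟨r, hr, -⟩ := hab; simp at hr
    | refl a => rfl
    | symm a b _ ih => exact ih.symm
    | trans a b c _ _ ih ih' => exact ih.trans ih'
  · rintro rfl
    exact .refl _

/-- Connectivity is decided by contracting the first edge. Contraction creates loops and unused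
vertex names, which is why raw edges over all natural numbers are used here. -/
theorem rawCon_cons {r : RawEdge} {L : List RawEdge} {x y : ℕ} : RawCon (r :: L) x y ↔
    RawCon (L.map (renRaw r.2.1 r.2.2.1)) (ren r.2.1 r.2.2.1 x) (ren r.2.1 r.2.2.1 y) := by
  have hr : RawCon (r :: L) r.2.1 r.2.2.1 := .rel _ _ ⟨r, by simp, rfl⟩
  have hren : ∀ z, RawCon (r :: L) z (ren r.2.1 r.2.2.1 z) := by
    intro z
    unfold ren
    split_ifs with h
    · subst h; exact .symm _ _ hr
    · exact .refl _
  constructor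
  · refine RawCon.map _ fun s hs => ?_
    rcases List.mem_cons.1 hs with rfl | hs
    · have : ren s.2.1 s.2.2.1 s.2.1 = ren s.2.1 s.2.2.1 s.2.2.1 := by
        unfold ren; simp
      rw [this]
      exact .refl _
    · exact .rel _ _ ⟨renRaw r.2.1 r.2.2.1 s, List.mem_map.2 ⟨s, hs, rfl⟩, rfl⟩
  · intro h
    refine .trans _ _ _ (hren x) (.trans _ _ _ ?_ (.symm _ _ (hren y)))
    refine RawCon.map id (fun s hs => ?_) h
    obtain ⟨s, hs', rfl⟩ := List.mem_map.1 hs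
    exact .trans _ _ _ (.symm _ _ (hren _)) (.trans _ _ _ (.rel _ _ ⟨s, by simp [hs'], rfl⟩)
      (hren _))

theorem fn_renV {N a b z : ℕ} (hz : z ≤ N) :
    Fn prog 5 (.node (.node (encNat a) (encNat b)) (encNat z)) (encNat (ren a b z))
      (20 * (N + 1) + 20) := by
  refine Fn.intro rfl (Ev.mono (Ev.ite (t := 5) (.call (.node (.snd (.var rfl))
    (.snd (.fst (.var rfl)))) (fn_natEq hz b)) (fun h => ?_) (fun h _ _ => ?_)) ?_)
  · rw [ren, if_neg h]
    exact (Ev.snd (.var rfl)).mono (by omega)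
  · rw [ren, if_pos h]
    exact (Ev.fst (.fst (.var rfl))).mono (by omega)
  · omega

/-- All vertices of the raw edges in the list are at most `N`. -/
def RawLe (N : ℕ) (L : List RawEdge) : Prop := ∀ r ∈ L, r.2.1 ≤ N ∧ r.2.2.1 ≤ N

theorem ren_le {N a b z : ℕ} (ha : a ≤ N) (hz : z ≤ N) : ren a b z ≤ N := by
  unfold ren; split_ifs <;> assumption

theorem fn_renL {N a b : ℕ} {L : List RawEdge} (hL : RawLe N L) :
    Fn prog 6 (.node (.node (encNat a) (encNat b)) (encL encRaw L))
      (encL encRaw (L.map (renRaw a b))) ((40 * (N + 1) + 100) * (L.length + 1)) := by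
  induction L with
  | nil => exact Fn.intro rfl ((Ev.case_nil (.snd (.var rfl)) .nil).mono (by simp))
  | cons r L ih =>
    have hr := hL r (by simp)
    refine Fn.intro rfl (Ev.mono (Ev.case_node (.snd (.var rfl)) (.node
      (.node (.fst (.var rfl)) (.node (.call (.node (.fst (.var rfl)) (.fst (.snd (.var rfl))))
        (fn_renV hr.1)) (.node (.call (.node (.fst (.var rfl)) (.fst (.snd (.snd (.var rfl)))))
        (fn_renV hr.2)) (.snd (.snd (.snd (.var rfl)))))))
      (.call (.node (.fst (.var rfl)) (.var rfl)) (ih fun s hs => hL s (by simp [hs]))))) ?_)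
    simp only [List.length_cons]
    ring_nf
    omega

theorem fn_rawCon {N x y : ℕ} {L : List RawEdge} (hL : RawLe N L) (hx : x ≤ N) (hy : y ≤ N)
    (hl : L.length ≤ N) :
    FnB prog 7 (.node (encL encRaw L) (.node (encNat x) (encNat y))) (RawCon L x y)
      (((40 * (N + 1) + 100) * (N + 1) + 60 * (N + 1) + 150) * (L.length + 1)) := by
  induction hk : L.length generalizing L x y with
  | zero =>
    obtain rfl := List.length_eq_zero_iff.1 hk
    refine FnB.intro rfl (EvB.mono (EvB.case_nil (.fst (.var rfl)) (.call (.snd (.var rfl))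
      ((fn_natEq hx y).congr rawCon_nil.symm))) ?_)
    ring_nf
    omega
  | succ k ih =>
    obtain ⟨r, L, rfl⟩ : ∃ r L', L = r :: L' := by
      cases L with
      | nil => simp at hk
      | cons r L => exact ⟨r, L, rfl⟩
    have hr := hL r (by simp)
    have hL' : RawLe N L := fun s hs => hL s (by simp [hs])
    have hLr : RawLe N (L.map (renRaw r.2.1 r.2.2.1)) := by
      intro s hs
      obtain ⟨s, hs', rfl⟩ := List.mem_map.1 hs
      exact ⟨ren_le hr.1 (hL' s hs').1, ren_le hr.1 (hL' s hs').2⟩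
    simp only [List.length_cons] at hl hk
    have h6 := (fn_renL (a := r.2.1) (b := r.2.2.1) hL').mono
      (Nat.mul_le_mul_left (40 * (N + 1) + 100) (show L.length + 1 ≤ N + 1 by omega))
    refine FnB.intro rfl (EvB.mono (EvB.case_node (.fst (.var rfl)) (.bind
      (.node (.fst (.snd (.var rfl))) (.fst (.snd (.snd (.var rfl)))))
      (.call (.node (.call (.node (.var rfl) (.var rfl)) h6)
        (.node (.call (.node (.var rfl) (.fst (.snd (.var rfl)))) (fn_renV hx))
          (.call (.node (.var rfl) (.snd (.snd (.var rfl)))) (fn_renV hy))))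
        ((ih hLr (ren_le hr.1 hx) (ren_le hr.1 hy) (by simp; omega)
          (by simp; omega)).congr rawCon_cons.symm)))) ?_)
    ring_nf
    omega

end EvenCycle

namespace TreeMachine

theorem fn_filter_le {α : Type*} {P : Program} {i g N T : ℕ} {enc : α → Data} {ctx : Data}
    {p : α → Prop} {L : List α} (hP : P[i]? = some (filterBody i g)) (hL : L.length ≤ N)
    (h : ∀ x ∈ L, FnB P g (.node ctx (enc x)) (p x) T) :
    Fn P i (.node ctx (encL enc L)) (encL enc (sel p L)) ((T + 25) * (N + 1)) :=
  (fn_filter L hP h).mono (Nat.mul_le_mul_left _ (by omega))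

theorem Fn.toB {P : Program} {i T : ℕ} {x y : Data} {p : Prop} (h : Fn P i x y T)
    (hp : y ≠ .nil ↔ p) : FnB P i x p T := ⟨y, hp, h⟩

end TreeMachine

namespace EvenCycle

open TreeMachine Net

/-! ### Encodings and sizes -/

/-- The encoding of a vertex. -/
def eV {n : ℕ} (x : Fin n) : Data := encNat x

/-- The encoding of a list of vertices. -/
abbrev eVs {n : ℕ} (L : List (Fin n)) : Data := encL eV L

/-- The encoding of an edge together with its number. -/
def Inst.eE (I : Inst) (e : Fin I.m) : Data := .node (encNat e) (I.encEdge e)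

/-- The encoding of a list of edges. -/
abbrev Inst.eEs (I : Inst) (L : List (Fin I.m)) : Data := encL I.eE L

/-- The encoding of the list of all edges. -/
def Inst.eG (I : Inst) : Data := I.eEs (List.finRange I.m)

/-- The numbers of vertices and edges are bounded by `N`. -/
structure Inst.Sz (I : Inst) (N : ℕ) : Prop where
  n : I.n + 1 ≤ N
  m : I.m ≤ N

/-- The edges inside `A`. -/
noncomputable def Inst.inside (I : Inst) (A : List (Fin I.n)) (L : List (Fin I.m)) :
    List (Fin I.m) := sel (· ∈ I.net.ind (vset A)) L

theorem mem_vset {V : Type*} {A : List V} {x : V} : x ∈ vset A ↔ x ∈ A := Iff.rfl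

theorem vset_sel {V : Type*} {A : List V} {p : V → Prop} : vset (sel p A) = {x | x ∈ A ∧ p x} := by
  ext; simp [vset]

theorem vset_append {V : Type*} {A B : List V} : vset (A ++ B) = vset A ∪ vset B := by
  ext; simp [vset]

theorem vset_cons {V : Type*} {A : List V} {x : V} : vset (x :: A) = insert x (vset A) := by
  ext; simp [vset]

theorem vset_inside {I : Inst} {A : List (Fin I.n)} :
    vset (I.inside A (List.finRange I.m)) = I.net.ind (vset A) := by
  ext; simp [Inst.inside, vset_sel]

theorem length_inside_le {I : Inst} {N : ℕ} (h : I.Sz N) {A : List (Fin I.n)} :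
    (I.inside A (List.finRange I.m)).length ≤ N :=
  length_sel_le.trans (by simpa using h.m)

/-! ### Basic list operations -/

theorem spec_eqV {I : Inst} {N : ℕ} (h : I.Sz N) (x y : Fin I.n) :
    FnB prog 1 (.node (eV x) (eV y)) (x = y) (20 * (N + 1)) :=
  (fn_natEq (by have := h.n; omega) _).congr (by rw [Fin.ext_iff])

/-- Specifications have this form because one polynomial `T` must serve all instances; `N` is any
bound on their size. Membership is computed as nonemptiness of the list filtered by equality with
`x`. -/
theorem spec_mem : ∃ T, PolyBd T ∧ ∀ (I : Inst) (N : ℕ), I.Sz N → ∀ (x : Fin I.n)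
    (A : List (Fin I.n)), A.length ≤ N → FnB prog 2 (.node (eV x) (eVs A)) (x ∈ A) (T N) :=
  ⟨_, by fun_prop, fun _ _ h x _ hA =>
    (fn_filter_le rfl hA fun y _ => spec_eqV h x y).toB (by rw [encL_ne_nil, sel_ne_nil]; simp)⟩

theorem spec_edgeIn : ∃ T, PolyBd T ∧ ∀ (I : Inst) (N : ℕ), I.Sz N → ∀ (A : List (Fin I.n))
    (e : Fin I.m), A.length ≤ N →
    FnB prog 3 (.node (eVs A) (I.eE e)) (e ∈ I.net.ind (vset A)) (T N) := by
  obtain ⟨T, hT, hm⟩ := spec_mem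
  refine ⟨fun N => 2 * T N + 100, by fun_prop, fun I N h A e hA => ?_⟩
  refine FnB.intro rfl (EvB.mono (EvB.ite (t := T N + 50)
    (.call (.node (.fst (.snd (.snd (.var rfl)))) (.fst (.var rfl))) (hm I N h (I.ends e).1 A hA))
    (fun hn => ?_) (fun hp _ _ => ?_)) ?_)
  · exact (EvB.nil fun h => hn h.1).mono (by omega)
  · exact ((EvB.call (.node (.fst (.snd (.snd (.snd (.var rfl))))) (.fst (.var rfl)))
      (hm I N h (I.ends e).2 A hA)).congr ⟨fun h => ⟨hp, h⟩, fun h => h.2⟩).mono (by omega)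
  · beta_reduce; omega

theorem spec_restrict : ∃ T, PolyBd T ∧ ∀ (I : Inst) (N : ℕ), I.Sz N → ∀ (A : List (Fin I.n))
    (L : List (Fin I.m)), A.length ≤ N → L.length ≤ N →
    Fn prog 4 (.node (eVs A) (I.eEs L)) (I.eEs (I.inside A L)) (T N) := by
  obtain ⟨T, hT, hm⟩ := spec_edgeIn
  exact ⟨_, by fun_prop, fun I N h A L hA hL =>
    fn_filter_le rfl hL fun e _ => hm I N h A e hA⟩

theorem spec_idNe {I : Inst} {N : ℕ} (h : I.Sz N) (e f : Fin I.m) :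
    FnB prog 8 (.node (I.eE e) (I.eE f)) (e ≠ f) (20 * (N + 1) + 20) :=
  FnB.intro rfl (((EvB.not (.call (.node (.fst (.fst (.var rfl))) (.fst (.snd (.var rfl))))
    (fn_natEq (N := N) (by have := h.m; omega) _))).congr (by rw [Ne, Fin.ext_iff])).mono
    (by omega))

theorem spec_delE : ∃ T, PolyBd T ∧ ∀ (I : Inst) (N : ℕ), I.Sz N → ∀ (e : Fin I.m)
    (L : List (Fin I.m)), L.length ≤ N →
    Fn prog 9 (.node (I.eE e) (I.eEs L)) (I.eEs (sel (e ≠ ·) L)) (T N) :=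
  ⟨_, by fun_prop, fun _ _ h e _ hL => fn_filter_le rfl hL fun f _ => spec_idNe h e f⟩

/-! ### Connectivity -/

/-- The raw edge of an edge. -/
def Inst.raw (I : Inst) (e : Fin I.m) : RawEdge :=
  (encNat e, (I.ends e).1, (I.ends e).2, encNat (I.weight e))

theorem Inst.eEs_eq (I : Inst) (L : List (Fin I.m)) : I.eEs L = encL encRaw (L.map I.raw) := by
  simp only [Inst.eEs, encL, List.map_map]
  rfl

theorem Inst.rawCon_iff (I : Inst) (L : List (Fin I.m)) (x y : Fin I.n) :
    RawCon (L.map I.raw) x y ↔ I.net.con (vset L) x y := by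
  constructor
  · intro h
    -- Raw walks range over all natural numbers, but nontrivial ones stay on vertices of the
    -- instance.
    have key : ∀ a b, RawCon (L.map I.raw) a b → (a = b ∨ ∃ x y : Fin I.n, a = x ∧ b = y ∧
        I.net.con (vset L) x y) := by
      intro a b h
      induction h with
      | rel a b hab =>
        obtain ⟨r, hr, hab⟩ := hab
        obtain ⟨e, he, rfl⟩ := List.mem_map.1 hr
        cases hab
        exact Or.inr ⟨_, _, rfl, rfl, con_edge he⟩
      | refl a => exact Or.inl rfl
      | symm a b _ ih =>
        rcases ih with rfl | ⟨x, y, rfl, rfl, h⟩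
        · exact Or.inl rfl
        · exact Or.inr ⟨_, _, rfl, rfl, h.symm⟩
      | trans a b c _ _ ih ih' =>
        rcases ih with rfl | ⟨x, y, rfl, rfl, h⟩
        · exact ih'
        · rcases ih' with rfl | ⟨y', z, hy, rfl, h'⟩
          · exact Or.inr ⟨_, _, rfl, rfl, h⟩
          · obtain rfl := Fin.ext hy
            exact Or.inr ⟨_, _, rfl, rfl, h.trans h'⟩
    rcases key _ _ h with h | ⟨x', y', hx, hy, h⟩
    · rw [Fin.ext h]; exact con_refl _
    · rwa [Fin.ext hx, Fin.ext hy]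
  · intro h
    induction h with
    | rel a b hab =>
      obtain ⟨e, he, hab⟩ := hab
      refine .rel _ _ ⟨I.raw e, List.mem_map.2 ⟨e, he, rfl⟩, ?_⟩
      change I.ends e = _ at hab
      simp [Inst.raw, hab]
    | refl a => exact .refl _
    | symm a b _ ih => exact .symm _ _ ih
    | trans a b c _ _ ih ih' => exact .trans _ _ _ ih ih'

theorem spec_conn : ∃ T, PolyBd T ∧ ∀ (I : Inst) (N : ℕ), I.Sz N → ∀ (L : List (Fin I.m))
    (x y : Fin I.n), L.length ≤ N →
    FnB prog 7 (.node (I.eEs L) (.node (eV x) (eV y))) (I.net.con (vset L) x y) (T N) := by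
  refine ⟨fun N => ((40 * (N + 1) + 100) * (N + 1) + 60 * (N + 1) + 150) * (N + 1), by fun_prop,
    fun I N h L x y hL => ?_⟩
  have hn : ∀ z : Fin I.n, (z : ℕ) ≤ N := fun z => by have := h.n; omega
  rw [I.eEs_eq]
  refine ((fn_rawCon (N := N) ?_ (hn x) (hn y) (by simpa using hL)).congr
    (I.rawCon_iff L x y)).mono (Nat.mul_le_mul_left _ (by simpa using hL))
  intro r hr
  obtain ⟨e, -, rfl⟩ := List.mem_map.1 hr
  exact ⟨hn _, hn _⟩

/-! ### Forests of odd cacti -/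

theorem spec_bridge : ∃ T, PolyBd T ∧ ∀ (I : Inst) (N : ℕ), I.Sz N → ∀ (L : List (Fin I.m))
    (x y : Fin I.n) (f : Fin I.m), L.length ≤ N →
    FnB prog 10 (.node (.node (I.eEs L) (.node (eV x) (eV y))) (I.eE f))
      (¬ I.net.con (vset (sel (f ≠ ·) L)) x y) (T N) := by
  obtain ⟨T, hT, hc⟩ := spec_conn
  obtain ⟨T', hT', hd⟩ := spec_delE
  refine ⟨fun N => T N + T' N + 100, by fun_prop, fun I N h L x y f hL => ?_⟩
  exact FnB.intro rfl ((EvB.not (.call (.node (.call (.node (.snd (.var rfl))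
    (.fst (.fst (.var rfl)))) (hd I N h f L hL)) (.snd (.fst (.var rfl))))
    (hc I N h _ x y (length_sel_le.trans hL)))).mono (by beta_reduce; omega))

theorem spec_bridges : ∃ T, PolyBd T ∧ ∀ (I : Inst) (N : ℕ), I.Sz N → ∀ (L : List (Fin I.m))
    (x y : Fin I.n), L.length ≤ N →
    Fn prog 11 (.node (.node (I.eEs L) (.node (eV x) (eV y))) (I.eEs L))
      (I.eEs (sel (fun f => ¬ I.net.con (vset (sel (f ≠ ·) L)) x y) L)) (T N) := by
  obtain ⟨T, hT, hb⟩ := spec_bridge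
  exact ⟨_, by fun_prop, fun I N h L x y hL => fn_filter_le rfl hL fun f _ => hb I N h L x y f hL⟩

theorem fn_parity (I : Inst) (L : List (Fin I.m)) :
    FnB prog 12 (I.eEs L) (Odd (L.map I.net.wt).sum) (40 * (L.length + 1)) := by
  induction L with
  | nil => exact FnB.intro rfl ((EvB.case_nil (.var rfl) (.nil (by simp))).mono (by simp))
  | cons e L ih =>
    simp only [List.map_cons, List.sum_cons, List.length_cons]
    have hw : I.net.wt e = 0 ∨ I.net.wt e = 1 := by
      have := (I.weight e).isLt
      change (I.weight e : ℕ) = 0 ∨ (I.weight e : ℕ) = 1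
      omega
    rcases hw with hw | hw
    · have hd : encNat (I.weight e) = .nil := by
        change (I.weight e : ℕ) = 0 at hw
        rw [hw]; rfl
      refine FnB.intro rfl ((EvB.case_node (.var rfl) (.case_nil (s := 7) ?_
        (.call (.var rfl) (ih.congr (by rw [hw, zero_add]))))).mono (by omega))
      have := Ev.snd (P := prog) (.snd (.snd (.var (i := 0) (env :=
        [I.eE e, I.eEs L, .node (I.eE e) (I.eEs L)]) rfl)))
      exact hd ▸ this
    · have hd : encNat (I.weight e) = .node .nil .nil := by
        change (I.weight e : ℕ) = 1 at hw
        rw [hw]; rfl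
      refine FnB.intro rfl ((EvB.case_node (.var rfl) (.case_node (x := .nil) (z := .nil) (s := 7)
        ?_
        ((EvB.not (.call (.var rfl) ih)).congr ?_))).mono (by omega))
      · have := Ev.snd (P := prog) (.snd (.snd (.var (i := 0) (env :=
          [I.eE e, I.eEs L, .node (I.eE e) (I.eEs L)]) rfl)))
        exact hd ▸ this
      · rw [hw, Nat.odd_add]
        simp

theorem vset_delE {m : ℕ} (e : Fin m) (L : List (Fin m)) :
    vset (sel (e ≠ ·) L) = vset L \ {e} := by
  ext f; simp [vset, eq_comm]

theorem spec_viol : ∃ T, PolyBd T ∧ ∀ (I : Inst) (N : ℕ), I.Sz N → ∀ (L : List (Fin I.m))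
    (e : Fin I.m), L.length ≤ N → L.Nodup → FnB prog 13 (.node (I.eEs L) (I.eE e))
      (¬ I.net.GoodAt (vset L) e) (T N) := by
  obtain ⟨T, hT, hc⟩ := spec_conn
  obtain ⟨T', hT', hd⟩ := spec_delE
  obtain ⟨T'', hT'', hb⟩ := spec_bridges
  refine ⟨fun N => 2 * T N + T' N + T'' N + 40 * (N + 2) + 200, by fun_prop,
    fun I N h L e hL hnd => ?_⟩
  set L' := sel (e ≠ ·) L with hL'
  set u := (I.ends e).1 with hu
  set v := (I.ends e).2 with hv
  set B := sel (fun f => ¬ I.net.con (vset (sel (f ≠ ·) L')) u v) L' with hB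
  have hl' : L'.length ≤ N := length_sel_le.trans hL
  have hBl : B.length ≤ N := length_sel_le.trans hl'
  have hL'v : vset L' = vset L \ {e} := vset_delE e L
  have hBv : vset B = I.net.bri (vset L) e := by
    ext f
    have hef : vset (sel (f ≠ ·) L') = vset L \ {e, f} := by
      rw [vset_delE, hL'v, Set.sdiff_sdiff]; rfl
    rw [hB, mem_vset, mem_sel, hef, ← mem_vset, hL'v]
    exact and_assoc
  -- Here the list must be free of repetitions, so that its sum counts every forced edge once.
  have hsum : ∑ᶠ f ∈ I.net.bri (vset L) e, I.net.wt f = (B.map I.net.wt).sum := by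
    have hBn : B.Nodup := (hnd.sublist sel_sublist).sublist sel_sublist
    rw [← hBv, finsum_mem_eq_finite_toFinset_sum _ (Set.toFinite _), ← List.sum_toFinset _ hBn]
    congr 1
    ext f
    simp [mem_vset]
  have hG : I.net.GoodAt (vset L) e ↔ (I.net.con (vset L') u v → I.net.con (vset B) u v ∧
      Odd ((e :: B).map I.net.wt).sum) := by
    rw [Net.GoodAt, hsum, ← hBv, hL'v]
    rfl
  rw [hG]
  refine FnB.intro rfl (EvB.mono (EvB.bind (.call (.node (.snd (.var rfl)) (.fst (.var rfl)))
    (hd I N h e L hL)) (.bind (.node (.fst (.snd (.snd (.var rfl))))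
    (.fst (.snd (.snd (.snd (.var rfl)))))) (.ite (t := T N + T'' N + 40 * (N + 2) + 100)
      (.call (.node (.var rfl) (.var rfl)) (hc I N h L' u v hl')) (fun hn => ?_)
      (fun hp _ _ => ?_)))) ?_)
  · exact (EvB.nil (by simp [hn])).mono (by omega)
  · refine EvB.mono (EvB.bind (.call (.node (.node (.var rfl) (.var rfl)) (.var rfl))
      (hb I N h L' u v hl')) (.ite (t := 40 * (N + 2) + 30) (.call (.node (.var rfl) (.var rfl))
        (hc I N h B u v hBl)) (fun hn => ?_) (fun hp' _ _ => ?_))) ?_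
    · exact (EvB.tt (by simp [hp, hn])).mono (by omega)
    · refine ((EvB.not (.call (.node (.snd (.var rfl)) (.var rfl))
        (fn_parity I (e :: B)))).congr (by simp [hp, hp'])).mono ?_
      have : (e :: B).length + 1 ≤ N + 2 := by simpa using hBl
      omega
    · omega
  · beta_reduce; omega

theorem spec_bad : ∃ T, PolyBd T ∧ ∀ (I : Inst) (N : ℕ), I.Sz N → ∀ (A : List (Fin I.n)),
    A.length ≤ N → FnB prog 15 (.node (eVs A) I.eG) (¬ I.net.Good (I.net.ind (vset A))) (T N) := by
  obtain ⟨T, hT, hv⟩ := spec_viol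
  obtain ⟨T', hT', hr⟩ := spec_restrict
  refine ⟨fun N => (T N + 25) * (N + 1) + T' N + 100, by fun_prop, fun I N h A hA => ?_⟩
  have hl := length_inside_le h (A := A)
  have hn : (I.inside A (List.finRange I.m)).Nodup := (List.nodup_finRange _).sublist sel_sublist
  refine FnB.intro rfl (EvB.mono (EvB.bind (.call (.var rfl)
    (hr I N h A _ hA (by simpa using h.m))) (.call (.node (.var rfl) (.var rfl))
    ((fn_filter_le rfl hl fun e _ => hv I N h _ e hl hn).toB ?_))) ?_)
  · rw [encL_ne_nil, sel_ne_nil, vset_inside]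
    simp only [← mem_vset (A := I.inside A _), vset_inside, Net.Good]
    push Not
    rfl
  · beta_reduce; omega

theorem spec_connIn : ∃ T, PolyBd T ∧ ∀ (I : Inst) (N : ℕ), I.Sz N → ∀ (A : List (Fin I.n))
    (x y : Fin I.n), A.length ≤ N → FnB prog 16 (.node (.node (eVs A) I.eG) (.node (eV x) (eV y)))
      (I.net.con (I.net.ind (vset A)) x y) (T N) := by
  obtain ⟨T, hT, hc⟩ := spec_conn
  obtain ⟨T', hT', hr⟩ := spec_restrict
  refine ⟨fun N => T N + T' N + 100, by fun_prop, fun I N h A x y hA => ?_⟩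
  refine FnB.intro rfl (EvB.mono (EvB.call (.node (.call (.fst (.var rfl))
    (hr I N h A _ hA (by simpa using h.m))) (.snd (.var rfl)))
    (hc I N h _ x y (length_inside_le h))) ?_) |>.congr (by rw [vset_inside])
  beta_reduce; omega

end EvenCycle

namespace EvenCycle

open TreeMachine Net

/-! ### Regions -/

theorem spec_reach : ∃ T, PolyBd T ∧ ∀ (I : Inst) (N : ℕ), I.Sz N → ∀ (L : List (Fin I.m))
    (w z : Fin I.n), L.length ≤ N → FnB prog 17 (.node (.node (I.eEs L) (eV w)) (eV z))
      (I.net.con (vset L) w z) (T N) := by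
  obtain ⟨T, hT, hc⟩ := spec_conn
  refine ⟨fun N => T N + 100, by fun_prop, fun I N h L w z hL => ?_⟩
  exact FnB.intro rfl (EvB.mono (EvB.call (.node (.fst (.fst (.var rfl)))
    (.node (.snd (.fst (.var rfl))) (.snd (.var rfl)))) (hc I N h L w z hL))
    (by beta_reduce; omega))

theorem spec_reached : ∃ T, PolyBd T ∧ ∀ (I : Inst) (N : ℕ), I.Sz N → ∀ (L : List (Fin I.m))
    (w : Fin I.n) (A : List (Fin I.n)), L.length ≤ N → A.length ≤ N →
    Fn prog 18 (.node (.node (I.eEs L) (eV w)) (eVs A)) (eVs (sel (I.net.con (vset L) w) A))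
      (T N) := by
  obtain ⟨T, hT, hr⟩ := spec_reach
  exact ⟨fun N => (T N + 25) * (N + 1), by fun_prop,
    fun I N h L w A hL hA => fn_filter_le rfl hA fun z _ => hr I N h L w z hL⟩

theorem spec_notMem : ∃ T, PolyBd T ∧ ∀ (I : Inst) (N : ℕ), I.Sz N → ∀ (A : List (Fin I.n))
    (x : Fin I.n), A.length ≤ N → FnB prog 19 (.node (eVs A) (eV x)) (x ∉ A) (T N) := by
  obtain ⟨T, hT, hm⟩ := spec_mem
  refine ⟨fun N => T N + 100, by fun_prop, fun I N h A x hA => ?_⟩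
  exact FnB.intro rfl (EvB.mono (EvB.not (.call (.node (.snd (.var rfl)) (.fst (.var rfl)))
    (hm I N h x A hA))) (by beta_reduce; omega))

theorem spec_diff : ∃ T, PolyBd T ∧ ∀ (I : Inst) (N : ℕ), I.Sz N → ∀ A L : List (Fin I.n),
    A.length ≤ N → L.length ≤ N →
    Fn prog 20 (.node (eVs A) (eVs L)) (eVs (sel (· ∉ A) L)) (T N) := by
  obtain ⟨T, hT, hm⟩ := spec_notMem
  exact ⟨fun N => (T N + 25) * (N + 1), by fun_prop,
    fun I N h A L hA hL => fn_filter_le rfl hL fun z _ => hm I N h A z hA⟩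

/-- Adjacency to a component becomes a connectivity query, which the program can already answer: add
`z` and ask whether it is reached from `w`. -/
theorem Net.mem_nb_comp_iff {V β : Type*} {N : Net V β} {A D : Set V} {w z : V} (hw : w ∈ D)
    (hz : z ∈ A) : z ∈ N.nb A (N.comp D w) ↔
      z ∉ N.comp D w ∧ N.con (N.ind (insert z (N.comp D w))) w z := by
  constructor
  · rintro ⟨-, hzP, p, hp, hpz⟩
    exact ⟨hzP, ((con_comp hp).mono (ind_mono (Set.subset_insert _ _))).trans
      (hpz.con (Or.inr hp) (Or.inl rfl))⟩
  · rintro ⟨hzP, hc⟩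
    refine ⟨hz, hzP, ?_⟩
    by_contra hno
    push Not at hno
    refine hzP (hc.mem_of_closed (mem_comp_self hw) fun x hx x' hx' hxx' => ?_)
    rcases hx' with rfl | hx'
    · exact absurd hxx' (hno x hx)
    · exact hx'

theorem spec_nbr : ∃ T, PolyBd T ∧ ∀ (I : Inst) (N : ℕ), I.Sz N → ∀ (P : List (Fin I.n))
    (w z : Fin I.n), P.length + 1 ≤ N →
    FnB prog 21 (.node (.node I.eG (.node (eVs P) (eV w))) (eV z))
      (z ∉ P ∧ I.net.con (I.net.ind (insert z (vset P))) w z) (T N) := by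
  obtain ⟨T, hT, hm⟩ := spec_mem
  obtain ⟨T', hT', hc⟩ := spec_connIn
  refine ⟨fun N => T N + T' N + 200, by fun_prop, fun I N h P w z hP => ?_⟩
  refine FnB.intro rfl (EvB.mono (EvB.ite (t := T' N + 100) (.call (.node (.snd (.var rfl))
    (.fst (.snd (.fst (.var rfl))))) (hm I N h z P (by omega))) (fun hn => ?_)
    (fun hp _ _ => ?_)) ?_)
  · refine ((EvB.call (.node (.node (.node (.snd (.var rfl)) (.fst (.snd (.fst (.var rfl)))))
      (.fst (.fst (.var rfl)))) (.node (.snd (.snd (.fst (.var rfl)))) (.snd (.var rfl))))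
      (hc I N h (z :: P) w z (by simpa using hP))).congr ?_).mono (by omega)
    rw [vset_cons]
    simp [hn]
  · exact (EvB.nil (by simp [hp])).mono (by omega)
  · beta_reduce; omega

theorem spec_nbrs : ∃ T, PolyBd T ∧ ∀ (I : Inst) (N : ℕ), I.Sz N → ∀ (P A : List (Fin I.n))
    (w : Fin I.n), P.length + 1 ≤ N → A.length ≤ N →
    Fn prog 22 (.node (.node I.eG (.node (eVs P) (eV w))) (eVs A))
      (eVs (sel (fun z => z ∉ P ∧ I.net.con (I.net.ind (insert z (vset P))) w z) A)) (T N) := by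
  obtain ⟨T, hT, hm⟩ := spec_nbr
  exact ⟨fun N => (T N + 25) * (N + 1), by fun_prop,
    fun I N h P A w hP hA => fn_filter_le rfl hA fun z _ => hm I N h P w z hP⟩

/-- The condition on the vertex `y` in the definition of `Net.Minor`. -/
def Net.Dom {V β : Type*} (N : Net V β) (P M : Set V) (y : V) : Prop :=
  y ∈ M ∧ (M \ {y}).Subsingleton ∧ N.Good (N.ind (P ∪ (M \ {y})))

theorem vset_del {V : Type*} (y : V) (M : List V) : vset (sel (· ∉ [y]) M) = vset M \ {y} := by
  ext f; simp [vset]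

theorem spec_dom : ∃ T, PolyBd T ∧ ∀ (I : Inst) (N : ℕ), I.Sz N → ∀ (P M : List (Fin I.n))
    (y : Fin I.n), P.length + 1 ≤ N → M.length ≤ N → M.Nodup →
    FnB prog 23 (.node (.node I.eG (.node (eVs P) (eVs M))) (eV y))
      (I.net.Dom (vset P) (vset M) y) (T N) := by
  obtain ⟨T, hT, hm⟩ := spec_mem
  obtain ⟨T', hT', hd⟩ := spec_diff
  obtain ⟨T'', hT'', hb⟩ := spec_bad
  refine ⟨fun N => T N + T' N + T'' N + 300, by fun_prop, fun I N h P M y hP hM hnd => ?_⟩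
  have hDom : I.net.Dom (vset P) (vset M) y ↔ y ∈ M ∧ (vset (sel (· ∉ [y]) M)).Subsingleton ∧
      I.net.Good (I.net.ind (vset P ∪ vset (sel (· ∉ [y]) M))) := by
    rw [vset_del]; rfl
  rw [hDom]
  have hnd' : (sel (· ∉ [y]) M).Nodup := hnd.sublist sel_sublist
  refine FnB.intro rfl (EvB.mono (EvB.ite (t := T' N + T'' N + 200) (.call (.node (.snd (.var rfl))
    (.snd (.snd (.fst (.var rfl))))) (hm I N h y M hM)) (fun hn => ?_)
    (fun hp _ _ => ?_)) ?_)
  · exact (EvB.nil (by simp [hn])).mono (by omega)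
  · have hdy := hd I N h [y] M (by simp; omega) hM
    generalize hO : sel (· ∉ [y]) M = O at hdy hnd' ⊢
    refine EvB.mono (EvB.bind (.call (.node (.node (.snd (.var rfl)) .nil)
      (.snd (.snd (.fst (.var rfl))))) hdy) (t := T'' N + 100) ?_) (by omega)
    -- `O` lists the neighbours other than `y`: none, one, or at least two, and two are distinct
    -- because the list has no repetitions.
    rcases O with _ | ⟨a, _ | ⟨b, O⟩⟩
    · refine ((EvB.case_nil (.var rfl) (.not (.call (.node (.fst (.snd (.fst (.var rfl))))
        (.fst (.fst (.var rfl)))) (hb I N h P (by omega))))).congr ?_).mono (by omega)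
      simp [hp, vset]
    · refine ((EvB.case_node (.var rfl) (.case_nil (.var rfl) (.not (.call (.node
        (.node (.var rfl) (.fst (.snd (.fst (.var rfl))))) (.fst (.fst (.var rfl))))
        (hb I N h (a :: P) (by simpa using hP)))))).congr ?_).mono (by omega)
      have hU : vset (a :: P) = vset P ∪ vset [a] := by
        rw [vset_cons, Set.insert_eq, Set.union_comm]; congr 1; ext; simp [vset]
      rw [hU]
      simp [hp, vset]
    · refine (EvB.case_node (.var rfl) (.case_node (.var rfl) (.nil ?_))).mono (by omega)
      rintro ⟨-, hs, -⟩
      have := hs (x := a) (by simp [vset]) (y := b) (by simp [vset])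
      simp [this] at hnd'
  · beta_reduce; omega

theorem spec_doms : ∃ T, PolyBd T ∧ ∀ (I : Inst) (N : ℕ), I.Sz N → ∀ (P M U : List (Fin I.n)),
    P.length + 1 ≤ N → M.length ≤ N → M.Nodup → U.length ≤ N →
    Fn prog 24 (.node (.node I.eG (.node (eVs P) (eVs M))) (eVs U))
      (eVs (sel (I.net.Dom (vset P) (vset M)) U)) (T N) := by
  obtain ⟨T, hT, hm⟩ := spec_dom
  exact ⟨fun N => (T N + 25) * (N + 1), by fun_prop, fun I N h P M U hP hM hnd hU =>
    fn_filter_le rfl hU fun z _ => hm I N h P M z hP hM hnd⟩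

theorem spec_inReg : ∃ T, PolyBd T ∧ ∀ (I : Inst) (N : ℕ), I.Sz N → ∀ (S F U : List (Fin I.n))
    (w : Fin I.n), (S ++ F).Nodup → U.length ≤ N → w ∈ F →
    FnB prog 25 (.node (.node I.eG (.node (eVs (S ++ F)) (.node (eVs U)
      (.node (eVs (sel (· ∉ U) F)) (I.eEs (I.inside (sel (· ∉ U) F) (List.finRange I.m)))))))
        (eV w)) (w ∈ I.net.reg (vset S) (vset F) (vset U)) (T N) := by
  obtain ⟨T1, hT1, h1⟩ := spec_mem
  obtain ⟨T2, hT2, h2⟩ := spec_reached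
  obtain ⟨T3, hT3, h3⟩ := spec_nbrs
  obtain ⟨T4, hT4, h4⟩ := spec_doms
  refine ⟨fun N => T1 N + T2 N + T3 N + T4 N + 500, by fun_prop,
    fun I N h S F U w hnd hU hw => ?_⟩
  set D := sel (· ∉ U) F with hD
  have hlen : ∀ L : List (Fin I.n), L.Nodup → L.length + 1 ≤ N := fun L hL =>
    (Nat.succ_le_succ (by simpa using hL.length_le_card)).trans h.n
  have hDn : D.Nodup := (List.nodup_append.1 hnd).2.1.sublist sel_sublist
  have hDv : vset D = vset F \ vset U := by ext; simp [hD, vset]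
  refine FnB.intro rfl (EvB.mono (EvB.ite (t := T2 N + T3 N + T4 N + 400) (.call
    (.node (.snd (.var rfl)) (.fst (.snd (.snd (.fst (.var rfl)))))) (h1 I N h w U hU))
    (fun hn => ?_) (fun hp _ _ => ?_)) ?_)
  · have hwD : w ∈ vset D := by simp [hD, vset, hw, hn]
    have hPv : vset (sel (I.net.con (vset (I.inside D (List.finRange I.m))) w) D) =
        I.net.comp (vset F \ vset U) w := by
      rw [vset_sel, vset_inside, ← hDv]; rfl
    have hPn := hDn.sublist (sel_sublist (p := I.net.con (vset (I.inside D (List.finRange I.m))) w))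
    have hr := h2 I N h (I.inside D (List.finRange I.m)) w D (length_inside_le h)
      (by have := hlen D hDn; omega)
    generalize sel (I.net.con (vset (I.inside D (List.finRange I.m))) w) D = P at hPv hPn hr
    have hMv : vset (sel (fun z => z ∉ P ∧ I.net.con (I.net.ind (insert z (vset P))) w z)
        (S ++ F)) = I.net.nb (vset S ∪ vset F) (I.net.comp (vset F \ vset U) w) := by
      ext z
      rw [vset_sel, ← vset_append]
      constructor
      · rintro ⟨hz, hz'⟩
        rw [Net.mem_nb_comp_iff (N := I.net) (A := vset (S ++ F)) (hDv ▸ hwD) hz, ← hPv]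
        exact hz'
      · intro hz
        refine ⟨hz.1, ?_⟩
        rw [Net.mem_nb_comp_iff (N := I.net) (hDv ▸ hwD) hz.1, ← hPv] at hz
        exact hz
    have hMn := hnd.sublist (sel_sublist (p := fun z => z ∉ P ∧
      I.net.con (I.net.ind (insert z (vset P))) w z))
    have hs := h3 I N h P (S ++ F) w (hlen P hPn) (by have := hlen _ hnd; omega)
    generalize sel (fun z => z ∉ P ∧ I.net.con (I.net.ind (insert z (vset P))) w z) (S ++ F) = M
      at hMv hMn hs
    refine ((EvB.bind (.call (.node (.node (.snd (.snd (.snd (.snd (.fst (.var rfl))))))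
      (.snd (.var rfl))) (.fst (.snd (.snd (.snd (.fst (.var rfl))))))) hr) (.bind
      (.call (.node (.node (.fst (.fst (.var rfl))) (.node (.var rfl) (.snd (.var rfl))))
        (.fst (.snd (.fst (.var rfl))))) hs) (.call (.node (.node (.fst (.fst (.var rfl)))
        (.node (.var rfl) (.var rfl))) (.fst (.snd (.snd (.fst (.var rfl))))))
        ((h4 I N h P M U (hlen P hPn) (by have := hlen M hMn; omega) hMn hU).toB
          encL_ne_nil)))).congr ?_).mono (by omega)
    rw [sel_ne_nil, hPv, hMv]
    constructor
    · rintro ⟨y, hy, hd⟩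
      exact ⟨hw, Or.inr ⟨y, hy, hd⟩⟩
    · rintro ⟨-, h | ⟨y, hy, hd⟩⟩
      · exact absurd h hn
      · exact ⟨y, hy, hd⟩
  · exact (EvB.tt ⟨hw, Or.inl hp⟩).mono (by omega)
  · beta_reduce; omega

theorem fn_append {α : Type*} (enc : α → Data) (A B : List α) :
    Fn prog 28 (.node (encL enc A) (encL enc B)) (encL enc (A ++ B)) (20 * (A.length + 1)) := by
  induction A with
  | nil => exact Fn.intro rfl ((Ev.case_nil (.fst (.var rfl)) (.snd (.var rfl))).mono (by simp))
  | cons x A ih =>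
    exact Fn.intro rfl ((Ev.case_node (.fst (.var rfl)) (.node (.var rfl) (.call
      (.node (.var rfl) (.snd (.var rfl))) ih))).mono (by simp; omega))

/-- The region of `U`, as a list. -/
noncomputable def Inst.region (I : Inst) (S F U : List (Fin I.n)) : List (Fin I.n) :=
  sel (· ∈ I.net.reg (vset S) (vset F) (vset U)) F

theorem spec_region : ∃ T, PolyBd T ∧ ∀ (I : Inst) (N : ℕ), I.Sz N → ∀ (S F U : List (Fin I.n)),
    (S ++ F).Nodup → U.length ≤ N →
    Fn prog 27 (.node (.node I.eG (.node (eVs S) (eVs F))) (eVs U)) (eVs (I.region S F U))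
      (T N) := by
  obtain ⟨T1, hT1, h1⟩ := spec_diff
  obtain ⟨T2, hT2, h2⟩ := spec_restrict
  obtain ⟨T3, hT3, h3⟩ := spec_inReg
  refine ⟨fun N => T1 N + T2 N + (T3 N + 25) * (N + 1) + 20 * (N + 1) + 500, by fun_prop,
    fun I N h S F U hnd hU => ?_⟩
  have hl : S.length + F.length + 1 ≤ N := by
    rw [← List.length_append]
    exact (Nat.succ_le_succ (by simpa using hnd.length_le_card)).trans h.n
  have hF : F.length ≤ N := by omega
  refine Fn.intro rfl (Ev.mono (Ev.bind (.call (.node (.snd (.var rfl))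
    (.snd (.snd (.fst (.var rfl))))) (h1 I N h U F hU hF)) (.bind
    (.call (.node (.var rfl) (.fst (.fst (.var rfl))))
      (h2 I N h _ _ (length_sel_le.trans hF) (by simpa using h.m)))
    (.call (.node (.node (.fst (.fst (.var rfl))) (.node
      (.call (.node (.fst (.snd (.fst (.var rfl)))) (.snd (.snd (.fst (.var rfl)))))
        ((fn_append eV S F).mono (Nat.mul_le_mul_left 20 (show S.length + 1 ≤ N + 1 by omega))))
        (.node (.snd (.var rfl)) (.node (.var rfl) (.var rfl)))))
      (.snd (.snd (.fst (.var rfl))))) (fn_filter_le rfl hF fun w hw =>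
        h3 I N h S F U w hnd hU hw)))) ?_)
  beta_reduce; omega

end EvenCycle

namespace EvenCycle

open TreeMachine Net

/-! ### The test for branching sets -/

theorem vset_region {I : Inst} {S F U : List (Fin I.n)} :
    vset (I.region S F U) = I.net.reg (vset S) (vset F) (vset U) := by
  rw [Inst.region, vset_sel]
  exact Set.ext fun _ => ⟨fun h => h.2, fun h => ⟨reg_subset (N := I.net) h, h⟩⟩

theorem length_of_nodup {I : Inst} {N : ℕ} (h : I.Sz N) {L : List (Fin I.n)} (hL : L.Nodup) :
    L.length + 1 ≤ N :=
  (Nat.succ_le_succ (by simpa using hL.length_le_card)).trans h.n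

theorem nodup_append_region {I : Inst} {S F U : List (Fin I.n)} (h : (S ++ F).Nodup) :
    (S ++ I.region S F U).Nodup :=
  h.sublist (List.Sublist.append (List.Sublist.refl S) sel_sublist)

theorem spec_attached : ∃ T, PolyBd T ∧ ∀ (I : Inst) (N : ℕ), I.Sz N → ∀ (R : List (Fin I.n))
    (p s : Fin I.n), R.length + 1 ≤ N →
    FnB prog 29 (.node (.node I.eG (.node (eVs R) (eV p))) (eV s))
      (I.net.con (I.net.ind (insert s (vset R))) p s) (T N) := by
  obtain ⟨T, hT, hc⟩ := spec_connIn
  refine ⟨fun N => T N + 100, by fun_prop, fun I N h R p s hR => ?_⟩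
  rw [← vset_cons]
  exact FnB.intro rfl ((EvB.call (.node (.node (.node (.snd (.var rfl))
    (.fst (.snd (.fst (.var rfl))))) (.fst (.fst (.var rfl)))) (.node (.snd (.snd
    (.fst (.var rfl)))) (.snd (.var rfl)))) (hc I N h (s :: R) p s (by simpa using hR))).mono
    (by beta_reduce; omega))

theorem spec_att : ∃ T, PolyBd T ∧ ∀ (I : Inst) (N : ℕ), I.Sz N → ∀ (R S : List (Fin I.n))
    (p : Fin I.n), R.length + 1 ≤ N → S.length ≤ N →
    Fn prog 30 (.node (.node I.eG (.node (eVs R) (eV p))) (eVs S))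
      (eVs (sel (fun s => I.net.con (I.net.ind (insert s (vset R))) p s) S)) (T N) := by
  obtain ⟨T, hT, ha⟩ := spec_attached
  exact ⟨fun N => (T N + 25) * (N + 1), by fun_prop, fun I N h R S p hR hS =>
    fn_filter_le rfl hS fun s _ => ha I N h R p s hR⟩

theorem spec_notReached : ∃ T, PolyBd T ∧ ∀ (I : Inst) (N : ℕ), I.Sz N → ∀ (L : List (Fin I.m))
    (w : Fin I.n) (A : List (Fin I.n)), L.length ≤ N → A.length ≤ N →
    Fn prog 32 (.node (.node (I.eEs L) (eV w)) (eVs A))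
      (eVs (sel (fun z => ¬ I.net.con (vset L) w z) A)) (T N) := by
  obtain ⟨T, hT, hr⟩ := spec_reach
  refine ⟨fun N => (T N + 10 + 25) * (N + 1), by fun_prop,
    fun I N h L w A hL hA => fn_filter_le rfl hA fun z _ => ?_⟩
  exact FnB.intro rfl ((EvB.not (.call (.var rfl) (hr I N h L w z hL))).mono (by omega))

theorem spec_test : ∃ T, PolyBd T ∧ ∀ (I : Inst) (N : ℕ), I.Sz N → ∀ S F U : List (Fin I.n),
    (S ++ F).Nodup → U.length ≤ N →
    FnB prog 33 (.node (.node I.eG (.node (eVs S) (eVs F))) (eVs U))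
      (I.net.Test (vset S) (vset F) U) (T N) := by
  obtain ⟨T1, hT1, h1⟩ := spec_region
  obtain ⟨T2, hT2, h2⟩ := spec_bad
  obtain ⟨T3, hT3, h3⟩ := spec_att
  obtain ⟨T4, hT4, h4⟩ := spec_connIn
  obtain ⟨T5, hT5, h5⟩ := spec_restrict
  obtain ⟨T6, hT6, h6⟩ := spec_notReached
  refine ⟨fun N => T1 N + T2 N + T3 N + T4 N + T5 N + T6 N + 20 * (N + 1) + 500, by fun_prop,
    fun I N h S F U hnd hU => ?_⟩
  have hr := h1 I N h S F U hnd hU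
  have hSR := nodup_append_region (U := U) hnd
  rw [Net.Test, ← vset_region, ← vset_append]
  generalize I.region S F U = R at hr hSR
  have hl := length_of_nodup h hSR
  rw [List.length_append] at hl
  have hS : S.length ≤ N := by omega
  have ha := (fn_append eV S R).mono (Nat.mul_le_mul_left 20 (show S.length + 1 ≤ N + 1 by omega))
  refine FnB.intro rfl (EvB.mono (EvB.bind (.call (.var rfl) hr) (.ite
    (t := T3 N + T4 N + T5 N + T6 N + 400) (.call (.node (.call (.node
      (.fst (.snd (.fst (.var rfl)))) (.var rfl)) ha) (.fst (.fst (.var rfl))))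
      (h2 I N h (S ++ R) (Nat.le_of_succ_le (length_of_nodup h hSR)))) (fun hn => ?_)
    (fun hp _ _ => ?_))) ?_)
  · rw [not_not] at hn
    cases U with
    | nil => exact (EvB.case_nil (.snd (.var rfl)) (.nil (by simp [hn]))).mono (by omega)
    | cons p U =>
      have hO := h3 I N h R S p (by omega) hS
      have hOv : vset (sel (fun s => I.net.con (I.net.ind (insert s (vset R))) p s) S) =
          I.net.Att (vset S) (vset R) p := vset_sel
      have hOl := length_sel_le (p := fun s => I.net.con (I.net.ind (insert s (vset R))) p s)
        (L := S)
      have hOn := (List.nodup_append.1 hnd).1.sublist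
        (sel_sublist (p := fun s => I.net.con (I.net.ind (insert s (vset R))) p s))
      generalize sel (fun s => I.net.con (I.net.ind (insert s (vset R))) p s) S = O
        at hO hOv hOl hOn
      have hT : (¬ I.net.Good (I.net.ind (vset (S ++ R))) ∨
          (∃ p', p :: U = [p'] ∧ ¬ (I.net.Att (vset S) (vset R) p').Subsingleton) ∨
          (∃ p' q, p :: U = [p', q] ∧ I.net.con (I.net.ind (vset R)) p' q ∧
            ∃ a ∈ I.net.Att (vset S) (vset R) p', ∃ b ∈ I.net.Att (vset S) (vset R) p',
              ¬ I.net.con (I.net.ind (vset S)) a b)) ↔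
          ((U = [] ∧ ¬ (vset O).Subsingleton) ∨ ∃ q, U = [q] ∧ I.net.con (I.net.ind (vset R)) p q ∧
            ∃ a ∈ O, ∃ b ∈ O, ¬ I.net.con (I.net.ind (vset S)) a b) := by
        simp only [hn, not_true_eq_false, false_or, List.cons.injEq, and_assoc]
        constructor
        · rintro (⟨p', rfl, rfl, h⟩ | ⟨p', q, rfl, rfl, h⟩)
          · exact Or.inl ⟨rfl, hOv ▸ h⟩
          · exact Or.inr ⟨q, rfl, by rwa [← hOv] at h⟩
        · rintro (⟨rfl, h⟩ | ⟨q, rfl, h⟩)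
          · exact Or.inl ⟨p, rfl, rfl, hOv ▸ h⟩
          · exact Or.inr ⟨p, q, rfl, rfl, by rwa [← hOv]⟩
      refine EvB.congr ?_ hT.symm
      refine EvB.mono (EvB.case_node (.snd (.var rfl)) (.bind (.call (.node (.node
        (.fst (.fst (.var rfl))) (.node (.var rfl) (.var rfl))) (.fst (.snd (.fst (.var rfl))))) hO)
        (t := T4 N + T5 N + T6 N + 200) ?_)) (by omega)
      cases O with
      | nil =>
        exact (EvB.case_nil (.var rfl) (.nil (by simp [vset]))).mono (by omega)
      | cons a O =>
        rcases U with _ | ⟨q, _ | ⟨q', U⟩⟩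
        · refine (EvB.case_node (.var rfl) (.case_nil (.var rfl) (.of_ev (.var rfl) ?_))).mono
            (by omega)
          change eVs O ≠ .nil ↔ _
          rw [encL_ne_nil, vset_cons]
          cases O with
          | nil => simp [vset]
          | cons b O =>
            simp only [ne_eq, reduceCtorEq, not_false_eq_true, true_and, List.nil_eq,
              false_and, exists_false, or_false, true_iff]
            intro hs
            have := hs (x := a) (Or.inl rfl) (y := b) (by simp [vset])
            simp [this] at hOn
        · refine EvB.mono (EvB.case_node (.var rfl) (.case_node (.var rfl) (.case_nil (.var rfl)
            (.ite (t := T5 N + T6 N + 100) (.call (.node (.node (.var rfl) (.fst (.fst (.var rfl))))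
              (.node (.var rfl) (.var rfl))) (h4 I N h R p q (by omega))) (fun hn => ?_)
              (fun hp _ _ => ?_))))) ?_
          · exact (EvB.nil (by simp [hn])).mono (by omega)
          · refine ((EvB.call (.node (.node (.call (.node (.fst (.snd (.fst (.var rfl))))
              (.fst (.fst (.var rfl)))) (h5 I N h S _ hS (by simpa using h.m))) (.var rfl))
              (.var rfl)) ((h6 I N h _ a (a :: O) (length_inside_le h) (by omega)).toB
                encL_ne_nil)).congr ?_).mono (by omega)
            rw [sel_ne_nil, vset_inside]
            constructor
            · rintro ⟨b, hb, hab⟩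
              exact Or.inr ⟨q, rfl, hp, a, by simp, b, hb, hab⟩
            · rintro (⟨h, -⟩ | ⟨_, -, -, x, hx, y, hy, hxy⟩)
              · simp at h
              -- Comparing with the first attached vertex `a` is enough: if `a` were connected to
              -- both `x` and `y`, these would be connected to each other.
              · by_cases hax : I.net.con (I.net.ind (vset S)) a x
                · exact ⟨y, hy, fun hay => hxy (hax.symm.trans hay)⟩
                · exact ⟨x, hx, hax⟩
          · omega
        · exact (EvB.case_node (.var rfl) (.case_node (.var rfl) (.case_node (.var rfl)
            (.nil (by simp))))).mono (by omega)
  · exact (EvB.tt (Or.inl hp)).mono (by omega)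
  · beta_reduce; omega

/-! ### Candidates -/

theorem fn_consAll {α : Type*} (enc : α → Data) (U F : List α) (L : List (List α)) :
    Fn prog 35 (.node (encL enc U) (.node (encL enc F) (encL (encL enc) L)))
      (encL (encL enc) (F.map (· :: U) ++ L)) (40 * (F.length + 1)) := by
  induction F with
  | nil =>
    exact Fn.intro rfl ((Ev.case_nil (.fst (.snd (.var rfl))) (.snd (.snd (.var rfl)))).mono
      (by simp))
  | cons x F ih =>
    exact Fn.intro rfl ((Ev.case_node (.fst (.snd (.var rfl))) (.node (.node (.var rfl)
      (.fst (.var rfl))) (.call (.node (.fst (.var rfl)) (.node (.var rfl)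
        (.snd (.snd (.var rfl))))) ih))).mono (by simp; omega))

/-- The lists obtained by adding an element of `F` to an element of `Us`, followed by `L`. -/
def extendList {α : Type*} (F : List α) (Us L : List (List α)) : List (List α) :=
  Us.foldr (fun U L => F.map (· :: U) ++ L) L

theorem fn_extend {α : Type*} (enc : α → Data) (F : List α) (Us L : List (List α)) :
    Fn prog 36 (.node (encL enc F) (.node (encL (encL enc) Us) (encL (encL enc) L)))
      (encL (encL enc) (extendList F Us L)) ((40 * (F.length + 1) + 60) * (Us.length + 1)) := by
  induction Us with
  | nil =>
    exact Fn.intro rfl ((Ev.case_nil (.fst (.snd (.var rfl))) (.snd (.snd (.var rfl)))).mono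
      (by simp))
  | cons U Us ih =>
    refine Fn.intro rfl ((Ev.case_node (.fst (.snd (.var rfl))) (.call (.node (.var rfl)
      (.node (.fst (.var rfl)) (.call (.node (.fst (.var rfl)) (.node (.var rfl)
        (.snd (.snd (.var rfl))))) ih))) (fn_consAll enc U F (extendList F Us L)))).mono ?_)
    simp only [List.length_cons]
    ring_nf
    omega

theorem mem_extendList {α : Type*} {F : List α} {Us L : List (List α)} {V : List α} :
    V ∈ extendList F Us L ↔ (∃ x ∈ F, ∃ U ∈ Us, x :: U = V) ∨ V ∈ L := by
  induction Us with
  | nil => simp [extendList]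
  | cons U Us ih =>
    change V ∈ F.map (· :: U) ++ extendList F Us L ↔ _
    rw [List.mem_append, ih]
    simp only [List.mem_map, List.mem_cons]
    constructor
    · rintro (⟨x, hx, rfl⟩ | ⟨x, hx, W, hW, rfl⟩ | h)
      · exact Or.inl ⟨x, hx, U, Or.inl rfl, rfl⟩
      · exact Or.inl ⟨x, hx, W, Or.inr hW, rfl⟩
      · exact Or.inr h
    · rintro (⟨x, hx, W, rfl | hW, rfl⟩ | h)
      · exact Or.inl ⟨x, hx, rfl⟩
      · exact Or.inr (Or.inl ⟨x, hx, W, hW, rfl⟩)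
      · exact Or.inr (Or.inr h)

theorem length_extendList {α : Type*} (F : List α) (Us L : List (List α)) :
    (extendList F Us L).length = Us.length * F.length + L.length := by
  induction Us with
  | nil => simp [extendList]
  | cons U Us ih =>
    change (F.map (· :: U) ++ extendList F Us L).length = _
    rw [List.length_append, ih, List.length_map, List.length_cons]
    ring

/-- The lists with at most three elements of a given list. -/
def candList {α : Type*} (F : List α) : List (List α) :=
  extendList F (extendList F (extendList F [[]] [[]]) (extendList F [[]] [[]]))
    (extendList F (extendList F [[]] [[]]) (extendList F [[]] [[]]))

theorem mem_candList {α : Type*} {F U : List α} :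
    U ∈ candList F ↔ U.length ≤ 3 ∧ ∀ u ∈ U, u ∈ F := by
  simp only [candList, mem_extendList, List.mem_singleton]
  constructor
  · rintro (⟨x, hx, V, ⟨y, hy, W, ⟨z, hz, _, rfl, rfl⟩ | rfl, rfl⟩ |
      ⟨y, hy, _, rfl, rfl⟩ | rfl, rfl⟩ | ⟨x, hx, W, ⟨y, hy, _, rfl, rfl⟩ | rfl, rfl⟩ |
      ⟨x, hx, _, rfl, rfl⟩ | rfl) <;> simp [*]
  · rintro ⟨hl, h⟩
    rcases U with _ | ⟨x, _ | ⟨y, _ | ⟨z, _ | ⟨t, U⟩⟩⟩⟩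
    · simp
    · exact Or.inr (Or.inr (Or.inl ⟨x, h x (by simp), [], rfl, rfl⟩))
    · exact Or.inr (Or.inl ⟨x, h x (by simp), [y],
        Or.inl ⟨y, h y (by simp), [], rfl, rfl⟩, rfl⟩)
    · exact Or.inl ⟨x, h x (by simp), [y, z], Or.inl ⟨y, h y (by simp), [z],
        Or.inl ⟨z, h z (by simp), [], rfl, rfl⟩, rfl⟩, rfl⟩
    · simp only [List.length_cons] at hl; omega

theorem spec_cands : ∃ T T', PolyBd T ∧ PolyBd T' ∧ ∀ (α : Type) (enc : α → Data) (F : List α)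
    (N : ℕ), F.length ≤ N → Fn prog 41 (encL enc F) (encL (encL enc) (candList F)) (T N) ∧
      (candList F).length ≤ T' N := by
  refine ⟨fun N => (40 * (N + 1) + 60) * (1 + 1) + (40 * (N + 1) + 60) * (N + 1 + 1) +
    (40 * (N + 1) + 60) * ((N + 1) * N + (N + 1) + 1) + 100,
    fun N => ((N + 1) * N + (N + 1)) * N + ((N + 1) * N + (N + 1)), by fun_prop, by fun_prop,
    fun α enc F N hF => ?_⟩
  have hA : (extendList F [[]] [[]]).length ≤ N + 1 := by
    rw [length_extendList]; simpa using hF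
  have hb : (extendList F (extendList F [[]] [[]]) (extendList F [[]] [[]])).length ≤
      (N + 1) * N + (N + 1) := by
    rw [length_extendList]; gcongr
  refine ⟨?_, ?_⟩
  · refine Fn.intro rfl (Ev.mono (Ev.bind (.call (.node (.var rfl) (.node (.node .nil .nil)
      (.node .nil .nil))) ((fn_extend enc F [[]] [[]]).mono (T' := (40 * (N + 1) + 60) * (1 + 1))
        ?_)) (.bind (.call (.node (.var rfl) (.node (.var rfl) (.var rfl)))
        ((fn_extend enc F _ _).mono (T' := (40 * (N + 1) + 60) * (N + 1 + 1)) ?_))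
        (.call (.node (.var rfl) (.node (.var rfl) (.var rfl))) ((fn_extend enc F _ _).mono
          (T' := (40 * (N + 1) + 60) * ((N + 1) * N + (N + 1) + 1)) ?_)))) ?_)
    · exact Nat.mul_le_mul_right _ (by omega)
    · gcongr
    · gcongr
    · beta_reduce; omega
  · rw [candList, length_extendList]; beta_reduce; gcongr

theorem spec_tests : ∃ T, PolyBd T ∧ ∀ (I : Inst) (N : ℕ), I.Sz N → ∀ S F : List (Fin I.n),
    (S ++ F).Nodup →
    Fn prog 41 (eVs F) (encL eVs (candList F)) (T N) ∧
    Fn prog 34 (.node (.node I.eG (.node (eVs S) (eVs F))) (encL eVs (candList F)))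
      (encL eVs (sel (I.net.Test (vset S) (vset F)) (candList F))) (T N) := by
  obtain ⟨T1, T2, hT1, hT2, hc⟩ := spec_cands
  obtain ⟨T3, hT3, ht⟩ := spec_test
  refine ⟨fun N => T1 N + (T3 (N + 3) + 25) * (T2 N + 1), by fun_prop,
    fun I N h S F hnd => ?_⟩
  have hl := length_of_nodup h hnd
  rw [List.length_append] at hl
  obtain ⟨h1, h2⟩ := hc (Fin I.n) eV F N (by omega)
  -- Candidates may have three elements even if `N` is smaller, hence `N + 3`.
  refine ⟨h1.mono (Nat.le_add_right _ _), (fn_filter_le rfl h2 fun U hU => ht I (N + 3)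
    ⟨h.n.trans (by omega), h.m.trans (by omega)⟩ S F U hnd ?_).mono (Nat.le_add_left _ _)⟩
  have := (mem_candList.1 hU).1
  omega

/-! ### Preparation of the input -/

/-- The program lists the vertices in descending order; only completeness and the absence of
repetitions matter later. -/
theorem fn_range (n : ℕ) : ∃ L : List (Fin n), L.Nodup ∧ (∀ x, x ∈ L) ∧
    Fn prog 38 (encNat n) (eVs L) (20 * (n + 1)) := by
  induction n with
  | zero => exact ⟨[], by simp, fun x => x.elim0, Fn.intro rfl ((Ev.case_nil (.var rfl) .nil).mono
      (by simp))⟩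
  | succ n ih =>
    obtain ⟨L, hn, hL, hf⟩ := ih
    refine ⟨Fin.last n :: L.map Fin.castSucc, ?_, fun x => ?_, ?_⟩
    · rw [List.nodup_cons]
      refine ⟨?_, hn.map (Fin.castSucc_injective n)⟩
      simp only [List.mem_map, not_exists, not_and]
      exact fun x _ => x.castSucc_ne_last
    · refine Fin.lastCases (by simp) (fun x => ?_) x
      simp [hL x]
    · have he : eVs (L.map Fin.castSucc) = eVs L := by
        simp [eVs, encL, List.map_map]; rfl
      refine Fn.intro rfl (Ev.mono (Ev.case_node (.var rfl) (.node (.var rfl)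
        (.call (.var rfl) (he ▸ hf)))) ?_)
      omega

theorem fn_number {α : Type*} (enc : α → Data) (L : List α) (i : ℕ) :
    Fn prog 37 (.node (encNat i) (encL enc L))
      (encList (L.mapIdx fun j x => .node (encNat (i + j)) (enc x))) (40 * (L.length + 1)) := by
  induction L generalizing i with
  | nil => exact Fn.intro rfl ((Ev.case_nil (.snd (.var rfl)) .nil).mono (by simp))
  | cons x L ih =>
    rw [List.mapIdx_cons]
    have h : (fun j x => Data.node (encNat (i + (j + 1))) (enc x)) =
        fun j x => .node (encNat (i + 1 + j)) (enc x) := by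
      funext j x; rw [show i + (j + 1) = i + 1 + j by omega]
    simp only [h]
    exact Fn.intro rfl ((Ev.case_node (.snd (.var rfl)) (.node (.node (.fst (.var rfl)) (.var rfl))
      (.call (.node (.node .nil (.fst (.var rfl))) (.var rfl)) (ih (i + 1))))).mono
      (by simp; omega))

theorem Inst.eG_eq (I : Inst) : I.eG = encList ((List.finRange I.m).mapIdx fun j e =>
    .node (encNat (0 + j)) (I.encEdge e)) := by
  unfold Inst.eG Inst.eEs encL
  congr 1
  refine List.ext_getElem (by simp) fun j h1 h2 => ?_
  simp [Inst.eE]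

end EvenCycle

namespace EvenCycle

open TreeMachine Net

/-! ### The branching algorithm -/

/-- `out` encodes a solution for `S`, `F` and `k`, or it is `nil` and there is none. -/
def Inst.Ans (I : Inst) (S F : List (Fin I.n)) (k : ℕ) (out : Data) : Prop :=
  (∃ l : List (Fin I.n), out = .node .nil (eVs l) ∧ I.net.Sol (vset S) (vset F) k l.toFinset) ∨
  (out = .nil ∧ ∀ X, ¬ I.net.Sol (vset S) (vset F) k X)

/-- The program finds a correct answer for `S`, `F` and `k` within a given number of steps. -/
def Inst.Solves (I : Inst) (S F : List (Fin I.n)) (k : ℕ) (r : ℝ) : Prop :=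
  ∃ (out : Data) (t : ℕ), I.Ans S F k out ∧
    Fn prog 39 (.node (encNat k) (.node I.eG (.node (eVs S) (eVs F)))) out t ∧ (t : ℝ) ≤ r

theorem Net.reg_empty {V β : Type*} {N : Net V β} {S F : Set V} : N.reg S F ∅ = ∅ := by
  ext w
  simp only [Net.reg, Net.Minor, Set.mem_empty_iff_false, false_and, exists_false, or_false,
    and_false]
  exact Iff.rfl

/-- The empty set has an empty region. Nonemptiness of `U` makes every recursive call shrink `F`. -/
theorem Net.Test.ne_nil {V β : Type*} {N : Net V β} {S F : Set V} {U : List V}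
    (h : N.Test S F U) (hS : N.Good (N.ind S)) : U ≠ [] := by
  rintro rfl
  have h0 : vset ([] : List V) = ∅ := by ext; simp [vset]
  rcases h with h | ⟨p, h, -⟩ | ⟨p, q, h, -⟩
  · rw [h0, Net.reg_empty, Set.union_empty] at h
    exact h hS
  · simp at h
  · simp at h

theorem vset_diff {V : Type*} (R F : List V) : vset (sel (· ∉ R) F) = vset F \ vset R := by
  ext; simp [vset]

theorem Net.pow_mul_mu_nonneg {V β : Type*} {N : Net V β} {S F : Set V} {k : ℕ} :
    0 ≤ 6 ^ k * N.mu S F :=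
  mul_nonneg (by positivity) (zero_le_one.trans one_le_mu)

theorem spec_branch : ∃ T, PolyBd T ∧ ∀ (I : Inst) (N : ℕ), I.Sz N → ∀ (S F U : List (Fin I.n))
    (k : ℕ) (D K : ℝ), (S ++ F).Nodup → U.length ≤ N → (∀ u ∈ U, u ∈ F) →
    (∀ u ∈ U, I.Solves S (sel (· ∉ [u]) F) k D) →
    I.Solves (S ++ I.region S F U) (sel (· ∉ I.region S F U) F) (k + 1) K →
    ∃ (out : Data) (t : ℕ), I.Ans S F (k + 1) out ∧
      Fn prog 40 (.node (eVs U) (.node (eVs U) (.node (encNat k) (.node I.eG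
        (.node (eVs S) (eVs F)))))) out t ∧ (t : ℝ) ≤ U.length * (D + T N) + (K + T N) := by
  classical
  obtain ⟨T1, hT1, h1⟩ := spec_diff
  obtain ⟨T2, hT2, h2⟩ := spec_region
  refine ⟨fun N => T1 N + T2 N + 20 * (N + 1) + 500, by fun_prop,
    fun I N h S F U k D K hnd hU hUF hD hK => ?_⟩
  have hl := length_of_nodup h hnd
  rw [List.length_append] at hl
  have hR : vset (I.region S F U) ⊆ vset F := by rw [vset_region]; exact reg_subset
  have hRl : (I.region S F U).length ≤ F.length := length_sel_le
  -- Induction on the part `U'` of `U` not yet tried, while the region of the full `U` stays fixed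
  -- for the final call. The answer `nil` means that no deletion from `U'` succeeds and that every
  -- solution meets the region.
  have key : ∀ U' : List (Fin I.n), (∀ u ∈ U', u ∈ U) → ∃ (out : Data) (t : ℕ),
      ((∃ l : List (Fin I.n), out = .node .nil (eVs l) ∧
          I.net.Sol (vset S) (vset F) (k + 1) l.toFinset) ∨
        (out = .nil ∧ (∀ u ∈ U', ∀ X, ¬ I.net.Sol (vset S) (vset F \ {u}) k X) ∧
          ∀ X, I.net.Sol (vset S) (vset F) (k + 1) X → ∃ z ∈ X, z ∈ vset (I.region S F U))) ∧
      Fn prog 40 (.node (eVs U') (.node (eVs U) (.node (encNat k) (.node I.eG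
        (.node (eVs S) (eVs F)))))) out t ∧
      (t : ℝ) ≤ U'.length * (D + (T1 N + T2 N + 20 * (N + 1) + 500 : ℕ)) +
        (K + (T1 N + T2 N + 20 * (N + 1) + 500 : ℕ)) := by
    intro U' hU'
    induction U' with
    | nil =>
      obtain ⟨out, t, hout, hfn, ht⟩ := hK
      refine ⟨out, t + (T1 N + T2 N + 20 * (N + 1) + 500), ?_, ?_, ?_⟩
      · rw [Inst.Ans, vset_append, vset_diff] at hout
        rcases hout with ⟨l, rfl, hl⟩ | ⟨rfl, hX⟩
        · exact Or.inl ⟨l, rfl, ((sol_keep_iff hR).1 hl).1⟩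
        · refine Or.inr ⟨rfl, by simp, fun X hX' => ?_⟩
          by_contra hno
          push Not at hno
          exact hX X ((sol_keep_iff hR).2 ⟨hX', hno⟩)
      · refine Fn.intro rfl (Ev.mono (Ev.case_nil (.fst (.var rfl)) (.bind (.call (.node
          (.snd (.snd (.snd (.var rfl)))) (.fst (.snd (.var rfl)))) (h2 I N h S F U hnd hU))
          (.call (.node (.node .nil (.fst (.snd (.snd (.var rfl)))))
            (.node (.fst (.snd (.snd (.snd (.var rfl))))) (.node (.call (.node
              (.fst (.snd (.snd (.snd (.snd (.var rfl)))))) (.var rfl)) ((fn_append eV S _).mono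
                (Nat.mul_le_mul_left 20 (show S.length + 1 ≤ N + 1 by omega))))
              (.call (.node (.var rfl) (.snd (.snd (.snd (.snd (.snd (.var rfl)))))))
                (h1 I N h _ F (by omega) (by omega)))))) hfn))) ?_)
        omega
      · push_cast at ht ⊢
        simp only [List.length_nil, Nat.cast_zero, zero_mul, zero_add]
        linarith
    | cons u U' ih =>
      obtain ⟨out', t', hout', hfn', ht'⟩ := ih fun v hv => hU' v (by simp [hv])
      obtain ⟨out, t, hout, hfn, ht⟩ := hD u (hU' u (by simp))
      rw [Inst.Ans, vset_del] at hout
      have hcall : Ev prog [eV u, eVs U', .node (eVs (u :: U')) (.node (eVs U) (.node (encNat k)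
          (.node I.eG (.node (eVs S) (eVs F)))))]
          (.call 39 (.node (.fst (.snd (.snd (.var 2))))
          (.node (.fst (.snd (.snd (.snd (.var 2)))))
            (.node (.fst (.snd (.snd (.snd (.snd (.var 2))))))
              (.call 20 (.node (.node (.var 0) .nil)
                (.snd (.snd (.snd (.snd (.snd (.var 2))))))))))))
          out (t + T1 N + 150) :=
        (Ev.call (.node (.fst (.snd (.snd (.var rfl)))) (.node
          (.fst (.snd (.snd (.snd (.var rfl)))))
          (.node (.fst (.snd (.snd (.snd (.snd (.var rfl))))))
            (.call (.node (.node (.var rfl) .nil) (.snd (.snd (.snd (.snd (.snd (.var rfl)))))))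
              (h1 I N h [u] F (by simp; omega) (by omega)))))) hfn).mono (by omega)
      have huF : u ∈ vset F := hUF u (hU' u (by simp))
      rcases hout with ⟨l, rfl, hl⟩ | ⟨rfl, hX⟩
      · refine ⟨.node .nil (eVs (u :: l)), t + (T1 N + T2 N + 20 * (N + 1) + 500),
          Or.inl ⟨u :: l, rfl, ?_⟩, ?_, ?_⟩
        · rw [List.toFinset_cons]; exact hl.insert huF
        · refine Fn.intro rfl (Ev.mono (Ev.case_node (.fst (.var rfl)) (.case_node hcall
            (.node .nil (.node (.var rfl) (.var rfl))))) ?_)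
          omega
        · have : (0 : ℝ) ≤ t' := Nat.cast_nonneg _
          simp only [List.length_cons]
          push_cast at ht ht' ⊢
          linarith
      · refine ⟨out', t + t' + (T1 N + T2 N + 20 * (N + 1) + 500), ?_, ?_, ?_⟩
        · refine hout'.imp_right fun ⟨h0, h1, h2⟩ => ⟨h0, fun v hv => ?_, h2⟩
          rcases List.mem_cons.1 hv with rfl | hv
          · exact hX
          · exact h1 v hv
        · refine Fn.intro rfl (Ev.mono (Ev.case_node (.fst (.var rfl)) (.case_nil hcall
            (.call (.node (.var rfl) (.snd (.var rfl))) hfn'))) ?_)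
          omega
        · simp only [List.length_cons]
          push_cast at ht ht' ⊢
          linarith
  obtain ⟨out, t, hout, hfn, ht⟩ := key U fun _ h => h
  refine ⟨out, t, hout.imp_right fun ⟨h0, h1, h2⟩ => ⟨h0, fun X hX => ?_⟩, hfn, ht⟩
  obtain ⟨z, hz, hzR⟩ := h2 X hX
  rw [vset_region] at hzR
  -- By exchange, a solution meeting the region yields one that contains some `u` of `U`,
  -- contradicting the failure of the branch that deletes `u`.
  obtain ⟨X', hX', u, huX, huU⟩ := hX.exchange hUF hz hzR
  have hd : Disjoint (vset S) (vset F) :=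
    Set.disjoint_left.2 fun x hx hx' => (List.nodup_append.1 hnd).2.2 x hx x hx' rfl
  exact h1 u huU _ (hX'.erase hd huX)

/-- Induction on the length of `F`, which every recursive call shortens. The factor `2 * F.length +
1` pays for the work outside the recursive calls: each level releases `2 * T N` times the measure.
The second statement covers a keep branch in which `S` becomes bad, where the call stops at once and
the measure need not drop. -/
theorem spec_solve : ∃ T, PolyBd T ∧ ∀ (I : Inst) (N : ℕ), I.Sz N → ∀ (f : ℕ)
    (S F : List (Fin I.n)) (k : ℕ), F.length = f → (S ++ F).Nodup →
    I.net.Good (I.net.ind (vset F)) →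
    I.Solves S F k (T N * (2 * F.length + 1) * (6 ^ k * I.net.mu (vset S) (vset F))) ∧
    (¬ I.net.Good (I.net.ind (vset S)) → I.Solves S F k (T N)) := by
  obtain ⟨T1, hT1, h1⟩ := spec_bad
  obtain ⟨T2, hT2, h2⟩ := spec_tests
  obtain ⟨L, hL, hb⟩ := spec_branch
  refine ⟨fun N => 4 * L (N + 3) + 2 * T1 N + 2 * T2 N + 20 * (N + 1) + 500, by fun_prop,
    fun I N h f => ?_⟩
  beta_reduce
  -- `O` is the cost of the tests made by one call. In `p`, four overheads of `branch` are added,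
  -- for at most three deletions and one keep.
  obtain ⟨O, hO⟩ : ∃ O, O = 2 * T1 N + 2 * T2 N + 20 * (N + 1) + 500 := ⟨_, rfl⟩
  obtain ⟨p, hp⟩ : ∃ p, p = 4 * L (N + 3) + 2 * T1 N + 2 * T2 N + 20 * (N + 1) + 500 := ⟨_, rfl⟩
  rw [← hp]
  have hpO : p = 4 * L (N + 3) + O := by omega
  induction f using Nat.strong_induction_on with
  | _ f ih =>
  intro S F k hf hnd hF
  have hl := length_of_nodup h hnd
  have hSF : (S ++ F).length ≤ N := by omega
  rw [List.length_append] at hl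
  have hd : Disjoint (vset S) (vset F) :=
    Set.disjoint_left.2 fun x hx hx' => (List.nodup_append.1 hnd).2.2 x hx x hx' rfl
  have happ := (fn_append eV S F).mono (Nat.mul_le_mul_left 20 (show S.length + 1 ≤ N + 1 by omega))
  have hmu : 1 ≤ I.net.mu (vset S) (vset F) := one_le_mu
  have hp0 : (0 : ℝ) ≤ p := Nat.cast_nonneg _
  -- a single step suffices
  have hshort : I.Solves S F k p →
      I.Solves S F k (p * (2 * F.length + 1) * (6 ^ k * I.net.mu (vset S) (vset F))) := by
    rintro ⟨out, t, h1, h2, h3⟩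
    refine ⟨out, t, h1, h2, h3.trans ?_⟩
    have h6 : (1 : ℝ) ≤ 6 ^ k := one_le_pow₀ (by norm_num)
    have hf0 : (0 : ℝ) ≤ F.length := Nat.cast_nonneg _
    calc (p : ℝ) = p * 1 * 1 := by ring
      _ ≤ _ := by
        gcongr
        · linarith
        · exact one_le_mul_of_one_le_of_one_le h6 hmu
  suffices hmain : I.Solves S F k p ∨ (I.net.Good (I.net.ind (vset S)) ∧
      I.Solves S F k (p * (2 * F.length + 1) * (6 ^ k * I.net.mu (vset S) (vset F)))) from
    ⟨hmain.elim hshort fun h => h.2, fun hS => hmain.resolve_right fun h => hS h.1⟩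
  have hbad := h1 I N h (S ++ F) hSF
  have hcall : EvB prog [.node (encNat k) (.node I.eG (.node (eVs S) (eVs F)))]
      (.call 15 (.node (.call 28 (.snd (.snd (.var 0)))) (.fst (.snd (.var 0)))))
      (¬ I.net.Good (I.net.ind (vset (S ++ F)))) (T1 N + 20 * (N + 1) + 50) :=
    (EvB.call (.node (.call (.snd (.snd (.var rfl))) happ) (.fst (.snd (.var rfl)))) hbad).mono
      (by omega)
  by_cases hG : I.net.Good (I.net.ind (vset S ∪ vset F))
  · refine Or.inl ⟨.node .nil (eVs []), O, Or.inl ⟨[], rfl, ?_⟩, Fn.intro rfl (Ev.mono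
      (Ev.ite (t := 3) hcall (fun _ => .node .nil .nil) fun hn => ?_) ?_), ?_⟩
    · exact ⟨by simp, by simp, by simpa using hG⟩
    · exact absurd (vset_append ▸ hG) hn
    · omega
    · exact_mod_cast (by omega : O ≤ p)
  have hbad' : ¬ I.net.Good (I.net.ind (vset (S ++ F))) := by rwa [vset_append]
  cases k with
  | zero =>
    refine Or.inl ⟨.nil, O, Or.inr ⟨rfl, ?_⟩, Fn.intro rfl (Ev.mono
      (Ev.ite (t := 20) hcall (fun h => absurd hbad' h) fun _ _ _ => ?_) ?_), ?_⟩
    · rintro X ⟨-, hX, hX'⟩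
      obtain rfl := Finset.card_eq_zero.1 (Nat.le_zero.1 hX)
      exact hG (by simpa using hX')
    · exact (Ev.case_nil (.fst (.var rfl)) .nil).mono (by omega)
    · omega
    · exact_mod_cast (by omega : O ≤ p)
  | succ k =>
    have hbadS := h1 I N h S (by omega)
    by_cases hS : I.net.Good (I.net.ind (vset S))
    swap
    · refine Or.inl ⟨.nil, O, Or.inr ⟨rfl, ?_⟩, Fn.intro rfl (Ev.mono
        (Ev.ite (t := T1 N + 100) hcall (fun h => absurd hbad' h) fun _ _ _ => ?_) ?_), ?_⟩
      · rintro X ⟨hX, -, hX'⟩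
        refine hS (hX'.mono (ind_mono fun z hz => ⟨Or.inl hz, fun hzX => ?_⟩))
        exact Set.disjoint_left.1 hd hz (hX hzX)
      · exact (Ev.case_node (.fst (.var rfl)) (.ite (t := 1) (.call (.node
          (.fst (.snd (.snd (.var rfl)))) (.fst (.snd (.var rfl)))) hbadS)
          (fun h => absurd hS h) fun _ _ _ => .nil)).mono (by omega)
      · omega
      · exact_mod_cast (by omega : O ≤ p)
    obtain ⟨hc, ht⟩ := h2 I N h S F hnd
    obtain ⟨U, Us, hsel⟩ : ∃ U Us, sel (I.net.Test (vset S) (vset F)) (candList F) = U :: Us := by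
      obtain ⟨U, -, hU3, hUF, hU⟩ := exists_test hd (Set.toFinite _) hS hF hG
      exact List.exists_cons_of_ne_nil (sel_ne_nil.2 ⟨U, mem_candList.2 ⟨hU3, hUF⟩, hU⟩)
    have hUmem : U ∈ sel (I.net.Test (vset S) (vset F)) (candList F) := by rw [hsel]; simp
    obtain ⟨hUc, hUt⟩ := mem_sel.1 hUmem
    obtain ⟨hU3, hUF⟩ := mem_candList.1 hUc
    have hU0 := hUt.ne_nil hS
    rw [hsel] at ht
    have hfpos : 1 ≤ F.length := by
      obtain ⟨u, hu⟩ := List.exists_mem_of_ne_nil U hU0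
      exact List.length_pos_of_mem (hUF u hu)
    have hless : ∀ R : List (Fin I.n), (∃ u ∈ R, u ∈ F) →
        (sel (· ∉ R) F).length + 1 ≤ F.length := by
      rintro R ⟨u, hu, huF⟩
      refine Nat.succ_le_of_lt (lt_of_le_of_ne length_sel_le fun he => ?_)
      have : u ∈ sel (· ∉ R) F := by rw [sel_sublist.eq_of_length he]; exact huF
      exact (mem_sel.1 this).2 hu
    have hbound : ∀ {a : ℕ} {x : ℝ}, a + 1 ≤ F.length → 0 ≤ x →
        (p : ℝ) * (2 * a + 1) * x ≤ p * (2 * F.length - 1) * x := by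
      intro a x ha hx
      have : (a : ℝ) + 1 ≤ F.length := by exact_mod_cast ha
      gcongr
      linarith
    have hfr : (1 : ℝ) ≤ F.length := by exact_mod_cast hfpos
    set M := I.net.mu (vset S) (vset F) with hM
    have hnd1 : ∀ q : Fin I.n → Prop, (S ++ sel q F).Nodup := fun q =>
      hnd.sublist (List.Sublist.append (List.Sublist.refl S) sel_sublist)
    have hdel : ∀ u ∈ U, I.Solves S (sel (· ∉ [u]) F) k (p * (2 * F.length - 1) * (6 ^ k * M)) := by
      intro u hu
      have hl := hless [u] ⟨u, by simp, hUF u hu⟩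
      obtain ⟨out, t, ha, hfn, ht⟩ := (ih _ (by omega) S (sel (· ∉ [u]) F) k rfl (hnd1 _)
        (hF.mono (ind_mono fun z hz => (mem_sel.1 hz).1))).1
      refine ⟨out, t, ha, hfn, ht.trans ((hbound hl pow_mul_mu_nonneg).trans ?_)⟩
      rw [vset_del]
      have := mu_delete (N := I.net) (F := vset F) (u := u) (Set.toFinite (vset S))
      have h0 : (0 : ℝ) ≤ p * (2 * F.length - 1) := mul_nonneg hp0 (by linarith)
      gcongr
    have hRless : (sel (· ∉ I.region S F U) F).length + 1 ≤ F.length := by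
      obtain ⟨u, hu⟩ := List.exists_mem_of_ne_nil U hU0
      refine hless _ ⟨u, ?_, hUF u hu⟩
      rw [← mem_vset, vset_region]
      exact subset_reg hUF hu
    have hRnd : (S ++ I.region S F U ++ sel (· ∉ I.region S F U) F).Nodup := by
      rw [List.append_assoc, List.nodup_append]
      obtain ⟨hn1, hn2, hn3⟩ := List.nodup_append.1 hnd
      refine ⟨hn1, ?_, fun a ha b hb => hn3 a ha b ?_⟩
      · rw [List.nodup_append]
        refine ⟨hn2.sublist sel_sublist, hn2.sublist sel_sublist, fun a ha b hb => ?_⟩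
        rintro rfl
        exact (mem_sel.1 hb).2 ha
      · rcases List.mem_append.1 hb with hb | hb
        · exact (mem_sel.1 hb).1
        · exact (mem_sel.1 hb).1
    obtain ⟨hk1, hk2⟩ := ih _ (by omega) (S ++ I.region S F U) (sel (· ∉ I.region S F U) F) (k + 1)
      rfl hRnd (hF.mono (ind_mono fun z hz => (mem_sel.1 hz).1))
    have h6 : (1 : ℝ) ≤ 6 ^ k := one_le_pow₀ (by norm_num)
    have h6M : 1 ≤ 6 ^ k * M := one_le_mul_of_one_le_of_one_le h6 hmu
    have hU3r : (U.length : ℝ) ≤ 3 := by exact_mod_cast hU3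
    set Q : ℝ := p * (2 * F.length - 1) with hQ
    have hQ0 : 0 ≤ Q := mul_nonneg hp0 (by linarith)
    obtain ⟨K, hK, hDK⟩ : ∃ K, I.Solves (S ++ I.region S F U) (sel (· ∉ I.region S F U) F) (k + 1)
        K ∧ U.length * (Q * (6 ^ k * M)) + K ≤ Q * (6 ^ (k + 1) * M) + p := by
      -- If the kept set is good, `mu_keep` balances the branches. Otherwise the keep branch costs
      -- only `p`, and at most three deletions use at most half of the available `6`.
      by_cases hG' : I.net.Good (I.net.ind (vset (S ++ I.region S F U)))
      · obtain ⟨out, t, ha, hfn, ht⟩ := hk1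
        refine ⟨_, ⟨out, t, ha, hfn, ht.trans (hbound hRless pow_mul_mu_nonneg)⟩, ?_⟩
        rw [vset_diff, vset_append, vset_region]
        rw [vset_append, vset_region] at hG'
        have := mu_keep hd (Set.toFinite _) hUF hUt hG'
        rw [← hM] at this
        set M' := I.net.mu (vset S ∪ I.net.reg (vset S) (vset F) (vset U))
          (vset F \ I.net.reg (vset S) (vset F) (vset U))
        calc U.length * (Q * (6 ^ k * M)) + Q * (6 ^ (k + 1) * M')
            = Q * 6 ^ k * (U.length * M + 6 * M') := by ring
          _ ≤ Q * 6 ^ k * (6 * M) := by gcongr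
          _ = Q * (6 ^ (k + 1) * M) := by ring
          _ ≤ _ := by linarith
      · refine ⟨p, hk2 hG', ?_⟩
        have h0 : 0 ≤ Q * (6 ^ k * M) := by positivity
        rw [pow_succ]
        nlinarith
    obtain ⟨out, t, ha, hfn, htt⟩ := hb I (N + 3) ⟨h.n.trans (by omega), h.m.trans (by omega)⟩
      S F U k _ K hnd (by omega) hUF hdel hK
    refine Or.inr ⟨hS, out, t + O, ha, Fn.intro rfl (Ev.mono
      (Ev.ite (t := T1 N + 2 * T2 N + t + 200) hcall (fun h => absurd hbad' h)
        fun _ _ _ => ?_) ?_), ?_⟩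
    · refine (Ev.case_node (.fst (.var rfl)) (.ite (t := 2 * T2 N + t + 100) (.call (.node
        (.fst (.snd (.snd (.var rfl)))) (.fst (.snd (.var rfl)))) hbadS)
        (fun _ => ?_) fun h _ _ => absurd hS h)).mono (by omega)
      exact (Ev.case_node (.call (.node (.snd (.var rfl)) (.call (.snd (.snd (.snd (.var rfl))))
        hc)) ht) (.call (.node (.var rfl) (.node (.var rfl) (.node (.var rfl) (.snd (.var rfl)))))
          hfn)).mono (by omega)
    · omega
    · have hpr : (p : ℝ) = 4 * (L (N + 3) : ℝ) + O := by rw [hpO]; push_cast; ring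
      have hL0 : (0 : ℝ) ≤ (L (N + 3) : ℝ) := Nat.cast_nonneg _
      push_cast
      -- One `p` pays for `O` and the four overheads, the other for a keep branch that stops at
      -- once.
      have e1 : (t : ℝ) + O ≤ Q * (6 ^ (k + 1) * M) + 2 * p := by nlinarith
      refine e1.trans ?_
      have e2 : (p : ℝ) * (2 * F.length + 1) * (6 ^ (k + 1) * M) =
          Q * (6 ^ (k + 1) * M) + 2 * p * (6 ^ (k + 1) * M) := by rw [hQ]; ring
      rw [e2]
      have e3 : 1 ≤ 6 ^ (k + 1) * M := by rw [pow_succ]; nlinarith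
      have e4 : 2 * (p : ℝ) * 1 ≤ 2 * p * (6 ^ (k + 1) * M) := by gcongr
      linarith

end EvenCycle

namespace EvenCycle

open TreeMachine Net

/-! ### Correctness and running time of the program -/

theorem Inst.sol_iff (I : Inst) (X : Finset (Fin I.n)) :
    I.net.Sol (I.S : Set (Fin I.n)) (I.S : Set (Fin I.n))ᶜ I.k X ↔ I.IsSolution X := by
  rw [Net.Sol, Inst.IsSolution, Inst.isOddCactusForest_iff, Set.union_compl_self,
    ← Set.compl_eq_univ_sdiff, Set.subset_compl_iff_disjoint_right, Finset.disjoint_coe]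

/-- In `Inst.enc` and `Inst.IsAnswer` a list of vertices is coerced to a list of numbers by a
monadic bind; this identifies it with the encoding vertex by vertex. -/
theorem eVs_eq {n : ℕ} (l : List (Fin n)) :
    eVs l = encList ((do let a ← l; pure (a : ℕ)).map fun x => encNat x) := by
  have h : (do let a ← l; pure (a : ℕ)) = l.map Fin.val := by
    rw [← map_eq_pure_bind, List.map_eq_map]
  rw [h, List.map_map]
  rfl

theorem Inst.enc_eq (I : Inst) : I.enc = .node (encNat I.n) (.node
    (encL I.encEdge (List.finRange I.m))
    (.node (eVs ((List.finRange I.n).filter (· ∈ I.S))) (encNat I.k))) := by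
  rw [eVs_eq]
  rfl

theorem spec_main : ∃ T, PolyBd T ∧ ∀ I : Inst, I.IsValid → I.S.card ≤ I.k + 1 →
    ∃ (out : Data) (t : ℕ), I.IsAnswer out ∧ Fn prog 0 I.enc out t ∧
      (t : ℝ) ≤ T (I.n + I.m + 1) * (16.64 : ℝ) ^ I.k := by
  obtain ⟨T1, hT1, h1⟩ := spec_diff
  obtain ⟨T2, hT2, h2⟩ := spec_solve
  refine ⟨fun N => T2 N * (2 * N + 1) * 3 + (T1 N + 60 * (N + 1) + 300), by fun_prop,
    fun I hI hk => ?_⟩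
  obtain ⟨N, hN⟩ : ∃ N, N = I.n + I.m + 1 := ⟨_, rfl⟩
  have hsz : I.Sz N := ⟨by omega, by omega⟩
  obtain ⟨L, hLn, hL, hr⟩ := fn_range I.n
  set S := (List.finRange I.n).filter (· ∈ I.S) with hS
  set F := sel (· ∉ S) L with hF
  have hSn : S.Nodup := (List.nodup_finRange _).filter _
  have hSv : vset S = (I.S : Set (Fin I.n)) := by ext; simp [hS, vset]
  have hFv : vset F = (I.S : Set (Fin I.n))ᶜ := by
    rw [← hSv, hF, vset_diff]
    ext x
    simp [mem_vset, hL]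
  have hnd : (S ++ F).Nodup := by
    refine List.nodup_append.2 ⟨hSn, hLn.sublist sel_sublist, ?_⟩
    rintro a ha _ hb rfl
    exact (mem_sel.1 hb).2 ha
  have hlS := length_of_nodup hsz hSn
  have hlL := length_of_nodup hsz hLn
  have hlF : F.length ≤ N := length_sel_le.trans (by omega)
  have hgood : I.net.Good (I.net.ind (vset F)) := by
    rw [hFv]
    exact I.isOddCactusForest_iff.1 hI
  obtain ⟨out, t, ha, hfn, ht⟩ := (h2 I N hsz _ S F I.k rfl hnd hgood).1
  refine ⟨out, t + (T1 N + 60 * (N + 1) + 300), ?_, ?_, ?_⟩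
  · rw [Inst.Ans, hSv, hFv] at ha
    rcases ha with ⟨l, rfl, hl⟩ | ⟨rfl, h⟩
    · exact Or.inl ⟨l, by rw [eVs_eq], (I.sol_iff _).1 hl⟩
    · exact Or.inr ⟨rfl, fun X hX => h X ((I.sol_iff X).2 hX)⟩
  · have hnum := fn_number I.encEdge (List.finRange I.m) 0
    rw [← I.eG_eq, List.length_finRange] at hnum
    rw [I.enc_eq]
    refine Fn.intro rfl (Ev.mono (Ev.bind (.call (.node .nil (.fst (.snd (.var rfl)))) hnum) (.bind
      (x := eVs S) (.fst (.snd (.snd (.var rfl)))) (.call (.node (.snd (.snd (.snd (.var rfl))))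
        (.node (.var rfl) (.node (.var rfl) (.call (.node (.var rfl) (.call (.fst (.var rfl)) hr))
          (h1 I N hsz S L (by omega) (by omega)))))) hfn))) ?_)
    omega
  · rw [← hN]
    have hmu := mu_initial (N := I.net) (F := vset F) (k := I.k) (Set.toFinite (vset S))
      (by rw [hSv, Set.ncard_coe_finset]; exact hk)
    have h16 : (1 : ℝ) ≤ 16.64 ^ I.k := one_le_pow₀ (by norm_num)
    have hlF' : (F.length : ℝ) ≤ N := by exact_mod_cast hlF
    have hb : (t : ℝ) ≤ T2 N * (2 * N + 1) * (3 * 16.64 ^ I.k) :=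
      ht.trans (mul_le_mul (by gcongr) hmu pow_mul_mu_nonneg (by positivity))
    have hc : ((T1 N + 60 * (N + 1) + 300 : ℕ) : ℝ) ≤
        ((T1 N + 60 * (N + 1) + 300 : ℕ) : ℝ) * 16.64 ^ I.k :=
      le_mul_of_one_le_right (Nat.cast_nonneg _) h16
    push_cast at hc ⊢
    linarith

end EvenCycle

/-- One program finds, on every instance with `|S| ≤ k + 1`, a solution or reports that there is
none, within `16.64 ^ k` times a polynomial in the numbers of vertices and edges. -/
theorem lemma6 :
    ∃ (P : TreeMachine.Program) (c d : ℕ),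
      ∀ I : EvenCycle.Inst, I.IsValid → I.S.card ≤ I.k + 1 →
        ∃ (out : TreeMachine.Data) (t : ℕ),
          TreeMachine.Runs P I.enc out t ∧
          I.IsAnswer out ∧
          (t : ℝ) ≤ c * (16.64 : ℝ) ^ I.k * ((I.n : ℝ) + I.m + 1) ^ d := by
  obtain ⟨T, ⟨d, hd⟩, h⟩ := EvenCycle.spec_main
  -- The constant comes from `n + m + 3 ≤ 3 * (n + m + 1)`, raised to the power `d`.
  refine ⟨EvenCycle.prog, 3 ^ d, d, fun I hI hk => ?_⟩
  obtain ⟨out, t, ha, ⟨body, hbody, t', htt, hev⟩, ht⟩ := h I hI hk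
  refine ⟨out, t', ⟨body, hbody, hev⟩, ha, ?_⟩
  have hT : (T (I.n + I.m + 1) : ℝ) ≤ 3 ^ d * ((I.n : ℝ) + I.m + 1) ^ d := by
    rw [← mul_pow]
    calc (T (I.n + I.m + 1) : ℝ) ≤ ((I.n + I.m + 1 + 2) ^ d : ℕ) := by exact_mod_cast hd _
      _ ≤ _ := by
        push_cast
        have h1 : (0 : ℝ) ≤ I.n := Nat.cast_nonneg _
        have h2 : (0 : ℝ) ≤ I.m := Nat.cast_nonneg _
        gcongr
        linarith
  calc (t' : ℝ) ≤ t := by exact_mod_cast htt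
    _ ≤ T (I.n + I.m + 1) * (16.64 : ℝ) ^ I.k := ht
    _ ≤ 3 ^ d * ((I.n : ℝ) + I.m + 1) ^ d * (16.64 : ℝ) ^ I.k := by gcongr
    _ = _ := by push_cast; ring
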